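/- Let $1\le\alpha<2$, let $r\ge 2$ be an integer and let $R>0$. Let $\phi\in C^\infty(\mathbb R)$ be a weight with $1\le\phi\le 2+2R$, $\phi_x=1$ for $|x|<R$, $\phi_x=0$ for $|x|\ge R+1$, $0\le\phi_x\le1$ and $\sqrt{\phi_x}\in C_c^\infty(\mathbb R)$. Let $\langle\cdot,\cdot\rangle$ be the inner product of $L^2(\mathbb R)$, let $\|u\|_{2,\phi}=\langle u,u\phi\rangle^{1/2}$, and let $\mathcal D^{s}=(-\Delta)^{s/2}$. For $\Delta x>0$ let $S_{\Delta x}$ be the space of all $v\in H^{1+\alpha}(\mathbb R)$ that are polynomials of degree at most $r$ on each cell $[(j-1)\Delta x,j\Delta x]$, $j\in\mathbb Z$. Given $u^n\in S_{\Delta x}$ and $\Delta t>0$, one step of the Crank–Nicolson Galerkin scheme asks for $u^{n+1}\in S_{\Delta x}$ such that, with $u^{n+1/2}=(u^{n+1}+u^n)/2$, $$\langle u^{n+1},\phi v\rangle-\Delta t\Big\langle\tfrac{(u^{n+1/2})^2}{2},(\phi v)_x\Big\rangle+\Delta t\big\langle\mathcal D^{\alpha/2}u^{n+1/2},\mathcal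 D^{\alpha/2}(\phi v)_x\big\rangle=\langle u^n,\phi v\rangle\qquad\text{for all }v\in S_{\Delta x}. \tag{1}$$ The fixed-point iteration for (1) is $w^0=u^n$ and, for $\ell\ge0$, $w^{\ell+1}\in S_{\Delta x}$ with $$\langle w^{\ell+1},\phi v\rangle-\tfrac{\Delta t}{2}\Big\langle\Big(\tfrac{w^\ell+u^n}{2}\Big)^2,(\phi v)_x\Big\rangle+\Delta t\Big\langle\mathcal D^{\alpha/2}\tfrac{w^{\ell+1}+u^n}{2},\mathcal D^{\alpha/2}(\phi v)_x\Big\rangle=\langle u^n,\phi v\rangle\qquad\text{for all }v\in S_{\Delta x}. \tag{2}$$ Then there are a constant $C_2>0$ that depends only on $r$, and a $\Delta t_0>0$ that depends only on $r$, $\alpha$ and $\phi$, such that the following holds for all $\Delta x>0$, all $0<\Delta t\le\Delta t_0$, all $0<L<1$ and all $u^n\in S_{\Delta x}$. Put $K=\frac{5-L}{1-L}$ and $\lambda=\Delta t/\Delta x^{3/2}$, and assume the CFL condition $$\lambda\le\frac{L}{2\sqrt{C_2}\,K\,\|u^n\|_{2,\phi}}$$ (which is no restriction if $u^n=0$). Then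 a sequence of iterates $(w^\ell)$ as in (2) exists, and there is a solution $u^{n+1}\in S_{\Delta x}$ of (1) such that $\|w^\ell-u^{n+1}\|_{2,\phi}\to0$ as $\ell\to\infty$ for every such sequence, and $$\|u^{n+1}\|_{2,\phi}\le K\,\|u^n\|_{2,\phi}.$$ -/

import Mathlib

open MeasureTheory Filter Topology

namespace FKdV

/-- A real function `f` regarded as an element of the complex space `L²(ℝ)`
(the value is `0` if `f` is not square integrable). -/
noncomputable def toL2 (f : ℝ → ℝ) : Lp ℂ 2 (volume : Measure ℝ) := by
  classical
  exact if h : MemLp (fun x => (f x : ℂ)) 2 (volume : Measure ℝ) then h.toLp _ else 0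

/-- The function `f` lies in the Sobolev (Bessel potential) space `H^s(ℝ)`, for `s ≥ 0`. -/
def MemH (s : ℝ) (f : ℝ → ℝ) : Prop :=
  MemLp (fun x => (f x : ℂ)) 2 (volume : Measure ℝ) ∧
    TemperedDistribution.MemSobolev s 2 (Lp.toTemperedDistribution (toL2 f))

/-- The Fourier transform of `𝓓^s f`, where `𝓓 = (-Δ)^{1/2}`. In Mathlib's normalisation
`𝓕 f(ξ) = ∫ e^{-2πi xξ} f(x) dx`, so that the symbol of `𝓓^s` is `(2π|ξ|)^s`. -/
noncomputable def fracFourier (s : ℝ) (f : ℝ → ℝ) : ℝ → ℂ := fun ξ =>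
  (((2 * Real.pi * |ξ|) ^ s : ℝ) : ℂ) *
    (FourierTransform.fourier (toL2 f) : Lp ℂ 2 (volume : Measure ℝ)) ξ

/-- The fractional derivative `𝓓^s f = (-Δ)^{s/2} f` of `f ∈ H^s(ℝ)`, as an element of `L²(ℝ)`
(the value is `0` if `f` is not in `H^s(ℝ)`). -/
noncomputable def fracD (s : ℝ) (f : ℝ → ℝ) : Lp ℂ 2 (volume : Measure ℝ) := by
  classical
  exact if h : MemLp (fracFourier s f) 2 (volume : Measure ℝ)
    then FourierTransformInv.fourierInv (h.toLp _) else 0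

/-- The `L²` inner product `⟨𝓓^s f, 𝓓^s g⟩`. As `f` and `g` are real, so are `𝓓^s f` and `𝓓^s g`,
and the complex inner product is a real number; `.re` only changes its type. -/
noncomputable def fracInner (s : ℝ) (f g : ℝ → ℝ) : ℝ :=
  (inner ℂ (fracD s f) (fracD s g)).re

/-- The `L²` inner product `⟨f, g⟩` of real functions. -/
noncomputable def ip (f g : ℝ → ℝ) : ℝ := ∫ x, f x * g x

/-- The weighted norm `‖u‖_{2,φ} = ⟨u, u φ⟩^{1/2}`. -/
noncomputable def wnorm (φ u : ℝ → ℝ) : ℝ := Real.sqrt (ip u (u * φ))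

/-- The smooth cut-off (weight) function with parameter `R`. -/
structure IsCutoff (R : ℝ) (φ : ℝ → ℝ) : Prop where
  smooth : ContDiff ℝ (⊤ : ℕ∞) φ
  one_le : ∀ x, 1 ≤ φ x
  le : ∀ x, φ x ≤ 2 + 2 * R
  deriv_eq_one : ∀ x, |x| < R → deriv φ x = 1
  deriv_eq_zero : ∀ x, R + 1 ≤ |x| → deriv φ x = 0
  deriv_nonneg : ∀ x, 0 ≤ deriv φ x
  deriv_le_one : ∀ x, deriv φ x ≤ 1
  sqrt_smooth : ContDiff ℝ (⊤ : ℕ∞) (fun x => Real.sqrt (deriv φ x))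
  sqrt_compact : HasCompactSupport (fun x => Real.sqrt (deriv φ x))

/-- The finite element space `S_{Δx}`: functions in `H^{1+α}(ℝ)` that are polynomials of degree at
most `r` on every cell `I_j = [(j-1)Δx, jΔx]`. As the cells are closed and overlap in the nodes,
the elements are continuous, i.e. the continuous representatives of their classes; since
`1 + α ≥ 2` they are even `C¹`, so that `deriv` is their weak derivative. -/
def femSpace (α : ℝ) (r : ℕ) (dx : ℝ) : Set (ℝ → ℝ) :=
  {v | MemH (1 + α) v ∧ ∀ j : ℤ, ∃ p : Polynomial ℝ, p.natDegree ≤ r ∧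
    ∀ x ∈ Set.Icc (((j : ℝ) - 1) * dx) ((j : ℝ) * dx), v x = p.eval x}

/-- `unext ∈ S_{Δx}` solves one step of the implicit Crank-Nicolson Galerkin scheme from `u`:
`⟨u⁺, φv⟩ - Δt ⟨(ū)²/2, (φv)_x⟩ + Δt ⟨𝓓^{α/2} ū, 𝓓^{α/2} (φv)_x⟩ = ⟨u, φv⟩` for all
`v ∈ S_{Δx}`, where `ū = (u⁺ + u)/2`. -/
def SolvesCN (α : ℝ) (r : ℕ) (dx dt : ℝ) (φ u unext : ℝ → ℝ) : Prop :=
  unext ∈ femSpace α r dx ∧ ∀ v ∈ femSpace α r dx,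
    ip unext (φ * v)
      - dt * ip (fun x => ((unext x + u x) / 2) ^ 2 / 2) (deriv (φ * v))
      + dt * fracInner (α / 2) (fun x => (unext x + u x) / 2) (deriv (φ * v))
    = ip u (φ * v)

/-- `w : ℕ → S_{Δx}` is a sequence of iterates of the (linearised) fixed-point scheme started at
`w⁰ = u`: for all `ℓ` and all `v ∈ S_{Δx}`,
`⟨w^{ℓ+1}, φv⟩ - (Δt/2) ⟨((w^ℓ+u)/2)², (φv)_x⟩
  + Δt ⟨𝓓^{α/2} ((w^{ℓ+1}+u)/2), 𝓓^{α/2} (φv)_x⟩ = ⟨u, φv⟩`. -/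
def IsIteration (α : ℝ) (r : ℕ) (dx dt : ℝ) (φ u : ℝ → ℝ) (w : ℕ → ℝ → ℝ) : Prop :=
  w 0 = u ∧ (∀ l, w l ∈ femSpace α r dx) ∧ ∀ l, ∀ v ∈ femSpace α r dx,
    ip (w (l + 1)) (φ * v)
      - dt / 2 * ip (fun x => ((w l x + u x) / 2) ^ 2) (deriv (φ * v))
      + dt * fracInner (α / 2) (fun x => (w (l + 1) x + u x) / 2) (deriv (φ * v))
    = ip u (φ * v)

end FKdV

/-! The argument lives in a Hilbert space of coefficient sequences. A function in S_Δx is an ℓ²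
sequence of coefficient vectors, one per cell, and the H^{1+α} regularity becomes node conditions: v
and v_x match at every node, and v_xx matches as well when α ≥ 3/2, because H^s admits jumps exactly
for s < 1/2 (`mem_femSpace_iff`). These conditions are closed, so the space is complete, and for
fixed Δx the weighted norm is equivalent to the ℓ² norm.

A step of the iteration is a linear equation for w^{ℓ+1} + u^n with the form ⟨x, φv⟩ +
(Δt/2)⟨𝓓^{α/2}x, 𝓓^{α/2}(φv)_x⟩. For small Δt it is coercive by the commutator estimate ⟨𝓓^{α/2}w,
𝓓^{α/2}(φw)_x⟩ ≥ -C‖w‖² (`IsCutoff.fracInner_lower`). To see this, the left side is written as an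
integral of products of increments δ_z against the kernel z^{-1-α} (`integral_incr₂`). Up to a total
x-derivative, 2 δ_z w · δ_z(φw)_x is ∂_z((δ_z w)² δ_z φ) plus δ_z(w²) δ_z φ_x. The last term becomes
w² times a second difference of φ_x, which is O(min(z², 1)). The ∂_z term is integrated by parts in
z: as φ increases and the kernel decreases, everything is nonnegative except a boundary term
O(ε^{2-α}), which vanishes in the limit. Lax–Milgram then gives a unique solution operator T for one
step.

The nonlinearity satisfies Q(x) - Q(y) = ⟨(x - y)(x + y), (φv)_x⟩. After an integration by parts it
is controlled by the inverse inequality ‖v_x‖_∞ ≤ B Δx^{-3/2}‖v‖_{2,φ} (`exists_abs_dfem_le`), where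
B comes from the reference cell and depends only on r. Under the CFL condition T maps the ball of
radius K‖u^n‖ into itself and contracts it by 1/2; the limit of the orbit of u^n is the solution,
and unique solvability makes every sequence of iterates equal to that orbit (`exists_scheme`). -/

namespace FKdV

open FourierTransform

/-! ### The L² Fourier transform: translations and derivatives -/

/-- The `L²` Fourier transform of a real function. -/
noncomputable abbrev ft (f : ℝ → ℝ) : Lp ℂ 2 (volume : Measure ℝ) := 𝓕 (toL2 f)

theorem toL2_eq {f : ℝ → ℝ} (hf : MemLp f 2) : toL2 f = (hf.ofReal (K := ℂ)).toLp _ := by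
  have hf' : MemLp (fun x => (f x : ℂ)) 2 (volume : Measure ℝ) := hf.ofReal
  simp [toL2, hf']

theorem memLp_real_iff {f : ℝ → ℝ} :
    MemLp (fun x => (f x : ℂ)) 2 (volume : Measure ℝ) ↔ MemLp f 2 :=
  ⟨fun h => by simpa using h.re, fun h => h.ofReal⟩

theorem toL2_add {f g : ℝ → ℝ} (hf : MemLp f 2) (hg : MemLp g 2) :
    toL2 (f + g) = toL2 f + toL2 g := by
  rw [toL2_eq hf, toL2_eq hg, toL2_eq (hf.add hg), ← MemLp.toLp_add]
  congr 1
  ext x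
  simp

theorem toL2_smul {f : ℝ → ℝ} (c : ℝ) (hf : MemLp f 2) :
    toL2 (c • f) = (c : ℂ) • toL2 f := by
  rw [toL2_eq hf, toL2_eq (hf.const_smul c), ← MemLp.toLp_const_smul]
  congr 1
  ext x
  simp

theorem norm_toL2_sq {f : ℝ → ℝ} (hf : MemLp f 2) : ‖toL2 f‖ ^ 2 = ∫ x, f x ^ 2 := by
  have h := @L2.inner_def ℝ ℂ ℂ _ _ _ _ _ (toL2 f) (toL2 f)
  have h2 : ((‖toL2 f‖ ^ 2 : ℝ) : ℂ) = ((∫ x, f x ^ 2 : ℝ) : ℂ) := by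
    rw [inner_self_eq_norm_sq_to_K] at h
    push_cast
    refine Eq.trans (by simpa using h) ?_
    rw [← integral_complex_ofReal]
    refine integral_congr_ae ?_
    rw [toL2_eq hf]
    filter_upwards [(hf.ofReal (K := ℂ)).coeFn_toLp] with x hx
    rw [hx]
    simp [sq, ← Complex.ofReal_mul]
  exact_mod_cast h2

theorem norm_ft_sq {f : ℝ → ℝ} (hf : MemLp f 2) : ‖ft f‖ ^ 2 = ∫ x, f x ^ 2 := by
  rw [ft, Lp.norm_fourier_eq, norm_toL2_sq hf]

/-- This is 𝓕T(η) = T(𝓕η) for the tempered distribution of f. Through `ae_eq_of_test` it reduces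
almost everywhere formulas for `ft` to formulas for 𝓕η with η smooth and compactly supported. -/
theorem integral_test_mul_ft {f : ℝ → ℝ} (hf : MemLp f 2) {η : ℝ → ℂ}
    (hη : ContDiff ℝ (⊤ : ℕ∞) η) (hc : HasCompactSupport η) :
    ∫ ξ, η ξ * ft f ξ = ∫ x, 𝓕 η x * (f x : ℂ) := by
  have h := congrArg (fun T => T (hc.toSchwartzMap hη))
    (Lp.fourier_toTemperedDistribution_eq (toL2 f))
  simp only [TemperedDistribution.fourier_apply, Lp.toTemperedDistribution_apply, smul_eq_mul] at h
  refine h.symm.trans ?_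
  rw [toL2_eq hf]
  refine integral_congr_ae ?_
  filter_upwards [(hf.ofReal (K := ℂ)).coeFn_toLp] with x hx
  rw [hx, SchwartzMap.fourier_coe]
  rfl

theorem ft_add {f g : ℝ → ℝ} (hf : MemLp f 2) (hg : MemLp g 2) :
    ft (f + g) =ᵐ[volume] fun ξ => ft f ξ + ft g ξ := by
  rw [ft, toL2_add hf hg, FourierTransform.fourier_add]
  exact Lp.coeFn_add _ _

theorem ft_smul {f : ℝ → ℝ} (c : ℝ) (hf : MemLp f 2) :
    ft (c • f) =ᵐ[volume] fun ξ => (c : ℂ) * ft f ξ := by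
  rw [ft, toL2_smul c hf, FourierTransform.fourier_smul]
  exact Lp.coeFn_smul _ _

/-- `f` is continuous with right derivative `f'` everywhere, and both are square integrable. -/
structure HasL2Deriv (f f' : ℝ → ℝ) : Prop where
  cont : Continuous f
  deriv : ∀ x, HasDerivWithinAt f (f' x) (Set.Ioi x) x
  mem : MemLp f 2
  mem' : MemLp f' 2

/-- No decay of G at infinity is assumed. The difference G(n) - G(-n) tends to the integral of G'
and is itself integrable in n; a nonzero limit would keep it away from 0 on a half-line of infinite
measure. Right derivatives suffice, which admits piecewise polynomials whose derivative jumps at the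
nodes. -/
theorem integral_right_deriv_eq_zero {E : Type*} [NormedAddCommGroup E] [NormedSpace ℝ E]
    [CompleteSpace E] {G G' : ℝ → E} (hc : Continuous G)
    (hd : ∀ x, HasDerivWithinAt G (G' x) (Set.Ioi x) x) (hi : Integrable G) (hi' : Integrable G') :
    ∫ x, G' x = 0 := by
  have key : ∀ n : ℝ, ∫ x in (-n)..n, G' x = G n - G (-n) := fun n =>
    intervalIntegral.integral_eq_sub_of_hasDeriv_right hc.continuousOn (fun x _ => hd x)
      hi'.intervalIntegrable
  have h1 : Tendsto (fun n : ℝ => ∫ x in (-n)..n, G' x) atTop (𝓝 (∫ x, G' x)) :=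
    intervalIntegral_tendsto_integral hi' tendsto_neg_atTop_atBot tendsto_id
  simp_rw [key] at h1
  have h2 : Integrable (fun n => G n - G (-n)) := hi.sub hi.comp_neg
  by_contra hne
  have h3 : ∀ᶠ n : ℝ in atTop, ‖∫ x, G' x‖ / 2 < ‖G n - G (-n)‖ := by
    refine h1.norm.eventually (lt_mem_nhds ?_)
    have := norm_pos_iff.2 hne
    linarith
  obtain ⟨N, hN⟩ := eventually_atTop.1 h3
  have hpos : 0 < ‖∫ x, G' x‖ / 2 := by have := norm_pos_iff.2 hne; linarith
  have h4 := h2.measure_norm_ge_lt_top hpos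
  have h5 : Set.Ici N ⊆ {a | ‖∫ x, G' x‖ / 2 ≤ ‖G a - G (-a)‖} := fun a ha => (hN a ha).le
  have h6 := measure_mono (μ := volume) h5
  rw [Real.volume_Ici] at h6
  exact absurd (lt_of_le_of_lt h6 h4) (lt_irrefl _)

/-- Two locally integrable functions that agree against test functions agree almost everywhere. -/
theorem ae_eq_of_test {h₁ h₂ : ℝ → ℂ} (l₁ : LocallyIntegrable h₁) (l₂ : LocallyIntegrable h₂)
    (H : ∀ η : ℝ → ℂ, ContDiff ℝ (⊤ : ℕ∞) η → HasCompactSupport η →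
      ∫ x, η x * h₁ x = ∫ x, η x * h₂ x) : h₁ =ᵐ[volume] h₂ := by
  refine ae_eq_of_integral_contDiff_smul_eq l₁ l₂ fun g hg hc => ?_
  have := H (fun x => (g x : ℂ)) (Complex.ofRealCLM.contDiff.comp hg)
    (hc.comp_left (g := fun t : ℝ => (t : ℂ)) Complex.ofReal_zero)
  simpa only [Complex.real_smul] using this

theorem locallyIntegrable_Lp (h : Lp ℂ 2 (volume : Measure ℝ)) : LocallyIntegrable h :=
  (Lp.memLp h).locallyIntegrable (by norm_num)

theorem contDiff_linear_I (a : ℝ) :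
    ContDiff ℝ (⊤ : ℕ∞) fun ξ : ℝ => ((a * ξ : ℝ) : ℂ) * Complex.I :=
  (Complex.ofRealCLM.contDiff.comp (contDiff_const.mul contDiff_id)).mul contDiff_const

theorem ft_translate {f : ℝ → ℝ} (hf : MemLp f 2) (z : ℝ) :
    ft (fun x => f (x + z)) =ᵐ[volume]
      fun ξ => Complex.exp ((2 * Real.pi * z * ξ : ℝ) * Complex.I) * ft f ξ := by
  have hfz : MemLp (fun x => f (x + z)) 2 :=
    hf.comp_measurePreserving (measurePreserving_add_right volume z)
  have hde : ContDiff ℝ (⊤ : ℕ∞) fun ξ : ℝ =>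
      Complex.exp ((2 * Real.pi * z * ξ : ℝ) * Complex.I) := (contDiff_linear_I _).cexp
  refine ae_eq_of_test (locallyIntegrable_Lp _)
    ((locallyIntegrable_Lp (ft f)).continuous_smul hde.continuous) fun η hη hc => ?_
  have h2 := integral_test_mul_ft hf (hη.mul hde) hc.mul_right
  rw [integral_test_mul_ft hfz hη hc]
  simp_rw [← mul_assoc]
  rw [h2, ← integral_add_right_eq_self (fun x => (𝓕 (fun x => η x *
    Complex.exp ((2 * Real.pi * z * x : ℝ) * Complex.I)) : ℝ → ℂ) x * (f x : ℂ)) z]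
  congr 1
  ext x
  congr 1
  rw [Real.fourier_real_eq_integral_exp_smul, Real.fourier_real_eq_integral_exp_smul]
  congr 1
  ext ξ
  rw [smul_eq_mul, smul_eq_mul, mul_comm (η ξ), ← mul_assoc, ← Complex.exp_add]
  congr 2
  push_cast
  ring

/-- Tested against η, this is integration by parts of 𝓕η · f, since (𝓕η)' is the Fourier transform
of -2πiξ η(ξ). -/
theorem HasL2Deriv.ft_deriv {f f' : ℝ → ℝ} (h : HasL2Deriv f f') :
    ft f' =ᵐ[volume] fun ξ => ((2 * Real.pi * ξ : ℝ) * Complex.I) * ft f ξ := by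
  have hde := contDiff_linear_I (2 * Real.pi)
  refine ae_eq_of_test (locallyIntegrable_Lp _)
    ((locallyIntegrable_Lp (ft f)).continuous_smul hde.continuous) fun η hη hc => ?_
  have h2 := integral_test_mul_ft h.mem (hη.mul hde) hc.mul_right
  rw [integral_test_mul_ft h.mem' hη hc]
  refine Eq.trans ?_ (h2.symm.trans (by congr 1; ext ξ; exact mul_assoc _ _ _))
  -- As a Schwartz function, 𝓕η is square integrable together with its derivative, so all products
  -- with f and f' below are integrable.
  set S := hc.toSchwartzMap hη with hS
  have hSη : (S : ℝ → ℂ) = η := rfl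
  set T := (𝓕 S : SchwartzMap ℝ ℂ) with hT
  have hTη : (T : ℝ → ℂ) = 𝓕 η := by rw [hT, SchwartzMap.fourier_coe, hSη]
  have hηi : Integrable η := hη.continuous.integrable_of_hasCompactSupport hc
  have hηi' : Integrable fun x : ℝ => x • η x :=
    (continuous_id.smul hη.continuous).integrable_of_hasCompactSupport hc.smul_left
  have hd : ∀ x, HasDerivAt (𝓕 η)
      (-𝓕 (fun ξ : ℝ => η ξ * (((2 * Real.pi * ξ : ℝ) : ℂ) * Complex.I)) x) x := by
    intro x
    refine (Real.hasDerivAt_fourier hηi hηi' x).congr_deriv ?_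
    rw [Real.fourier_real_eq_integral_exp_smul, Real.fourier_real_eq_integral_exp_smul,
      ← integral_neg]
    congr 1
    ext ξ
    simp only [smul_eq_mul]
    push_cast
    ring
  have hT2 : MemLp (𝓕 η) 2 := by rw [← hTη]; exact T.memLp 2
  have hdT : _root_.deriv (𝓕 η) = fun x => -𝓕 (fun ξ : ℝ => η ξ * (((2 * Real.pi * ξ : ℝ) : ℂ) * Complex.I)) x :=
    funext fun x => (hd x).deriv
  have hT2' : MemLp (fun x => -𝓕 (fun ξ : ℝ => η ξ * (((2 * Real.pi * ξ : ℝ) : ℂ) * Complex.I)) x) 2 := by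
    rw [← hdT, ← hTη]
    exact (SchwartzMap.derivCLM ℂ ℂ T).memLp 2
  have hf : MemLp (fun x => (f x : ℂ)) 2 := h.mem.ofReal
  have hf' : MemLp (fun x => (f' x : ℂ)) 2 := h.mem'.ofReal
  have i1 := hT2.integrable_mul hf
  have i2 := hT2.integrable_mul hf'
  have i3 := hT2'.integrable_mul hf
  have h0 := integral_right_deriv_eq_zero
    (G := fun x => 𝓕 η x * (f x : ℂ))
    (G' := fun x => -𝓕 (fun ξ : ℝ => η ξ * (((2 * Real.pi * ξ : ℝ) : ℂ) * Complex.I)) x * (f x : ℂ)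
      + 𝓕 η x * (f' x : ℂ))
    ((continuous_iff_continuousAt.2 fun x => (hd x).continuousAt).mul
      (Complex.continuous_ofReal.comp h.cont))
    (fun x => (hd x).hasDerivWithinAt.mul (h.deriv x).ofReal_comp) i1 (i3.add i2)
  have h1 := (integral_add i3 i2).symm.trans h0
  simp only [Pi.mul_apply, neg_mul, integral_neg] at h1
  linear_combination h1

end FKdV

/-! ### Fractional derivatives through increments -/

namespace FKdV
open FourierTransform

theorem norm_sq_Lp (h : Lp ℂ 2 (volume : Measure ℝ)) : ‖h‖ ^ 2 = ∫ ξ, ‖h ξ‖ ^ 2 := by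
  have e := @L2.inner_def ℝ ℂ ℂ _ _ _ _ _ h h
  have h2 : ((‖h‖ ^ 2 : ℝ) : ℂ) = ((∫ x, ‖h x‖ ^ 2 : ℝ) : ℂ) := by
    rw [inner_self_eq_norm_sq_to_K] at e
    push_cast
    refine Eq.trans (by simpa using e) ?_
    rw [← integral_complex_ofReal]
    refine integral_congr_ae (Eventually.of_forall fun x => ?_)
    simp
  exact_mod_cast h2

theorem memLp_translate {f : ℝ → ℝ} (hf : MemLp f 2) (z : ℝ) : MemLp (fun x => f (x + z)) 2 :=
  hf.comp_measurePreserving (measurePreserving_add_right volume z)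

theorem integrable_norm_sq_Lp (h : Lp ℂ 2 (volume : Measure ℝ)) :
    Integrable fun ξ => ‖h ξ‖ ^ 2 := (Lp.memLp h).norm.integrable_sq

theorem norm_exp_sub_one_sq (t : ℝ) :
    ‖Complex.exp (t * Complex.I) - 1‖ ^ 2 = 2 * (1 - Real.cos t) := by
  rw [Complex.sq_norm, Complex.normSq_apply]
  simp [Complex.exp_ofReal_mul_I_re, Complex.exp_ofReal_mul_I_im]
  nlinarith [Real.sin_sq_add_cos_sq t]

/-- The squared `L²` norm of the increment `f(· + z) - f`. -/
noncomputable def incr (f : ℝ → ℝ) (z : ℝ) : ℝ := ∫ x, (f (x + z) - f x) ^ 2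

theorem incr_nonneg (f : ℝ → ℝ) (z : ℝ) : 0 ≤ incr f z := integral_nonneg fun _ => sq_nonneg _

theorem integrable_cos_mul_sq (h : Lp ℂ 2 (volume : Measure ℝ)) (z : ℝ) :
    Integrable fun ξ => 2 * (1 - Real.cos (2 * Real.pi * z * ξ)) * ‖h ξ‖ ^ 2 := by
  refine (integrable_norm_sq_Lp h).bdd_mul (c := 4)
    (by fun_prop : Continuous _).aestronglyMeasurable (Eventually.of_forall fun ξ => ?_)
  rw [Real.norm_eq_abs, abs_le]
  constructor <;> nlinarith [Real.cos_le_one (2 * Real.pi * z * ξ),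
    Real.neg_one_le_cos (2 * Real.pi * z * ξ)]

/-- Plancherel: the increment has multiplier e^{2πizξ} - 1, and |e^{it} - 1|² = 2(1 - cos t). -/
theorem incr_eq {f : ℝ → ℝ} (hf : MemLp f 2) (z : ℝ) :
    incr f z = ∫ ξ, 2 * (1 - Real.cos (2 * Real.pi * z * ξ)) * ‖ft f ξ‖ ^ 2 := by
  have hz := memLp_translate hf z
  have hs : MemLp ((fun x => f (x + z)) + (-1 : ℝ) • f) 2 := hz.add (hf.const_smul _)
  have h1 := norm_ft_sq hs
  have h2 : incr f z = ∫ x, ((fun x => f (x + z)) + (-1 : ℝ) • f) x ^ 2 := by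
    simp [incr, sub_eq_add_neg]
  rw [h2, ← h1, norm_sq_Lp]
  refine integral_congr_ae ?_
  filter_upwards [ft_add hz (hf.const_smul (-1 : ℝ)), ft_smul (-1) hf, ft_translate hf z]
    with ξ e1 e2 e3
  rw [e1, e2, e3, ← norm_exp_sub_one_sq, ← mul_pow, ← norm_mul]
  congr 2
  push_cast
  ring

/-! ### The kernel `z ^ (-1-β)` -/

/-- The quadratic bound is used on (0, 1], where β < 2 is needed, and the uniform bound on (1, ∞),
where β > 0 is needed. -/
theorem integrableOn_kernel {β : ℝ} (h0 : 0 < β) (h2 : β < 2) {g : ℝ → ℝ} (hg : Measurable g)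
    {A B : ℝ} (hA : ∀ z, 0 < z → |g z| ≤ A * z ^ 2) (hB : ∀ z, 0 < z → |g z| ≤ B) :
    IntegrableOn (fun z => g z * z ^ (-1 - β)) (Set.Ioi 0) := by
  have m : Measurable fun z : ℝ => g z * z ^ (-1 - β) := by fun_prop
  rw [← Set.Ioc_union_Ioi_eq_Ioi (zero_le_one' ℝ)]
  refine IntegrableOn.union ?_ ?_
  · have i1 : IntegrableOn (fun z : ℝ => z ^ (1 - β)) (Set.Ioc 0 1) :=
      (intervalIntegrable_iff_integrableOn_Ioc_of_le zero_le_one).1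
        (intervalIntegral.intervalIntegrable_rpow' (by linarith))
    refine Integrable.mono' (i1.const_mul A) m.aestronglyMeasurable ?_
    refine (ae_restrict_iff' measurableSet_Ioc).2 (Eventually.of_forall fun z hz => ?_)
    rw [Real.norm_eq_abs, abs_mul, abs_of_pos (Real.rpow_pos_of_pos hz.1 _)]
    calc |g z| * z ^ (-1 - β) ≤ A * z ^ 2 * z ^ (-1 - β) := by
          gcongr
          · exact Real.rpow_nonneg hz.1.le _
          · exact hA z hz.1
      _ = A * z ^ (1 - β) := by
          rw [mul_assoc, ← Real.rpow_natCast z 2, ← Real.rpow_add hz.1]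
          congr 2
          norm_num; ring
  · have i1 : IntegrableOn (fun z : ℝ => z ^ (-1 - β)) (Set.Ioi 1) :=
      integrableOn_Ioi_rpow_of_lt (by linarith) one_pos
    refine Integrable.mono' (i1.const_mul B) m.aestronglyMeasurable ?_
    refine (ae_restrict_iff' measurableSet_Ioi).2 (Eventually.of_forall fun z hz => ?_)
    have hz0 : (0 : ℝ) < z := lt_trans one_pos hz
    rw [Real.norm_eq_abs, abs_mul, abs_of_pos (Real.rpow_pos_of_pos hz0 _)]
    gcongr
    exact hB z hz0

theorem two_mul_one_sub_cos_le (t : ℝ) : 2 * (1 - Real.cos t) ≤ t ^ 2 := by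
  nlinarith [Real.one_sub_sq_div_two_le_cos (x := t)]

theorem integrableOn_cos_kernel {β : ℝ} (h0 : 0 < β) (h2 : β < 2) :
    IntegrableOn (fun z => 2 * (1 - Real.cos z) * z ^ (-1 - β)) (Set.Ioi 0) := by
  refine integrableOn_kernel h0 h2 (A := 1) (B := 4) (by fun_prop) (fun z _ => ?_) fun z _ => ?_
  all_goals
    rw [abs_of_nonneg (by nlinarith [Real.cos_le_one z])]
  · linarith [two_mul_one_sub_cos_le z]
  · linarith [Real.neg_one_le_cos z]

/-- The constant in `∫₀^∞ 2(1 - cos(tz)) z^(-1-β) dz = kc β * |t|^β`. -/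
noncomputable def kc (β : ℝ) : ℝ := ∫ z in Set.Ioi (0 : ℝ), 2 * (1 - Real.cos z) * z ^ (-1 - β)

theorem kc_pos {β : ℝ} (h0 : 0 < β) (h2 : β < 2) : 0 < kc β := by
  rw [kc, setIntegral_pos_iff_support_of_nonneg_ae]
  · have hsub : Set.Ioo (0 : ℝ) 1 ⊆
        (Function.support fun z : ℝ => 2 * (1 - Real.cos z) * z ^ (-1 - β)) ∩ Set.Ioi 0 := by
      intro z hz
      refine ⟨?_, hz.1⟩
      have := Real.cos_lt_cos_of_nonneg_of_le_pi (le_refl 0)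
        (by linarith [hz.2, Real.pi_gt_three]) hz.1
      rw [Real.cos_zero] at this
      exact (mul_pos (by linarith) (Real.rpow_pos_of_pos hz.1 _)).ne'
    refine lt_of_lt_of_le ?_ (measure_mono hsub)
    simp
  · refine (ae_restrict_iff' measurableSet_Ioi).2 (Eventually.of_forall fun z hz => ?_)
    exact mul_nonneg (by linarith [Real.cos_le_one z]) (Real.rpow_nonneg (le_of_lt hz) _)
  · exact integrableOn_cos_kernel h0 h2

/-- The substitution z ↦ |t|z extracts the power |t|^β from the homogeneous kernel. -/
theorem lintegral_cos_kernel {β : ℝ} (h0 : 0 < β) (h2 : β < 2) (t : ℝ) :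
    ∫⁻ z in Set.Ioi (0 : ℝ), ENNReal.ofReal (2 * (1 - Real.cos (t * z)) * z ^ (-1 - β))
      = ENNReal.ofReal (kc β * |t| ^ β) := by
  rcases eq_or_ne t 0 with rfl | ht
  · simp [Real.zero_rpow h0.ne']
  have ha : 0 < |t| := abs_pos.2 ht
  have e1 : Set.EqOn (fun z : ℝ => 2 * (1 - Real.cos (t * z)) * z ^ (-1 - β))
      (fun z => |t| ^ (1 + β) *
        (2 * (1 - Real.cos (|t| * z)) * (|t| * z) ^ (-1 - β))) (Set.Ioi 0) := by
    intro z hz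
    have hz : 0 < z := hz
    have c1 : Real.cos (t * z) = Real.cos (|t| * z) := by
      rw [← Real.cos_abs (t * z), abs_mul, abs_of_pos hz]
    have c2 : |t| ^ (1 + β) * |t| ^ (-1 - β) = 1 := by
      rw [← Real.rpow_add ha]; simp
    simp only
    rw [c1, Real.mul_rpow ha.le hz.le]
    linear_combination -(2 * (1 - Real.cos (|t| * z)) * z ^ (-1 - β)) * c2
  have i1 := (integrableOn_Ioi_comp_mul_left_iff
    (fun z => 2 * (1 - Real.cos z) * z ^ (-1 - β)) 0 ha).2
    (by simpa using integrableOn_cos_kernel h0 h2)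
  have i2 : IntegrableOn (fun z : ℝ => 2 * (1 - Real.cos (t * z)) * z ^ (-1 - β)) (Set.Ioi 0) :=
    (integrableOn_congr_fun e1 measurableSet_Ioi).2 (i1.const_mul _)
  rw [← ofReal_integral_eq_lintegral_ofReal i2, setIntegral_congr_fun measurableSet_Ioi e1,
    integral_const_mul, integral_comp_mul_left_Ioi
    (fun z => 2 * (1 - Real.cos z) * z ^ (-1 - β)) 0 ha, mul_zero, smul_eq_mul, ← kc]
  · congr 1
    rw [Real.rpow_add ha, Real.rpow_one]
    field_simp
  · refine (ae_restrict_iff' measurableSet_Ioi).2 (Eventually.of_forall fun z hz => ?_)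
    exact mul_nonneg (by linarith [Real.cos_le_one (t * z)]) (Real.rpow_nonneg (le_of_lt hz) _)

/-- Tonelli applied to `incr_eq`. Both sides may be infinite, so the identity also decides whether
𝓓^{β/2} f is in L²; this is how jumps are tested for fractional regularity later. -/
theorem lintegral_incr {β : ℝ} (h0 : 0 < β) (h2 : β < 2) {f : ℝ → ℝ} (hf : MemLp f 2) :
    ∫⁻ z in Set.Ioi (0 : ℝ), ENNReal.ofReal (incr f z * z ^ (-1 - β))
      = ENNReal.ofReal (kc β) * ∫⁻ ξ, ENNReal.ofReal ((2 * Real.pi * |ξ|) ^ β * ‖ft f ξ‖ ^ 2) := by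
  have e1 : ∀ z ∈ Set.Ioi (0 : ℝ), ENNReal.ofReal (incr f z * z ^ (-1 - β)) =
      ∫⁻ ξ, ENNReal.ofReal (2 * (1 - Real.cos (2 * Real.pi * ξ * z)) * z ^ (-1 - β)) *
        ENNReal.ofReal (‖ft f ξ‖ ^ 2) := by
    intro z hz
    have hz : 0 < z := hz
    rw [incr_eq hf, ← integral_mul_const, ofReal_integral_eq_lintegral_ofReal]
    · refine lintegral_congr fun ξ => ?_
      rw [← ENNReal.ofReal_mul']
      · congr 1
        rw [mul_right_comm (2 * Real.pi) z ξ]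
        ring
      · positivity
    · exact (integrable_cos_mul_sq _ z).mul_const _
    · refine Eventually.of_forall fun ξ => ?_
      exact mul_nonneg (mul_nonneg (by linarith [Real.cos_le_one (2 * Real.pi * z * ξ)])
        (sq_nonneg _)) (Real.rpow_nonneg hz.le _)
  rw [setLIntegral_congr_fun measurableSet_Ioi e1, lintegral_lintegral_swap]
  · rw [← lintegral_const_mul' _ _ ENNReal.ofReal_ne_top]
    refine lintegral_congr fun ξ => ?_
    rw [lintegral_mul_const' _ _ ENNReal.ofReal_ne_top, lintegral_cos_kernel h0 h2,
      ← ENNReal.ofReal_mul' (by positivity),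
      ← ENNReal.ofReal_mul (kc_pos h0 h2).le]
    congr 1
    rw [abs_mul, abs_of_pos Real.two_pi_pos]
    ring
  · have m1 : Measurable fun p : ℝ × ℝ =>
        ENNReal.ofReal (2 * (1 - Real.cos (2 * Real.pi * p.2 * p.1)) * p.1 ^ (-1 - β)) := by
      fun_prop
    have m2 : Measurable fun ξ => ENNReal.ofReal (‖ft f ξ‖ ^ 2) :=
      ((Lp.stronglyMeasurable _).measurable.norm.pow_const 2).ennreal_ofReal
    exact (m1.mul (m2.comp measurable_snd)).aemeasurable

theorem measurable_fracFourier (s : ℝ) (f : ℝ → ℝ) : Measurable (fracFourier s f) := by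
  have : Measurable (ft f) := (Lp.stronglyMeasurable _).measurable
  unfold fracFourier
  fun_prop

theorem norm_fracFourier (s : ℝ) (f : ℝ → ℝ) (ξ : ℝ) :
    ‖fracFourier s f ξ‖ = (2 * Real.pi * |ξ|) ^ s * ‖ft f ξ‖ := by
  rw [fracFourier, norm_mul, Complex.norm_real, Real.norm_eq_abs, abs_of_nonneg (by positivity)]

theorem norm_fracFourier_sq (β : ℝ) (f : ℝ → ℝ) (ξ : ℝ) :
    ‖fracFourier (β / 2) f ξ‖ ^ 2 = (2 * Real.pi * |ξ|) ^ β * ‖ft f ξ‖ ^ 2 := by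
  rw [norm_fracFourier, mul_pow, ← Real.rpow_natCast _ 2, ← Real.rpow_mul (by positivity)]
  congr 2
  push_cast
  ring

theorem norm_fracD_sq {s : ℝ} {f : ℝ → ℝ} (h : MemLp (fracFourier s f) 2) :
    ‖fracD s f‖ ^ 2 = ∫ ξ, ‖fracFourier s f ξ‖ ^ 2 := by
  have e : fracD s f = 𝓕⁻ (h.toLp _) := by simp [fracD, h]
  have e2 : ‖fracD s f‖ = ‖h.toLp _‖ := by
    rw [e]; exact (Lp.fourierTransformₗᵢ ℝ ℂ).symm.norm_map _
  rw [e2, norm_sq_Lp]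
  refine integral_congr_ae ?_
  filter_upwards [h.coeFn_toLp] with ξ hξ
  rw [hξ]

theorem memLp_fracFourier_iff {β : ℝ} (h0 : 0 < β) (h2 : β < 2) {f : ℝ → ℝ} (hf : MemLp f 2) :
    MemLp (fracFourier (β / 2) f) 2 ↔
      ∫⁻ z in Set.Ioi (0 : ℝ), ENNReal.ofReal (incr f z * z ^ (-1 - β)) < ⊤ := by
  rw [lintegral_incr h0 h2 hf, memLp_two_iff_integrable_sq_norm
    (measurable_fracFourier _ _).aestronglyMeasurable]
  simp_rw [norm_fracFourier_sq]
  have hm : Measurable (ft f) := (Lp.stronglyMeasurable _).measurable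
  constructor
  · intro h
    exact ENNReal.mul_lt_top ENNReal.ofReal_lt_top h.lintegral_lt_top
  · intro h
    refine (lintegral_ofReal_ne_top_iff_integrable (by fun_prop)
      (Eventually.of_forall fun ξ => by positivity)).1 fun htop => ?_
    rw [htop, ENNReal.mul_top] at h
    · exact lt_irrefl _ h
    · simpa using kc_pos h0 h2

theorem measurable_incr {f : ℝ → ℝ} (hf : MemLp f 2) : Measurable (incr f) := by
  have hm : Measurable (ft f) := (Lp.stronglyMeasurable _).measurable
  have e : incr f = fun z => ∫ ξ, 2 * (1 - Real.cos (2 * Real.pi * z * ξ)) * ‖ft f ξ‖ ^ 2 :=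
    funext fun z => incr_eq hf z
  rw [e]
  have : StronglyMeasurable fun p : ℝ × ℝ =>
      2 * (1 - Real.cos (2 * Real.pi * p.1 * p.2)) * ‖ft f p.2‖ ^ 2 := by
    refine Measurable.stronglyMeasurable ?_
    have : Measurable fun p : ℝ × ℝ => ft f p.2 := hm.comp measurable_snd
    fun_prop
  exact this.integral_prod_right.measurable

theorem integrableOn_incr {β : ℝ} (h0 : 0 < β) (h2 : β < 2) {f : ℝ → ℝ} (hf : MemLp f 2)
    (h : MemLp (fracFourier (β / 2) f) 2) :
    IntegrableOn (fun z => incr f z * z ^ (-1 - β)) (Set.Ioi 0) := by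
  have hm := measurable_incr hf
  refine (lintegral_ofReal_ne_top_iff_integrable (by fun_prop) ?_).1
    ((memLp_fracFourier_iff h0 h2 hf).1 h).ne
  refine (ae_restrict_iff' measurableSet_Ioi).2 (Eventually.of_forall fun z hz => ?_)
  exact mul_nonneg (incr_nonneg f z) (Real.rpow_nonneg (le_of_lt hz) _)

theorem integral_incr {β : ℝ} (h0 : 0 < β) (h2 : β < 2) {f : ℝ → ℝ} (hf : MemLp f 2)
    (h : MemLp (fracFourier (β / 2) f) 2) :
    ∫ z in Set.Ioi (0 : ℝ), incr f z * z ^ (-1 - β) = kc β * ‖fracD (β / 2) f‖ ^ 2 := by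
  have e := lintegral_incr h0 h2 hf
  rw [← ofReal_integral_eq_lintegral_ofReal (integrableOn_incr h0 h2 hf h),
    ← ofReal_integral_eq_lintegral_ofReal, ← ENNReal.ofReal_mul (kc_pos h0 h2).le,
    ENNReal.ofReal_eq_ofReal_iff] at e
  · rw [e, norm_fracD_sq h]
    simp_rw [norm_fracFourier_sq]
  · refine setIntegral_nonneg measurableSet_Ioi fun z hz => ?_
    exact mul_nonneg (incr_nonneg f z) (Real.rpow_nonneg (le_of_lt hz) _)
  · exact mul_nonneg (kc_pos h0 h2).le (integral_nonneg fun ξ => by positivity)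
  · simp_rw [← norm_fracFourier_sq]
    exact (memLp_two_iff_integrable_sq_norm
      (measurable_fracFourier _ _).aestronglyMeasurable).1 h
  · exact Eventually.of_forall fun ξ => by positivity
  · refine (ae_restrict_iff' measurableSet_Ioi).2 (Eventually.of_forall fun z hz => ?_)
    exact mul_nonneg (incr_nonneg f z) (Real.rpow_nonneg (le_of_lt hz) _)

/-! ### Algebra of fractional derivatives -/

theorem fracFourier_add (s : ℝ) {f g : ℝ → ℝ} (hf : MemLp f 2) (hg : MemLp g 2) :
    fracFourier s (f + g) =ᵐ[volume] fracFourier s f + fracFourier s g := by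
  filter_upwards [ft_add hf hg] with ξ h
  simp only [fracFourier, Pi.add_apply]
  rw [h, mul_add]

theorem fracFourier_smul (s : ℝ) (c : ℝ) {f : ℝ → ℝ} (hf : MemLp f 2) :
    fracFourier s (c • f) =ᵐ[volume] (c : ℂ) • fracFourier s f := by
  filter_upwards [ft_smul c hf] with ξ h
  simp only [fracFourier, Pi.smul_apply, smul_eq_mul]
  rw [h]
  ring

/-- `f ∈ L²` and `𝓓^s f ∈ L²`. -/
structure FracMem (s : ℝ) (f : ℝ → ℝ) : Prop where
  mem : MemLp f 2
  frac : MemLp (fracFourier s f) 2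

theorem FracMem.fracD_eq {s : ℝ} {f : ℝ → ℝ} (h : FracMem s f) :
    fracD s f = 𝓕⁻ (h.frac.toLp _) := by simp [fracD, h.frac]

theorem FracMem.add {s : ℝ} {f g : ℝ → ℝ} (hf : FracMem s f) (hg : FracMem s g) :
    FracMem s (f + g) :=
  ⟨hf.mem.add hg.mem, (hf.frac.add hg.frac).ae_eq (fracFourier_add s hf.mem hg.mem).symm⟩

theorem FracMem.smul {s : ℝ} {f : ℝ → ℝ} (c : ℝ) (hf : FracMem s f) : FracMem s (c • f) :=
  ⟨hf.mem.const_smul c, (hf.frac.const_smul (c : ℂ)).ae_eq (fracFourier_smul s c hf.mem).symm⟩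

theorem fracD_add {s : ℝ} {f g : ℝ → ℝ} (hf : FracMem s f) (hg : FracMem s g) :
    fracD s (f + g) = fracD s f + fracD s g := by
  rw [hf.fracD_eq, hg.fracD_eq, (hf.add hg).fracD_eq, ← FourierTransform.fourierInv_add, ← MemLp.toLp_add]
  congr 1
  exact (MemLp.toLp_eq_toLp_iff _ _).2 (fracFourier_add s hf.mem hg.mem)

theorem fracD_smul {s : ℝ} {f : ℝ → ℝ} (c : ℝ) (hf : FracMem s f) :
    fracD s (c • f) = (c : ℂ) • fracD s f := by
  rw [hf.fracD_eq, (hf.smul c).fracD_eq, ← FourierTransform.fourierInv_smul,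
    ← MemLp.toLp_const_smul]
  congr 1
  exact (MemLp.toLp_eq_toLp_iff _ _).2 (fracFourier_smul s c hf.mem)

theorem fracInner_add_left {s : ℝ} {f g h : ℝ → ℝ} (hf : FracMem s f) (hg : FracMem s g) :
    fracInner s (f + g) h = fracInner s f h + fracInner s g h := by
  simp [fracInner, fracD_add hf hg, inner_add_left]

theorem fracInner_add_right {s : ℝ} {f g h : ℝ → ℝ} (hf : FracMem s f) (hg : FracMem s g) :
    fracInner s h (f + g) = fracInner s h f + fracInner s h g := by
  simp [fracInner, fracD_add hf hg, inner_add_right]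

theorem fracInner_smul_left {s : ℝ} {f h : ℝ → ℝ} (c : ℝ) (hf : FracMem s f) :
    fracInner s (c • f) h = c * fracInner s f h := by
  rw [fracInner, fracD_smul c hf, inner_smul_left, Complex.conj_ofReal, Complex.re_ofReal_mul,
    fracInner]

theorem fracInner_smul_right {s : ℝ} {f h : ℝ → ℝ} (c : ℝ) (hf : FracMem s f) :
    fracInner s h (c • f) = c * fracInner s h f := by
  rw [fracInner, fracD_smul c hf, inner_smul_right, Complex.re_ofReal_mul, fracInner]

theorem abs_fracInner_le (s : ℝ) (f g : ℝ → ℝ) :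
    |fracInner s f g| ≤ ‖fracD s f‖ * ‖fracD s g‖ :=
  (Complex.abs_re_le_norm _).trans (norm_inner_le_norm _ _)

/-! ### Sobolev membership -/

theorem rpow_le_one_add_rpow {x a b : ℝ} (hx : 0 ≤ x) (ha : 0 ≤ a) (hab : a ≤ b) :
    x ^ a ≤ 1 + x ^ b := by
  rcases le_total x 1 with h | h
  · have := Real.rpow_le_one hx h ha
    have := Real.rpow_nonneg hx b
    linarith
  · have := Real.rpow_le_rpow_of_exponent_le h hab
    linarith

theorem FracMem.mono {s t : ℝ} {f : ℝ → ℝ} (h : FracMem t f) (hs : 0 ≤ s) (hst : s ≤ t) :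
    FracMem s f := by
  refine ⟨h.mem, ?_⟩
  have hb : MemLp (fun ξ => ‖ft f ξ‖ + ‖fracFourier t f ξ‖) 2 :=
    (Lp.memLp (ft f)).norm.add h.frac.norm
  refine hb.of_le (measurable_fracFourier _ _).aestronglyMeasurable
    (Eventually.of_forall fun ξ => ?_)
  rw [Real.norm_of_nonneg (by positivity), norm_fracFourier, norm_fracFourier]
  nlinarith [rpow_le_one_add_rpow (x := 2 * Real.pi * |ξ|) (by positivity) hs hst,
    norm_nonneg (ft f ξ)]

/-- The Bessel weight (1 + ξ²)^{s/2} and 1 + (2π|ξ|)^s bound each other up to constants. The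
distributional condition is first turned into square integrability of the weight times `ft f`. -/
theorem memH_iff {s : ℝ} (hs : 0 ≤ s) {f : ℝ → ℝ} : MemH s f ↔ FracMem s f := by
  have hg : (fun x : ℝ => (((1 + ‖x‖ ^ 2) ^ (s / 2) : ℝ) : ℂ)).HasTemperateGrowth := by fun_prop
  have hgc := hg.1.continuous
  have hm : Measurable (ft f) := (Lp.stronglyMeasurable _).measurable
  have hnorm : ∀ ξ : ℝ, ‖(((1 + ‖ξ‖ ^ 2) ^ (s / 2) : ℝ) : ℂ) * ft f ξ‖
      = (1 + ξ ^ 2) ^ (s / 2) * ‖ft f ξ‖ := fun ξ => by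
    rw [norm_mul, Complex.norm_real, Real.norm_of_nonneg (by positivity), Real.norm_eq_abs, sq_abs]
  have key : TemperedDistribution.MemSobolev s 2 (Lp.toTemperedDistribution (toL2 f)) ↔
      MemLp (fun ξ : ℝ => (((1 + ‖ξ‖ ^ 2) ^ (s / 2) : ℝ) : ℂ) * ft f ξ) 2 := by
    rw [TemperedDistribution.memSobolev_iff_exists_smulLeftCLM_fourier,
      Lp.fourier_toTemperedDistribution_eq]
    constructor
    · rintro ⟨F, hF⟩
      refine (Lp.memLp F).ae_eq ?_
      symm
      refine ae_eq_of_test ((locallyIntegrable_Lp (ft f)).continuous_smul hgc)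
        (locallyIntegrable_Lp F) fun η hη hc => ?_
      have h := congrArg (fun T => T (hc.toSchwartzMap hη)) hF
      simp only [TemperedDistribution.smulLeftCLM_apply_apply, Lp.toTemperedDistribution_apply,
        SchwartzMap.smulLeftCLM_apply_apply hg, smul_eq_mul] at h
      refine Eq.trans ?_ h
      refine integral_congr_ae (Eventually.of_forall fun ξ => ?_)
      simp only [HasCompactSupport.toSchwartzMap_toFun]
      ring
    · intro h
      refine ⟨h.toLp _, ?_⟩
      ext η
      simp only [TemperedDistribution.smulLeftCLM_apply_apply, Lp.toTemperedDistribution_apply,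
        SchwartzMap.smulLeftCLM_apply_apply hg, smul_eq_mul]
      refine integral_congr_ae ?_
      filter_upwards [h.coeFn_toLp] with ξ hξ
      rw [hξ]
      ring
  have key2 : MemLp f 2 → (MemLp (fun ξ : ℝ => (((1 + ‖ξ‖ ^ 2) ^ (s / 2) : ℝ) : ℂ) * ft f ξ) 2 ↔
      MemLp (fracFourier s f) 2) := by
    intro hf
    constructor
    · intro h
      refine (h.const_mul (((2 * Real.pi) ^ s : ℝ) : ℂ)).of_le
        (measurable_fracFourier _ _).aestronglyMeasurable (Eventually.of_forall fun ξ => ?_)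
      rw [norm_mul, hnorm, norm_fracFourier, Complex.norm_real,
        Real.norm_of_nonneg (by positivity), ← mul_assoc, Real.mul_rpow (by positivity) (abs_nonneg _)]
      gcongr
      calc |ξ| ^ s = (|ξ| ^ (2 : ℝ)) ^ (s / 2) := by
            rw [← Real.rpow_mul (abs_nonneg _)]; congr 1; ring
        _ ≤ (1 + ξ ^ 2) ^ (s / 2) := by
            rw [Real.rpow_two, sq_abs]
            exact Real.rpow_le_rpow (sq_nonneg _) (by linarith) (by linarith)
    · intro h
      have hb : MemLp (fun ξ => (2 : ℝ) ^ (s / 2) * (‖ft f ξ‖ + ‖fracFourier s f ξ‖)) 2 :=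
        ((Lp.memLp (ft f)).norm.add h.norm).const_mul _
      refine hb.of_le (hgc.measurable.mul hm).aestronglyMeasurable
        (Eventually.of_forall fun ξ => ?_)
      rw [hnorm, norm_fracFourier, Real.norm_of_nonneg (by positivity), ← one_add_mul, ← mul_assoc]
      gcongr
      rcases le_total |ξ| 1 with h1 | h1
      · have h3 : (1 + ξ ^ 2) ^ (s / 2) ≤ (2 : ℝ) ^ (s / 2) := by
          refine Real.rpow_le_rpow (by positivity) ?_ (by linarith)
          rw [← sq_abs]; nlinarith [abs_nonneg ξ]
        refine h3.trans (le_mul_of_one_le_right (by positivity) ?_)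
        have : 0 ≤ (2 * Real.pi * |ξ|) ^ s := by positivity
        linarith
      · have h3 : (1 + ξ ^ 2) ^ (s / 2) ≤ (2 * |ξ| ^ (2 : ℝ)) ^ (s / 2) := by
          refine Real.rpow_le_rpow (by positivity) ?_ (by linarith)
          rw [Real.rpow_two, ← sq_abs]; nlinarith [abs_nonneg ξ]
        rw [Real.mul_rpow (by positivity) (by positivity), ← Real.rpow_mul (abs_nonneg _),
          mul_div_cancel₀ _ (two_ne_zero' ℝ)] at h3
        refine h3.trans ?_
        gcongr
        have h4 : |ξ| ^ s ≤ (2 * Real.pi * |ξ|) ^ s :=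
          Real.rpow_le_rpow (abs_nonneg _) (by nlinarith [Real.pi_gt_three]) hs
        linarith
  constructor
  · rintro ⟨h1, h2⟩
    have h1' := memLp_real_iff.1 h1
    exact ⟨h1', (key2 h1').1 (key.1 h2)⟩
  · rintro ⟨h1, h2⟩
    exact ⟨memLp_real_iff.2 h1, key.2 ((key2 h1).2 h2)⟩

theorem HasL2Deriv.fracFourier_norm {f f' : ℝ → ℝ} (h : HasL2Deriv f f') {s : ℝ} (hs : 0 ≤ s) :
    ∀ᵐ ξ, ‖fracFourier s f' ξ‖ = ‖fracFourier (s + 1) f ξ‖ := by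
  filter_upwards [h.ft_deriv] with ξ e
  rw [norm_fracFourier, norm_fracFourier, e, norm_mul, norm_mul, Complex.norm_I, mul_one,
    Complex.norm_real, Real.norm_eq_abs, abs_mul, abs_of_pos Real.two_pi_pos,
    Real.rpow_add_one' (by positivity) (by positivity)]
  ring

/-- The multiplier of d/dx has modulus 2π|ξ|, so a derivative trades exactly for one order of
smoothness. It carries H^{1+α} regularity of v down to H^{α-1} regularity of v_xx and back. -/
theorem HasL2Deriv.fracMem_iff {f f' : ℝ → ℝ} (h : HasL2Deriv f f') {s : ℝ} (hs : 0 ≤ s) :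
    FracMem s f' ↔ FracMem (s + 1) f := by
  have e := h.fracFourier_norm hs
  constructor
  · intro k
    refine ⟨h.mem, k.frac.of_le (measurable_fracFourier _ _).aestronglyMeasurable ?_⟩
    filter_upwards [e] with ξ hξ using hξ.ge
  · intro k
    refine ⟨h.mem', k.frac.of_le (measurable_fracFourier _ _).aestronglyMeasurable ?_⟩
    filter_upwards [e] with ξ hξ using hξ.le

theorem fracMem_zero {f : ℝ → ℝ} (h : MemLp f 2) : FracMem 0 f := by
  refine ⟨h, (Lp.memLp (ft f)).of_le (measurable_fracFourier _ _).aestronglyMeasurable ?_⟩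
  exact Eventually.of_forall fun ξ => by rw [norm_fracFourier]; simp

theorem HasL2Deriv.fracMem {f f' : ℝ → ℝ} (h : HasL2Deriv f f') {s : ℝ} (hs : 0 ≤ s)
    (hs1 : s ≤ 1) : FracMem s f := by
  have := (h.fracMem_iff le_rfl).1 (fracMem_zero h.mem')
  exact this.mono hs (by linarith)

theorem HasL2Deriv.norm_fracD_sq_le {f f' : ℝ → ℝ} (h : HasL2Deriv f f') {s : ℝ} (hs : 0 ≤ s)
    (hs1 : s ≤ 1) : ‖fracD s f‖ ^ 2 ≤ (∫ x, f x ^ 2) + ∫ x, f' x ^ 2 := by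
  rw [norm_fracD_sq (h.fracMem hs hs1).frac, ← norm_ft_sq h.mem, ← norm_ft_sq h.mem',
    norm_sq_Lp, norm_sq_Lp, ← integral_add (integrable_norm_sq_Lp _) (integrable_norm_sq_Lp _)]
  refine integral_mono_ae ((memLp_two_iff_integrable_sq_norm
      (measurable_fracFourier _ _).aestronglyMeasurable).1 (h.fracMem hs hs1).frac)
      ((integrable_norm_sq_Lp _).add (integrable_norm_sq_Lp _)) ?_
  filter_upwards [h.ft_deriv] with ξ e
  rw [e, norm_fracFourier, norm_mul, norm_mul, Complex.norm_I, mul_one,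
    Complex.norm_real, Real.norm_eq_abs, abs_mul, abs_of_pos Real.two_pi_pos, mul_pow, mul_pow,
    ← Real.rpow_natCast _ 2, ← Real.rpow_mul (by positivity)]
  have := rpow_le_one_add_rpow (x := 2 * Real.pi * |ξ|) (a := s * (2 : ℕ)) (b := (2 : ℕ))
    (by positivity) (by positivity) (by push_cast; linarith)
  rw [Real.rpow_natCast (2 * Real.pi * |ξ|) 2] at this
  nlinarith [sq_nonneg ‖ft f ξ‖]

/-- On the Fourier side, 2(1 - cos t) ≤ t² with t = 2πzξ. -/
theorem HasL2Deriv.incr_le {f f' : ℝ → ℝ} (h : HasL2Deriv f f') (z : ℝ) :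
    incr f z ≤ z ^ 2 * ∫ x, f' x ^ 2 := by
  rw [incr_eq h.mem, ← norm_ft_sq h.mem', norm_sq_Lp, ← integral_const_mul]
  refine integral_mono_ae (integrable_cos_mul_sq _ _) ((integrable_norm_sq_Lp _).const_mul _) ?_
  filter_upwards [h.ft_deriv] with ξ e
  rw [e, norm_mul, norm_mul, Complex.norm_I, mul_one, Complex.norm_real, Real.norm_eq_abs, mul_pow,
    sq_abs]
  nlinarith [two_mul_one_sub_cos_le (2 * Real.pi * z * ξ), sq_nonneg ‖ft f ξ‖]

end FKdV

/-! ### Polarised increments and calculus with the cut-off -/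

namespace FKdV

/-- The polarisation of `incr`. -/
noncomputable def incr₂ (f g : ℝ → ℝ) (z : ℝ) : ℝ := ∫ x, (f (x + z) - f x) * (g (x + z) - g x)

theorem memLp_increment {f : ℝ → ℝ} (hf : MemLp f 2) (z : ℝ) :
    MemLp (fun x => f (x + z) - f x) 2 := (memLp_translate hf z).sub hf

theorem incr_add {f g : ℝ → ℝ} (hf : MemLp f 2) (hg : MemLp g 2) (z : ℝ) :
    incr (f + g) z = incr f z + incr g z + 2 * incr₂ f g z := by
  have h1 := memLp_increment hf z
  have h2 := memLp_increment hg z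
  have i3 : Integrable fun x => (f (x + z) - f x) * (g (x + z) - g x) := h1.integrable_mul h2
  have i12 : Integrable fun x => (f (x + z) - f x) ^ 2 + (g (x + z) - g x) ^ 2 :=
    h1.integrable_sq.add h2.integrable_sq
  rw [incr, incr, incr, incr₂, ← integral_const_mul, ← integral_add h1.integrable_sq h2.integrable_sq,
    ← integral_add i12 (i3.const_mul 2)]
  congr 1
  ext x
  simp only [Pi.add_apply]
  ring

theorem norm_fracD_add_sq {s : ℝ} {f g : ℝ → ℝ} (hf : FracMem s f) (hg : FracMem s g) :
    ‖fracD s (f + g)‖ ^ 2 = ‖fracD s f‖ ^ 2 + ‖fracD s g‖ ^ 2 + 2 * fracInner s f g := by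
  rw [fracD_add hf hg, @norm_add_sq ℂ, fracInner]
  simp only [RCLike.re_eq_complex_re]
  ring

/-- Polarisation of `integral_incr`: both sides are the same combination of the quadratic quantities
of f + g, f and g. -/
theorem integral_incr₂ {β : ℝ} (h0 : 0 < β) (h2 : β < 2) {f g : ℝ → ℝ} (hf : FracMem (β / 2) f)
    (hg : FracMem (β / 2) g) :
    IntegrableOn (fun z => incr₂ f g z * z ^ (-1 - β)) (Set.Ioi 0) ∧
    ∫ z in Set.Ioi (0 : ℝ), incr₂ f g z * z ^ (-1 - β) = kc β * fracInner (β / 2) f g := by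
  have e : (fun z => incr₂ f g z * z ^ (-1 - β)) = fun z => 2⁻¹ * (incr (f + g) z * z ^ (-1 - β)
      - incr f z * z ^ (-1 - β) - incr g z * z ^ (-1 - β)) := by
    ext z
    rw [incr_add hf.mem hg.mem]
    ring
  have i1 := integrableOn_incr h0 h2 (hf.add hg).mem (hf.add hg).frac
  have i2 := integrableOn_incr h0 h2 hf.mem hf.frac
  have i3 := integrableOn_incr h0 h2 hg.mem hg.frac
  have i12 : IntegrableOn (fun z => incr (f + g) z * z ^ (-1 - β)
      - incr f z * z ^ (-1 - β)) (Set.Ioi 0) := i1.sub i2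
  rw [e]
  refine ⟨(i12.sub i3).const_mul _, ?_⟩
  rw [integral_const_mul, integral_sub i12 i3, integral_sub i1 i2,
    integral_incr h0 h2 (hf.add hg).mem (hf.add hg).frac, integral_incr h0 h2 hf.mem hf.frac,
    integral_incr h0 h2 hg.mem hg.frac, norm_fracD_add_sq hf hg]
  ring

theorem hasDerivAt_of_right {f f' : ℝ → ℝ} (hc : Continuous f) (hc' : Continuous f')
    (h : ∀ x, HasDerivWithinAt f (f' x) (Set.Ioi x) x) (x : ℝ) : HasDerivAt f (f' x) x := by
  have e : f = fun y => f 0 + ∫ t in (0 : ℝ)..y, f' t := by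
    ext y
    rw [intervalIntegral.integral_eq_sub_of_hasDeriv_right hc.continuousOn (fun x _ => h x)
      (hc'.intervalIntegrable _ _)]
    ring
  rw [e]
  exact (intervalIntegral.integral_hasDerivAt_right (hc'.intervalIntegrable _ _)
    (hc'.stronglyMeasurableAtFilter _ _) hc'.continuousAt).const_add _

theorem HasL2Deriv.hasDerivAt {f f' : ℝ → ℝ} (h : HasL2Deriv f f') (hc : Continuous f') (x : ℝ) :
    HasDerivAt f (f' x) x := hasDerivAt_of_right h.cont hc h.deriv x

section Cutoff

variable {R : ℝ} {φ : ℝ → ℝ}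

theorem IsCutoff.contDiff_deriv (h : IsCutoff R φ) : ContDiff ℝ (⊤ : ℕ∞) (deriv φ) :=
  (contDiff_infty_iff_deriv.1 h.smooth).2

theorem IsCutoff.differentiable (h : IsCutoff R φ) : Differentiable ℝ φ :=
  (contDiff_infty_iff_deriv.1 h.smooth).1

theorem IsCutoff.hasCompactSupport_deriv (h : IsCutoff R φ) : HasCompactSupport (deriv φ) := by
  refine HasCompactSupport.intro (isCompact_Icc (a := -(R + 1)) (b := R + 1)) fun x hx => ?_
  refine h.deriv_eq_zero x ?_
  by_contra hlt
  exact hx (abs_le.1 (not_le.1 hlt).le)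

theorem IsCutoff.abs_sub_le (h : IsCutoff R φ) (x y : ℝ) : |φ y - φ x| ≤ |y - x| := by
  have := Convex.norm_image_sub_le_of_norm_deriv_le (f := φ) (C := 1) (s := Set.univ) (x := x)
    (y := y) (fun x _ => h.differentiable x) (fun x _ => by
      rw [Real.norm_eq_abs, abs_of_nonneg (h.deriv_nonneg x)]; exact h.deriv_le_one x)
    convex_univ trivial trivial
  simpa using this

theorem IsCutoff.mono (h : IsCutoff R φ) : Monotone φ :=
  monotone_of_deriv_nonneg h.differentiable h.deriv_nonneg

/-- Bounds for the second and third derivative of a cut-off. -/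
theorem IsCutoff.exists_bound (h : IsCutoff R φ) : ∃ M, 0 ≤ M ∧ (∀ x, |deriv (deriv φ) x| ≤ M) ∧
    ∀ x z, 0 < z → |2 * deriv φ x - deriv φ (x - z) - deriv φ (x + z)| ≤ M * z ^ 2 := by
  have c1 := h.contDiff_deriv
  have c2 : ContDiff ℝ (⊤ : ℕ∞) (deriv (deriv φ)) := (contDiff_infty_iff_deriv.1 c1).2
  have d1 : Differentiable ℝ (deriv φ) := (contDiff_infty_iff_deriv.1 c1).1
  have c3 : ContDiff ℝ (⊤ : ℕ∞) (deriv (deriv (deriv φ))) := (contDiff_infty_iff_deriv.1 c2).2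
  have d2 : Differentiable ℝ (deriv (deriv φ)) := (contDiff_infty_iff_deriv.1 c2).1
  obtain ⟨A, hA⟩ := (h.hasCompactSupport_deriv.deriv).exists_bound_of_continuous c2.continuous
  obtain ⟨B, hB⟩ := (h.hasCompactSupport_deriv.deriv.deriv).exists_bound_of_continuous c3.continuous
  have hA0 : 0 ≤ A := (norm_nonneg _).trans (hA 0)
  have hB0 : 0 ≤ B := (norm_nonneg _).trans (hB 0)
  refine ⟨A + 2 * B, by positivity, fun x => (hA x).trans (by linarith), fun x z hz => ?_⟩
  have lip : ∀ a b, |deriv (deriv φ) b - deriv (deriv φ) a| ≤ B * |b - a| := fun a b => by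
    simpa using Convex.norm_image_sub_le_of_norm_deriv_le (f := deriv (deriv φ)) (C := B)
      (s := Set.univ) (x := a) (y := b) (fun x _ => d2 x) (fun x _ => hB x)
      convex_univ trivial trivial
  have hd : ∀ t, HasDerivAt (fun t => 2 * deriv φ x - deriv φ (x - t) - deriv φ (x + t))
      (deriv (deriv φ) (x - t) - deriv (deriv φ) (x + t)) t := fun t => by
    have e1 : HasDerivAt (fun t => deriv φ (x - t)) (deriv (deriv φ) (x - t) * (-1)) t :=
      (d1 (x - t)).hasDerivAt.comp t ((hasDerivAt_id t).const_sub x)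
    have e2 : HasDerivAt (fun t => deriv φ (x + t)) (deriv (deriv φ) (x + t) * 1) t :=
      (d1 (x + t)).hasDerivAt.comp t ((hasDerivAt_id t).const_add x)
    exact (((hasDerivAt_const t (2 * deriv φ x)).sub e1).sub e2).congr_deriv (by ring)
  -- The second difference vanishes at t = 0 and its t-derivative is at most 2Bt ≤ 2Bz on [0, z].
  have := Convex.norm_image_sub_le_of_norm_hasDerivWithin_le
    (f := fun t => 2 * deriv φ x - deriv φ (x - t) - deriv φ (x + t)) (C := 2 * B * z)
    (s := Set.Icc 0 z) (x := 0) (y := z) (fun t _ => (hd t).hasDerivWithinAt) (fun t ht => by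
      refine (lip _ _).trans ?_
      have : |x - t - (x + t)| = 2 * t := by
        rw [show x - t - (x + t) = -(2 * t) by ring, abs_neg, abs_of_nonneg (by linarith [ht.1])]
      rw [this]
      nlinarith [ht.2]) (convex_Icc _ _) ⟨le_rfl, hz.le⟩ ⟨hz.le, le_rfl⟩
  simp only [sub_zero, add_zero, Real.norm_eq_abs, abs_of_pos hz] at this
  rw [show 2 * deriv φ x - deriv φ (x - z) - deriv φ (x + z) - (2 * deriv φ x - deriv φ x - deriv φ x)
    = 2 * deriv φ x - deriv φ (x - z) - deriv φ (x + z) by ring] at this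
  refine this.trans ?_
  nlinarith [sq_nonneg z]

theorem IsCutoff.abs_le (h : IsCutoff R φ) (x : ℝ) : |φ x| ≤ 2 + 2 * R := by
  rw [abs_of_nonneg (by linarith [h.one_le x])]; exact h.le x

theorem MemLp.bdd_mul_cont {f g : ℝ → ℝ} {C : ℝ} (hg : MemLp g 2) (hf : Continuous f)
    (hb : ∀ x, |f x| ≤ C) : MemLp (fun x => f x * g x) 2 :=
  (hg.const_mul C).of_le (hf.aestronglyMeasurable.mul hg.1) (Eventually.of_forall fun x => by
    rw [norm_mul, norm_mul, Real.norm_eq_abs, Real.norm_eq_abs C,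
      abs_of_nonneg ((abs_nonneg _).trans (hb 0))]
    gcongr
    exact hb x)

theorem IsCutoff.hasL2Deriv_mul (h : IsCutoff R φ) {w w' : ℝ → ℝ} (hw : HasL2Deriv w w') :
    HasL2Deriv (φ * w) (fun x => deriv φ x * w x + φ x * w' x) := by
  have hφ := h.differentiable
  have hb : ∀ x, |deriv φ x| ≤ 1 := fun x => by
    rw [abs_of_nonneg (h.deriv_nonneg x)]; exact h.deriv_le_one x
  refine ⟨hφ.continuous.mul hw.cont, fun x => (hφ x).hasDerivAt.hasDerivWithinAt.mul (hw.deriv x),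
    MemLp.bdd_mul_cont hw.mem hφ.continuous h.abs_le, ?_⟩
  exact (MemLp.bdd_mul_cont hw.mem h.contDiff_deriv.continuous hb).add
    (MemLp.bdd_mul_cont hw.mem' hφ.continuous h.abs_le)

theorem IsCutoff.deriv_mul (h : IsCutoff R φ) {w w' : ℝ → ℝ} (hw : HasL2Deriv w w')
    (hc : Continuous w') : deriv (φ * w) = fun x => deriv φ x * w x + φ x * w' x :=
  funext fun x => ((h.differentiable x).hasDerivAt.mul (hw.hasDerivAt hc x)).deriv

/-- Places the test function (φw)_x of the dispersive term in H^s for all 0 ≤ s ≤ 1, even when w''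
jumps. -/
theorem IsCutoff.hasL2Deriv_deriv_mul (h : IsCutoff R φ) {w w' w'' : ℝ → ℝ} (hw : HasL2Deriv w w')
    (hw' : HasL2Deriv w' w'') :
    HasL2Deriv (deriv (φ * w)) (fun x => deriv (deriv φ) x * w x + 2 * (deriv φ x * w' x)
      + φ x * w'' x) := by
  rw [h.deriv_mul hw hw'.cont]
  obtain ⟨M, -, hM, -⟩ := h.exists_bound
  have c1 := h.contDiff_deriv
  have c2 : ContDiff ℝ (⊤ : ℕ∞) (deriv (deriv φ)) := (contDiff_infty_iff_deriv.1 c1).2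
  have d1 : Differentiable ℝ (deriv φ) := (contDiff_infty_iff_deriv.1 c1).1
  have hφ := h.differentiable
  have hb : ∀ x, |deriv φ x| ≤ 1 := fun x => by
    rw [abs_of_nonneg (h.deriv_nonneg x)]; exact h.deriv_le_one x
  refine ⟨(c1.continuous.mul hw.cont).add (hφ.continuous.mul hw'.cont), fun x => ?_,
    (h.hasL2Deriv_mul hw).mem', ?_⟩
  · refine (((d1 x).hasDerivAt.hasDerivWithinAt.mul (hw.deriv x)).add
      ((hφ x).hasDerivAt.hasDerivWithinAt.mul (hw'.deriv x))).congr_deriv ?_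
    ring
  · exact ((MemLp.bdd_mul_cont hw.mem c2.continuous hM).add
      ((MemLp.bdd_mul_cont hw.mem' c1.continuous hb).const_mul 2)).add
      (MemLp.bdd_mul_cont hw'.mem' hφ.continuous h.abs_le)

end Cutoff
end FKdV

/-! ### The commutator estimate for the dispersive term -/

namespace FKdV
section Coercivity
variable {R : ℝ} {φ : ℝ → ℝ}

theorem integrable_prod_comp_add {h : ℝ → ℝ} (hi : Integrable h) (hc : Continuous h)
    (ν : Measure ℝ) [IsFiniteMeasure ν] :
    Integrable (fun p : ℝ × ℝ => h (p.1 + p.2)) ((volume : Measure ℝ).prod ν) := by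
  have hm : AEStronglyMeasurable (fun p : ℝ × ℝ => h (p.1 + p.2)) ((volume : Measure ℝ).prod ν) :=
    (by fun_prop : Continuous _).aestronglyMeasurable
  rw [integrable_prod_iff' hm]
  refine ⟨Eventually.of_forall fun y => hi.comp_add_right y, ?_⟩
  have : (fun y => ∫ x, ‖h (x + y)‖) = fun _ => ∫ x, ‖h x‖ := by
    ext y
    exact integral_add_right_eq_self (fun x => ‖h x‖) y
  simp only [this]
  exact integrable_const _

/-- The `z`-derivative of `(w(x+z) - w(x))² (φ(x+z) - φ(x))`. -/
noncomputable def incrFlux (φ w w' : ℝ → ℝ) (x z : ℝ) : ℝ :=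
  2 * (w (x + z) - w x) * w' (x + z) * (φ (x + z) - φ x) + (w (x + z) - w x) ^ 2 * deriv φ (x + z)

theorem IsCutoff.integrable_prod_incrFlux (h : IsCutoff R φ) {w w' : ℝ → ℝ}
    (hw : HasL2Deriv w w') (hc : Continuous w') (ν : Measure ℝ) [IsFiniteMeasure ν] :
    Integrable (fun p : ℝ × ℝ => incrFlux φ w w' p.1 p.2) ((volume : Measure ℝ).prod ν) := by
  have hφ := h.differentiable.continuous
  have hφ' := h.contDiff_deriv.continuous
  have hwc := hw.cont
  have i1 := integrable_prod_comp_add hw.mem.integrable_sq (hwc.pow 2) ν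
  have i2 := integrable_prod_comp_add hw.mem'.integrable_sq (hc.pow 2) ν
  have i3 : Integrable (fun p : ℝ × ℝ => w p.1 ^ 2) ((volume : Measure ℝ).prod ν) :=
    hw.mem.integrable_sq.comp_fst ν
  -- With |δφ| ≤ 4 + 4R and 0 ≤ φ_x ≤ 1 the flux is at most (5 + 4R)(δw)² + (4 + 4R)w'(x+z)², and (a
  -- - b)² ≤ 2(a² + b²).
  refine Integrable.mono' (((i1.add i3).const_mul (2 * (5 + 4 * R))).add (i2.const_mul (4 + 4 * R)))
    ?_ (Eventually.of_forall fun p => ?_)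
  · refine Continuous.aestronglyMeasurable ?_
    unfold incrFlux
    fun_prop
  · simp only [incrFlux, Pi.add_apply, Real.norm_eq_abs]
    set a := w (p.1 + p.2)
    set b := w p.1
    set c := w' (p.1 + p.2)
    have hd0 := h.deriv_nonneg (p.1 + p.2)
    have hd1 := h.deriv_le_one (p.1 + p.2)
    have f1 := h.abs_le (p.1 + p.2)
    have f2 := h.abs_le p.1
    set d := deriv φ (p.1 + p.2)
    have hR : 0 ≤ 4 + 4 * R := by linarith [abs_nonneg (φ p.1)]
    have hφ : |φ (p.1 + p.2) - φ p.1| ≤ 4 + 4 * R := (abs_sub _ _).trans (by linarith)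
    have hab : (a - b) ^ 2 ≤ 2 * (a ^ 2 + b ^ 2) := by nlinarith [sq_nonneg (a + b)]
    have t1 : |2 * (a - b) * c * (φ (p.1 + p.2) - φ p.1)| ≤ ((a - b) ^ 2 + c ^ 2) * (4 + 4 * R) := by
      rw [abs_mul]
      refine mul_le_mul ?_ hφ (abs_nonneg _) (by positivity)
      rw [_root_.abs_le]; constructor <;> nlinarith [sq_nonneg (a - b + c), sq_nonneg (a - b - c)]
    have t2 : |(a - b) ^ 2 * d| ≤ (a - b) ^ 2 := by
      rw [abs_of_nonneg (by positivity)]; nlinarith [sq_nonneg (a - b)]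
    refine (abs_add_le _ _).trans ?_
    nlinarith

/-- Integration by parts in z. As the kernel decreases and φ increases, the interior term and the
boundary term at N are nonnegative and may be dropped. What remains is the boundary term at ε, where
φ(x+ε) - φ(x) ≤ ε gains one power of ε. -/
theorem IsCutoff.incrFlux_lower (h : IsCutoff R φ) {w w' : ℝ → ℝ} (hw : HasL2Deriv w w')
    (hc : Continuous w') {α ε N : ℝ} (hα : 1 ≤ α) (hε : 0 < ε) (hN : ε ≤ N) (x : ℝ) :
    -(ε ^ (-α) * (w (x + ε) - w x) ^ 2) ≤
      ∫ z in ε..N, incrFlux φ w w' x z * z ^ (-1 - α) := by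
  have hφ := h.differentiable.continuous
  have hφ' := h.contDiff_deriv.continuous
  have hwc := hw.cont
  have hpos : ∀ z ∈ Set.uIcc ε N, 0 < z := fun z hz => by
    rw [Set.uIcc_of_le hN] at hz; exact hε.trans_le hz.1
  have hshift : ∀ {f f' : ℝ → ℝ}, (∀ y, HasDerivAt f (f' y) y) → ∀ z,
      HasDerivAt (fun z => f (x + z)) (f' (x + z)) z := fun hf z => by
    exact ((hf (x + z)).comp z ((hasDerivAt_id z).const_add x)).congr_deriv (mul_one _)
  have hcr : ∀ r : ℝ, ContinuousOn (fun z : ℝ => z ^ r) (Set.uIcc ε N) := fun r =>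
    continuousOn_id.rpow_const fun z hz => Or.inl (hpos z hz).ne'
  have hG : ∀ z, 0 < z → HasDerivAt
      (fun z => (w (x + z) - w x) ^ 2 * (φ (x + z) - φ x) * z ^ (-1 - α))
      (incrFlux φ w w' x z * z ^ (-1 - α) + (w (x + z) - w x) ^ 2 * (φ (x + z) - φ x) *
        ((-1 - α) * z ^ (-1 - α - 1))) z := fun z hz => by
    refine (((((hshift (fun y => hw.hasDerivAt hc y) z).sub_const _).pow 2).mul
      ((hshift (fun y => (h.differentiable y).hasDerivAt) z).sub_const _)).mul
      (Real.hasDerivAt_rpow_const (p := -1 - α) (Or.inl hz.ne'))).congr_deriv ?_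
    simp only [incrFlux, Pi.pow_apply, Pi.mul_apply]
    push_cast
    ring
  have c1 : ContinuousOn (fun z => incrFlux φ w w' x z * z ^ (-1 - α)) (Set.uIcc ε N) := by
    refine ContinuousOn.mul (Continuous.continuousOn ?_) (hcr _)
    unfold incrFlux
    fun_prop
  have c2 : ContinuousOn (fun z => (w (x + z) - w x) ^ 2 * (φ (x + z) - φ x) *
        ((-1 - α) * z ^ (-1 - α - 1))) (Set.uIcc ε N) :=
    ContinuousOn.mul (Continuous.continuousOn (by fun_prop)) ((hcr _).const_mul _)
  have key := intervalIntegral.integral_eq_sub_of_hasDerivAt (fun z hz => hG z (hpos z hz))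
    (c1.add c2).intervalIntegrable
  have inc : ∀ z, 0 < z → 0 ≤ φ (x + z) - φ x := fun z hz => sub_nonneg.2 (h.mono (by linarith))
  have m : ∫ z in ε..N, (incrFlux φ w w' x z * z ^ (-1 - α) +
      (w (x + z) - w x) ^ 2 * (φ (x + z) - φ x) * ((-1 - α) * z ^ (-1 - α - 1)))
      ≤ ∫ z in ε..N, incrFlux φ w w' x z * z ^ (-1 - α) := by
    refine intervalIntegral.integral_mono_on hN (c1.add c2).intervalIntegrable
      c1.intervalIntegrable fun z hz => ?_
    have hz0 : 0 < z := hε.trans_le hz.1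
    have := mul_nonneg (mul_nonneg (sq_nonneg (w (x + z) - w x)) (inc z hz0))
      (Real.rpow_nonneg hz0.le (-1 - α - 1))
    nlinarith
  refine le_trans ?_ (key.symm.le.trans m)
  have hNpos := hε.trans_le hN
  have p1 : 0 ≤ (w (x + N) - w x) ^ 2 * (φ (x + N) - φ x) * N ^ (-1 - α) :=
    mul_nonneg (mul_nonneg (sq_nonneg _) (inc N hNpos)) (Real.rpow_nonneg hNpos.le _)
  have p2 : φ (x + ε) - φ x ≤ ε := by
    have := h.abs_sub_le x (x + ε)
    rw [add_sub_cancel_left, abs_of_pos hε] at this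
    exact (le_abs_self _).trans this
  have p3 : ε ^ (-α) = ε * ε ^ (-1 - α) := by
    rw [← Real.rpow_one_add' hε.le (by linarith)]
    congr 1; ring
  rw [p3]
  have p4 := mul_le_mul_of_nonneg_right (mul_le_mul_of_nonneg_left p2 (sq_nonneg (w (x + ε) - w x)))
    (Real.rpow_nonneg hε.le (-1 - α))
  linarith

/-- Integrated in x, the boundary term is ε^{-α} `incr w ε` ≤ ε^{2-α}‖w'‖². Away from z = 0 the
kernel is bounded, which justifies Fubini. -/
theorem IsCutoff.integral_incrFlux_lower (h : IsCutoff R φ) {w w' : ℝ → ℝ} (hw : HasL2Deriv w w')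
    (hc : Continuous w') {α ε N : ℝ} (hα : 1 ≤ α) (hε : 0 < ε) (hN : ε ≤ N) :
    IntegrableOn (fun z => (∫ x, incrFlux φ w w' x z) * z ^ (-1 - α)) (Set.Ioc ε N) ∧
    -(ε ^ (2 - α) * ∫ x, w' x ^ 2) ≤
      ∫ z in Set.Ioc ε N, (∫ x, incrFlux φ w w' x z) * z ^ (-1 - α) := by
  have i0 := h.integrable_prod_incrFlux hw hc (volume.restrict (Set.Ioc ε N))
  have i1 : Integrable (fun p : ℝ × ℝ => incrFlux φ w w' p.1 p.2 * p.2 ^ (-1 - α))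
      ((volume : Measure ℝ).prod (volume.restrict (Set.Ioc ε N))) := by
    refine i0.mul_bdd (c := ε ^ (-1 - α))
      (by fun_prop : Measurable _).aestronglyMeasurable ?_
    have : ∀ᵐ z ∂(volume.restrict (Set.Ioc ε N)), ‖z ^ (-1 - α)‖ ≤ ε ^ (-1 - α) :=
      (ae_restrict_iff' measurableSet_Ioc).2 (Eventually.of_forall fun z hz => by
        rw [Real.norm_of_nonneg (Real.rpow_nonneg (hε.trans hz.1).le _)]
        exact Real.rpow_le_rpow_of_nonpos hε hz.1.le (by linarith))
    exact Measure.quasiMeasurePreserving_snd.ae this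
  have i2 := i1.integral_prod_right
  simp only [integral_mul_const] at i2
  refine ⟨i2, ?_⟩
  have e : ∫ z in Set.Ioc ε N, (∫ x, incrFlux φ w w' x z) * z ^ (-1 - α) =
      ∫ x, ∫ z in Set.Ioc ε N, incrFlux φ w w' x z * z ^ (-1 - α) := by
    simp_rw [← integral_mul_const]
    exact (integral_integral_swap i1).symm
  rw [e]
  have hle := hw.incr_le ε
  calc -(ε ^ (2 - α) * ∫ x, w' x ^ 2) ≤ ∫ x, -(ε ^ (-α) * (w (x + ε) - w x) ^ 2) := by
        rw [integral_neg, integral_const_mul, neg_le_neg_iff]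
        rw [show (2 - α) = -α + (2 : ℕ) by push_cast; ring, Real.rpow_add_natCast hε.ne', mul_assoc]
        exact mul_le_mul_of_nonneg_left hle (Real.rpow_nonneg hε.le _)
    _ ≤ _ := by
        refine integral_mono ((memLp_increment hw.mem ε).integrable_sq.const_mul _).neg
          i1.integral_prod_left fun x => ?_
        simp only
        rw [← intervalIntegral.integral_of_le hN]
        exact h.incrFlux_lower hw hc hα hε hN x

theorem IsCutoff.abs_deriv_le (h : IsCutoff R φ) (x : ℝ) : |deriv φ x| ≤ 1 := by
  rw [abs_of_nonneg (h.deriv_nonneg x)]; exact h.deriv_le_one x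

theorem integrable_sq_mul_bdd {w f : ℝ → ℝ} {C : ℝ} (hw : MemLp w 2) (hf : Continuous f)
    (hb : ∀ x, |f x| ≤ C) : Integrable fun x => w x ^ 2 * f x :=
  hw.integrable_sq.mul_bdd (c := C) hf.aestronglyMeasurable (Eventually.of_forall hb)

/-- Summation by parts: translating the w(x+z)² part by -z moves the difference from w² onto φ_x, so
no smoothness of w is spent. -/
theorem IsCutoff.integral_second_difference (h : IsCutoff R φ) {w : ℝ → ℝ} (hw : MemLp w 2)
    (z : ℝ) :
    Integrable (fun x => (w (x + z) ^ 2 - w x ^ 2) * (deriv φ (x + z) - deriv φ x)) ∧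
    ∫ x, (w (x + z) ^ 2 - w x ^ 2) * (deriv φ (x + z) - deriv φ x) =
      ∫ x, w x ^ 2 * (2 * deriv φ x - deriv φ (x - z) - deriv φ (x + z)) := by
  have hφ' := h.contDiff_deriv.continuous
  have bd : ∀ x y, |deriv φ x - deriv φ y| ≤ 2 := fun x y =>
    (abs_sub _ _).trans (by linarith [h.abs_deriv_le x, h.abs_deriv_le y])
  have i1 : Integrable fun x => w x ^ 2 * (deriv φ (x + z) - deriv φ x) :=
    integrable_sq_mul_bdd hw (by fun_prop) fun x => bd _ _
  have i2 : Integrable fun x => w x ^ 2 * (deriv φ x - deriv φ (x - z)) :=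
    integrable_sq_mul_bdd hw (by fun_prop) fun x => bd _ _
  have i3 : Integrable fun x => w (x + z) ^ 2 * (deriv φ (x + z) - deriv φ x) := by
    simpa using i2.comp_add_right z
  have e3 : ∫ x, w (x + z) ^ 2 * (deriv φ (x + z) - deriv φ x) =
      ∫ x, w x ^ 2 * (deriv φ x - deriv φ (x - z)) := by
    have := integral_add_right_eq_self (fun x => w x ^ 2 * (deriv φ x - deriv φ (x - z))) z
      (μ := volume)
    simpa using this
  simp_rw [sub_mul (w _ ^ 2)]
  refine ⟨i3.sub i1, ?_⟩
  rw [integral_sub i3 i1, e3, ← integral_sub i2 i1]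
  congr 1
  ext x
  ring

/-- Pointwise, 2 δw · δ(φw)_x = `incrFlux` + ∂_x((δw)² φ) + δ(w²) δφ_x. The middle term integrates
to zero and the last is a second difference of φ_x against w². -/
theorem IsCutoff.incr₂_lower (h : IsCutoff R φ) {w w' w'' : ℝ → ℝ} (hw : HasL2Deriv w w')
    (hw' : HasL2Deriv w' w'') {b z : ℝ}
    (hb : ∀ x, |2 * deriv φ x - deriv φ (x - z) - deriv φ (x + z)| ≤ b) :
    2⁻¹ * (∫ x, incrFlux φ w w' x z) - 2⁻¹ * (b * ∫ x, w x ^ 2) ≤ incr₂ w (deriv (φ * w)) z := by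
  have hφ := h.differentiable.continuous
  have hφ' := h.contDiff_deriv.continuous
  have hwc := hw.cont
  have hwc' := hw'.cont
  have hdw := fun x => hw.hasDerivAt hw'.cont x
  have hδ := memLp_increment hw.mem z
  have hδ' := memLp_increment hw.mem' z
  obtain ⟨iB, eB⟩ := h.integral_second_difference hw.mem z
  have iT1 : Integrable fun x => (w (x + z) - w x) * (φ x * (w' (x + z) - w' x)) :=
    hδ.integrable_mul (MemLp.bdd_mul_cont hδ' hφ h.abs_le)
  have iT2 : Integrable fun x => (w (x + z) - w x) ^ 2 * deriv φ x :=
    integrable_sq_mul_bdd hδ hφ' h.abs_deriv_le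
  have iT : Integrable fun x => 2 * ((w (x + z) - w x) * (φ x * (w' (x + z) - w' x))) +
      (w (x + z) - w x) ^ 2 * deriv φ x := (iT1.const_mul 2).add iT2
  have iF1 : Integrable fun x => (w (x + z) - w x) * ((φ (x + z) - φ x) * w' (x + z)) :=
    hδ.integrable_mul (MemLp.bdd_mul_cont (memLp_translate hw.mem' z) (by fun_prop)
      fun x => (abs_sub _ _).trans (add_le_add (h.abs_le (x + z)) (h.abs_le x)))
  have iF2 : Integrable fun x => (w (x + z) - w x) ^ 2 * deriv φ (x + z) :=
    integrable_sq_mul_bdd hδ (by fun_prop) fun x => h.abs_deriv_le (x + z)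
  have iF : Integrable fun x => incrFlux φ w w' x z := by
    refine ((iF1.const_mul 2).add iF2).congr (Eventually.of_forall fun x => ?_)
    simp only [incrFlux, Pi.add_apply]
    ring
  have zT : ∫ x, (2 * ((w (x + z) - w x) * (φ x * (w' (x + z) - w' x))) +
      (w (x + z) - w x) ^ 2 * deriv φ x) = 0 := by
    refine integral_eq_zero_of_hasDerivAt_of_integrable
      (f := fun x => (w (x + z) - w x) ^ 2 * φ x) (fun x => ?_) iT
      (integrable_sq_mul_bdd hδ hφ h.abs_le)
    have e1 : HasDerivAt (fun x => w (x + z)) (w' (x + z)) x :=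
      ((hdw (x + z)).comp x ((hasDerivAt_id x).add_const z)).congr_deriv (mul_one _)
    refine (((e1.sub (hdw x)).pow 2).mul (h.differentiable x).hasDerivAt).congr_deriv ?_
    simp only [Pi.pow_apply, Pi.sub_apply]
    push_cast
    ring
  have e : incr₂ w (deriv (φ * w)) z = 2⁻¹ * (∫ x, incrFlux φ w w' x z) +
      2⁻¹ * ∫ x, (w (x + z) ^ 2 - w x ^ 2) * (deriv φ (x + z) - deriv φ x) := by
    have : incr₂ w (deriv (φ * w)) z = ∫ x, (2⁻¹ * incrFlux φ w w' x z +
        2⁻¹ * (2 * ((w (x + z) - w x) * (φ x * (w' (x + z) - w' x))) +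
          (w (x + z) - w x) ^ 2 * deriv φ x)) +
        2⁻¹ * ((w (x + z) ^ 2 - w x ^ 2) * (deriv φ (x + z) - deriv φ x)) := by
      rw [incr₂, h.deriv_mul hw hw'.cont]
      congr 1
      ext x
      simp only [incrFlux]
      ring
    have iFT : Integrable fun x => 2⁻¹ * incrFlux φ w w' x z +
        2⁻¹ * (2 * ((w (x + z) - w x) * (φ x * (w' (x + z) - w' x))) +
          (w (x + z) - w x) ^ 2 * deriv φ x) := (iF.const_mul _).add (iT.const_mul _)
    rw [this, integral_add iFT (iB.const_mul _),
      integral_add (iF.const_mul _) (iT.const_mul _), integral_const_mul, integral_const_mul,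
      integral_const_mul, zT]
    ring
  rw [e, eB]
  have lower : -(b * ∫ x, w x ^ 2) ≤
      ∫ x, w x ^ 2 * (2 * deriv φ x - deriv φ (x - z) - deriv φ (x + z)) := by
    rw [← integral_const_mul, ← integral_neg]
    refine integral_mono (hw.mem.integrable_sq.const_mul b).neg
      (integrable_sq_mul_bdd hw.mem (by fun_prop) hb) fun x => ?_
    have := (_root_.abs_le.1 (hb x)).1
    simp only
    nlinarith [sq_nonneg (w x)]
  linarith

/-- A single sequence sends the inner truncation ε to 0 and the outer truncation N to ∞ at once. -/
theorem aecover_Ioc_inv_nat :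
    AECover ((volume : Measure ℝ).restrict (Set.Ioi 0)) atTop
      fun n : ℕ => Set.Ioc (1 / ((n : ℝ) + 1)) ((n : ℝ) + 1) where
  ae_eventually_mem := by
    refine (ae_restrict_iff' measurableSet_Ioi).2 (Eventually.of_forall fun z hz => ?_)
    have t1 : Tendsto (fun n : ℕ => 1 / ((n : ℝ) + 1)) atTop (𝓝 0) :=
      tendsto_one_div_add_atTop_nhds_zero_nat
    have t2 : Tendsto (fun n : ℕ => (n : ℝ) + 1) atTop atTop :=
      tendsto_atTop_add_const_right _ _ tendsto_natCast_atTop_atTop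
    filter_upwards [t1.eventually (gt_mem_nhds (Set.mem_Ioi.1 hz)), t2.eventually_ge_atTop z]
      with n h1 h2 using ⟨h1, h2⟩
  measurableSet _ := measurableSet_Ioc

/-- The commutator estimate: the dispersive term is bounded below by the `L²` norm. -/
theorem IsCutoff.fracInner_lower (h : IsCutoff R φ) {α : ℝ} (hα : 1 ≤ α) (hα2 : α < 2) :
    ∃ C, 0 ≤ C ∧ ∀ w w' w'' : ℝ → ℝ, HasL2Deriv w w' → HasL2Deriv w' w'' →
      -(C * ∫ x, w x ^ 2) ≤ fracInner (α / 2) w (deriv (φ * w)) := by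
  obtain ⟨M, hM0, -, hM⟩ := h.exists_bound
  have h0 : 0 < α := by linarith
  have hk := kc_pos h0 hα2
  -- Both bounds for the second difference of φ_x: smoothness for small z, and 0 ≤ φ_x ≤ 1 for large
  -- z. Their minimum is integrable against z^{-1-α}.
  set b : ℝ → ℝ := fun z => min (M * z ^ 2) 4 with hbdef
  have b0 : ∀ z, 0 ≤ b z := fun z => le_min (by positivity) (by norm_num)
  have ib : IntegrableOn (fun z => b z * z ^ (-1 - α)) (Set.Ioi 0) := by
    refine integrableOn_kernel h0 hα2 (A := M) (B := 4) (by fun_prop) (fun z _ => ?_) fun z _ => ?_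
    · rw [abs_of_nonneg (b0 z)]; exact min_le_left _ _
    · rw [abs_of_nonneg (b0 z)]; exact min_le_right _ _
  have bnn : ∀ z ∈ Set.Ioi (0 : ℝ), 0 ≤ b z * z ^ (-1 - α) := fun z hz =>
    mul_nonneg (b0 z) (Real.rpow_nonneg (le_of_lt hz) _)
  set J := ∫ z in Set.Ioi (0 : ℝ), b z * z ^ (-1 - α) with hJ
  have hJ0 : 0 ≤ J := setIntegral_nonneg measurableSet_Ioi bnn
  refine ⟨(kc α)⁻¹ * (2⁻¹ * J), by positivity, fun w w' w'' hw hw' => ?_⟩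
  have hfw := hw.fracMem (s := α / 2) (by linarith) (by linarith)
  have hfq := (h.hasL2Deriv_deriv_mul hw hw').fracMem (s := α / 2) (by linarith) (by linarith)
  obtain ⟨iI, eI⟩ := integral_incr₂ h0 hα2 hfw hfq
  set W0 := ∫ x, w x ^ 2
  have hW0 : 0 ≤ W0 := integral_nonneg fun x => sq_nonneg _
  have hbz : ∀ z, 0 < z → ∀ x, |2 * deriv φ x - deriv φ (x - z) - deriv φ (x + z)| ≤ b z :=
    fun z hz x => le_min (hM x z hz) <| by
      have e1 := _root_.abs_le.1 (h.abs_deriv_le x)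
      have e2 := _root_.abs_le.1 (h.abs_deriv_le (x - z))
      have e3 := _root_.abs_le.1 (h.abs_deriv_le (x + z))
      rw [_root_.abs_le]; constructor <;> linarith
  have main : ∀ ε N : ℝ, 0 < ε → ε ≤ N →
      -(2⁻¹ * (ε ^ (2 - α) * ∫ x, w' x ^ 2)) - 2⁻¹ * (J * W0) ≤
        ∫ z in Set.Ioc ε N, incr₂ w (deriv (φ * w)) z * z ^ (-1 - α) := by
    intro ε N hε hN
    have hsub : Set.Ioc ε N ⊆ Set.Ioi 0 := fun z hz => hε.trans hz.1
    obtain ⟨iF, lF⟩ := h.integral_incrFlux_lower hw hw'.cont hα hε hN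
    have ibs := ib.mono_set hsub
    have hJle : ∫ z in Set.Ioc ε N, b z * z ^ (-1 - α) ≤ J :=
      setIntegral_mono_set ib ((ae_restrict_iff' measurableSet_Ioi).2 (Eventually.of_forall bnn))
        hsub.eventuallyLE
    have step : ∫ z in Set.Ioc ε N, (2⁻¹ * ((∫ x, incrFlux φ w w' x z) * z ^ (-1 - α)) -
        2⁻¹ * W0 * (b z * z ^ (-1 - α))) ≤
        ∫ z in Set.Ioc ε N, incr₂ w (deriv (φ * w)) z * z ^ (-1 - α) := by
      refine setIntegral_mono_on ((iF.const_mul _).sub (ibs.const_mul _)) (iI.mono_set hsub)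
        measurableSet_Ioc fun z hz => ?_
      have hz0 : 0 < z := hsub hz
      have := mul_le_mul_of_nonneg_right (h.incr₂_lower hw hw' (hbz z hz0))
        (Real.rpow_nonneg hz0.le (-1 - α))
      linarith
    rw [integral_sub (iF.const_mul _) (ibs.const_mul _), integral_const_mul,
      integral_const_mul] at step
    nlinarith
  have lim := aecover_Ioc_inv_nat.integral_tendsto_of_countably_generated iI
  simp only [Measure.restrict_restrict measurableSet_Ioc] at lim
  have lim2 : Tendsto (fun n : ℕ => -(2⁻¹ * ((1 / ((n : ℝ) + 1)) ^ (2 - α) * ∫ x, w' x ^ 2)) -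
      2⁻¹ * (J * W0)) atTop (𝓝 (-(2⁻¹ * ((0 : ℝ) ^ (2 - α) * ∫ x, w' x ^ 2)) - 2⁻¹ * (J * W0))) := by
    have t1 : Tendsto (fun n : ℕ => 1 / ((n : ℝ) + 1)) atTop (𝓝 0) :=
      tendsto_one_div_add_atTop_nhds_zero_nat
    -- Here α < 2 removes the term with w', so the final constant involves only the L² norm of w.
    have t2 := t1.rpow_const (p := 2 - α) (Or.inr (by linarith))
    exact (((t2.mul_const _).const_mul _).neg).sub_const _
  have fin := le_of_tendsto_of_tendsto' lim2 lim fun n => by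
    have hn : (0 : ℝ) ≤ n := n.cast_nonneg
    have hsub : Set.Ioc (1 / ((n : ℝ) + 1)) ((n : ℝ) + 1) ⊆ Set.Ioi 0 :=
      fun z hz => lt_of_le_of_lt (by positivity) hz.1
    rw [Set.inter_eq_left.2 hsub]
    refine main _ _ (by positivity) ?_
    rw [div_le_iff₀ (by positivity)]
    nlinarith
  rw [eI, Real.zero_rpow (by linarith)] at fin
  have : -(kc α * ((kc α)⁻¹ * (2⁻¹ * J) * W0)) ≤ kc α * fracInner (α / 2) w (deriv (φ * w)) := by
    rw [← mul_assoc (kc α), mul_inv_cancel_left₀ hk.ne']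
    linarith
  rw [← mul_neg] at this
  exact le_of_mul_le_mul_left this hk

end Coercivity
end FKdV

/-! ### The abstract linearly implicit scheme -/

namespace FKdV
section Abstract

variable {V H : Type*} [NormedAddCommGroup V] [InnerProductSpace ℝ V] [CompleteSpace V]
  [NormedAddCommGroup H] [InnerProductSpace ℝ H]

/-- The Lax-Milgram theorem: unique solvability for a coercive bilinear form. -/
theorem lax_milgram {B : V →L[ℝ] V →L[ℝ] ℝ} (hB : IsCoercive B) (f : V →L[ℝ] ℝ) :
    ∃ x, ∀ v, B x v = f v := by
  refine ⟨hB.continuousLinearEquivOfBilin.symm ((InnerProductSpace.toDual ℝ V).symm f), fun v => ?_⟩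
  rw [← hB.continuousLinearEquivOfBilin_apply, ContinuousLinearEquiv.apply_symm_apply,
    InnerProductSpace.toDual_symm_apply]

/-- One linearly implicit step with a coercive principal part and a locally Lipschitz nonlinearity
is uniquely solvable; under a smallness condition the fixed-point iteration converges. -/
theorem exists_scheme (Φ : V →L[ℝ] H) {c₁ : ℝ} (hΦ : ∀ x, ‖x‖ ≤ c₁ * ‖Φ x‖)
    (d : V →L[ℝ] V →L[ℝ] ℝ) {C : ℝ} (hd : ∀ x, -(C * ‖Φ x‖ ^ 2) ≤ d x x)
    (Q : V → V →L[ℝ] ℝ) {b : ℝ} (hb : 0 ≤ b) (Q0 : Q 0 = 0)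
    (hQ : ∀ x y v, |Q x v - Q y v| ≤ b * ‖Φ (x - y)‖ * ‖Φ (x + y)‖ * ‖Φ v‖)
    {dt K : ℝ} (hdt : 0 < dt) (hdtC : C * dt ≤ 1 / 5) (hK : 5 ≤ K) (u : V)
    (hcfl : dt * b * K * ‖Φ u‖ ≤ 1 / 10) :
    ∃ T : V → V, (∀ w w' : V, (∀ v, inner ℝ (Φ w') (Φ v) - dt / 2 * Q ((2⁻¹ : ℝ) • (w + u)) v +
        dt * d ((2⁻¹ : ℝ) • (w' + u)) v = inner ℝ (Φ u) (Φ v)) ↔ w' = T w) ∧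
      ∃ x, T x = x ∧ ‖Φ x‖ ≤ K * ‖Φ u‖ ∧
        Tendsto (fun l => ‖Φ (T^[l] u - x)‖) atTop (𝓝 0) := by
  have innerL : ∃ I : H →L[ℝ] H →L[ℝ] ℝ, ∀ x y, I x y = inner ℝ x y := ⟨innerSL ℝ, fun _ _ => rfl⟩
  obtain ⟨I, hI⟩ := innerL
  -- Adding ⟨Φu, Φv⟩ to both sides turns a step into an equation for w' + u with this form; hence
  -- the factor 2 in `ex`.
  set a : V →L[ℝ] V →L[ℝ] ℝ := I.bilinearComp Φ Φ + (dt / 2) • d with ha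
  have a_apply : ∀ x v, a x v = inner ℝ (Φ x) (Φ v) + dt / 2 * d x v := fun x v => by
    simp [ha, hI]
  have a_coer : ∀ v, 4 / 5 * ‖Φ v‖ ^ 2 ≤ a v v := fun v => by
    rw [a_apply, real_inner_self_eq_norm_sq]
    have h1 := mul_le_mul_of_nonneg_left (hd v) hdt.le
    have h2 := mul_le_mul_of_nonneg_right hdtC (sq_nonneg ‖Φ v‖)
    nlinarith [sq_nonneg ‖Φ v‖]
  have a_low : ∀ {y : ℝ} {x : V}, 0 ≤ y → (∀ v, a x v ≤ y * ‖Φ v‖) → ‖Φ x‖ ≤ 5 / 4 * y := by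
    intro y x hy h
    have h1 := (a_coer x).trans (h x)
    by_contra hlt
    push Not at hlt
    have : 0 < ‖Φ x‖ := lt_of_le_of_lt (by positivity) hlt
    nlinarith
  have coer : IsCoercive a := by
    refine ⟨4 / 5 * ((c₁ ^ 2 + 1)⁻¹), by positivity, fun v => le_trans ?_ (a_coer v)⟩
    have h1 : ‖v‖ ^ 2 ≤ (c₁ ^ 2 + 1) * ‖Φ v‖ ^ 2 := by
      have := pow_le_pow_left₀ (norm_nonneg v) (hΦ v) 2
      rw [mul_pow] at this
      nlinarith [sq_nonneg ‖Φ v‖]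
    have h2 : (c₁ ^ 2 + 1)⁻¹ * ‖v‖ ^ 2 ≤ ‖Φ v‖ ^ 2 := by
      rw [inv_mul_le_iff₀ (by positivity)]; exact h1
    nlinarith
  -- the solution operator
  have ex : ∀ w, ∃ w', ∀ v, a (w' + u) v =
      2 * inner ℝ (Φ u) (Φ v) + dt / 2 * Q ((2⁻¹ : ℝ) • (w + u)) v := fun w => by
    obtain ⟨x, hx⟩ := lax_milgram coer
      ((2 : ℝ) • (innerSL ℝ (Φ u)).comp Φ + (dt / 2) • Q ((2⁻¹ : ℝ) • (w + u)))
    refine ⟨x - u, fun v => ?_⟩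
    rw [sub_add_cancel, hx]
    simp
  choose T hT using ex
  have inj : ∀ x y, (∀ v, a x v = a y v) → x = y := fun x y h => by
    have h1 := a_low (x := x - y) le_rfl (fun v => by simp [h v])
    have h2 := hΦ (x - y)
    have h3 : ‖Φ (x - y)‖ = 0 := le_antisymm (by linarith) (norm_nonneg _)
    rw [h3, mul_zero] at h2
    exact sub_eq_zero.1 (norm_le_zero_iff.1 h2)
  have iff : ∀ w w' : V, (∀ v, inner ℝ (Φ w') (Φ v) - dt / 2 * Q ((2⁻¹ : ℝ) • (w + u)) v +
        dt * d ((2⁻¹ : ℝ) • (w' + u)) v = inner ℝ (Φ u) (Φ v)) ↔ w' = T w := by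
    intro w w'
    have e : ∀ v, (inner ℝ (Φ w') (Φ v) - dt / 2 * Q ((2⁻¹ : ℝ) • (w + u)) v +
        dt * d ((2⁻¹ : ℝ) • (w' + u)) v = inner ℝ (Φ u) (Φ v)) ↔ a (w' + u) v = a (T w + u) v := by
      intro v
      rw [hT w v, a_apply]
      simp only [map_add, map_smul, add_apply, smul_apply,
        smul_eq_mul, inner_add_left]
      constructor <;> intro h <;> linarith
    constructor
    · intro h
      exact add_right_cancel (inj _ _ fun v => (e v).1 (h v))
    · rintro rfl v
      exact (e v).2 rfl
  refine ⟨T, iff, ?_⟩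
  set n := ‖Φ u‖ with hn
  have hn0 : 0 ≤ n := norm_nonneg _
  have hbn : 0 ≤ dt * b * n := by positivity
  -- invariant ball
  have ball : ∀ w, ‖Φ w‖ ≤ K * n → ‖Φ (T w)‖ ≤ K * n := by
    intro w hw
    have hs : ‖Φ ((2⁻¹ : ℝ) • (w + u))‖ ≤ (K + 1) / 2 * n := by
      rw [map_smul, norm_smul, map_add, Real.norm_of_nonneg (by norm_num)]
      linarith [norm_add_le (Φ w) (Φ u)]
    have h1 : ‖Φ (T w + u)‖ ≤ 5 / 4 * (2 * n + dt / 2 * (b * ((K + 1) / 2 * n) ^ 2)) := by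
      refine a_low (by positivity) fun v => ?_
      rw [hT]
      have q := hQ ((2⁻¹ : ℝ) • (w + u)) 0 v
      simp only [Q0, zero_apply, sub_zero, add_zero] at q
      have q2 : b * ‖Φ ((2⁻¹ : ℝ) • (w + u))‖ * ‖Φ ((2⁻¹ : ℝ) • (w + u))‖ * ‖Φ v‖ ≤
          b * ((K + 1) / 2 * n) ^ 2 * ‖Φ v‖ := by
        rw [sq, ← mul_assoc b]
        gcongr
      have q3 := (le_abs_self _).trans (q.trans q2)
      have q4 := real_inner_le_norm (Φ u) (Φ v)
      have := mul_le_mul_of_nonneg_left q3 (by positivity : 0 ≤ dt / 2)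
      linarith
    have h2 : ‖Φ (T w)‖ ≤ ‖Φ (T w + u)‖ + n := by
      have := norm_sub_le (Φ (T w + u)) (Φ u)
      rwa [← map_sub, add_sub_cancel_right] at this
    -- From K ≥ 5, K + 1 ≤ 6K/5; with the smallness condition the left side is at most (9/500)Kn.
    -- Since n ≤ Kn/5, the total is then at most (7/10 + 1/40)Kn.
    have h3 : dt / 2 * (b * ((K + 1) / 2 * n) ^ 2) ≤ 1 / 50 * (K * n) := by
      have e1 : (K + 1) ^ 2 ≤ 36 / 25 * K ^ 2 := by nlinarith
      have e2 : dt * b * n ^ 2 * (K + 1) ^ 2 ≤ dt * b * n ^ 2 * (36 / 25 * K ^ 2) := by gcongr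
      have e3 := mul_le_mul_of_nonneg_right hcfl (by positivity : 0 ≤ K * n)
      nlinarith [mul_nonneg (by linarith : 0 ≤ K) hn0]
    nlinarith
  -- contraction
  have contr : ∀ w w', ‖Φ w‖ ≤ K * n → ‖Φ w'‖ ≤ K * n →
      ‖Φ (T w - T w')‖ ≤ 1 / 2 * ‖Φ (w - w')‖ := by
    intro w w' hw hw'
    have h1 : ‖Φ (T w - T w')‖ ≤
        5 / 4 * (dt / 2 * (b * (1 / 2 * ‖Φ (w - w')‖) * ((K + 1) * n))) := by
      refine a_low (by positivity) fun v => ?_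
      have e : a (T w - T w') v = a (T w + u) v - a (T w' + u) v := by
        rw [← sub_apply, ← map_sub, add_sub_add_right_eq_sub]
      rw [e, hT, hT]
      have q := hQ ((2⁻¹ : ℝ) • (w + u)) ((2⁻¹ : ℝ) • (w' + u)) v
      have f1 : ‖Φ ((2⁻¹ : ℝ) • (w + u) - (2⁻¹ : ℝ) • (w' + u))‖ = 1 / 2 * ‖Φ (w - w')‖ := by
        rw [← smul_sub, add_sub_add_right_eq_sub, map_smul, norm_smul,
          Real.norm_of_nonneg (by norm_num)]
        norm_num
      have f2 : ‖Φ ((2⁻¹ : ℝ) • (w + u) + (2⁻¹ : ℝ) • (w' + u))‖ ≤ (K + 1) * n := by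
        rw [← smul_add, map_smul, norm_smul, Real.norm_of_nonneg (by norm_num), map_add, map_add,
          map_add]
        have := norm_add_le (Φ w + Φ u) (Φ w' + Φ u)
        have := norm_add_le (Φ w) (Φ u)
        have := norm_add_le (Φ w') (Φ u)
        linarith
      rw [f1] at q
      have q2 := q.trans (mul_le_mul_of_nonneg_right (mul_le_mul_of_nonneg_left f2
        (by positivity)) (norm_nonneg (Φ v)))
      have q3 := (le_abs_self _).trans q2
      have := mul_le_mul_of_nonneg_left q3 (by positivity : 0 ≤ dt / 2)
      linarith
    -- This yields the Lipschitz factor 5/16 · 1/5 = 1/16, well below 1/2.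
    have h2 : dt * b * ((K + 1) * n) ≤ 1 / 5 := by nlinarith
    have h3 := mul_le_mul_of_nonneg_right h2 (norm_nonneg (Φ (w - w')))
    nlinarith [norm_nonneg (Φ (w - w'))]
  have hu : ‖Φ u‖ ≤ K * n := by rw [← hn]; nlinarith
  have orbit : ∀ l, ‖Φ (T^[l] u)‖ ≤ K * n := fun l => by
    induction l with
    | zero => exact hu
    | succ l ih => rw [Function.iterate_succ_apply']; exact ball _ ih
  have geom : ∀ l, ‖Φ (T^[l + 1] u - T^[l] u)‖ ≤ ‖Φ (T u - u)‖ * (1 / 2) ^ l := fun l => by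
    induction l with
    | zero => simp
    | succ l ih =>
      rw [Function.iterate_succ_apply' _ (l + 1), Function.iterate_succ_apply' _ l (x := u)]
      rw [Function.iterate_succ_apply'] at ih
      have o := orbit (l + 1)
      rw [Function.iterate_succ_apply'] at o
      refine (contr _ _ o (orbit l)).trans ?_
      rw [pow_succ]
      linarith
  have hc₁ : ∀ x, ‖x‖ ≤ |c₁| * ‖Φ x‖ := fun x =>
    (hΦ x).trans (mul_le_mul_of_nonneg_right (le_abs_self _) (norm_nonneg _))
  have cau : CauchySeq fun l => T^[l] u := by
    refine cauchySeq_of_le_geometric (1 / 2) (|c₁| * ‖Φ (T u - u)‖) (by norm_num) fun l => ?_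
    rw [dist_comm, dist_eq_norm, mul_assoc]
    exact (hc₁ _).trans (mul_le_mul_of_nonneg_left (geom l) (abs_nonneg _))
  obtain ⟨x, hx⟩ := cauchySeq_tendsto_of_complete cau
  have hΦx : Tendsto (fun l => ‖Φ (T^[l] u - x)‖) atTop (𝓝 0) := by
    have h1 : Tendsto (fun l => T^[l] u - x) atTop (𝓝 0) := by
      simpa using hx.sub_const x
    simpa using ((Φ.continuous.tendsto 0).comp h1).norm
  have hxK : ‖Φ x‖ ≤ K * n :=
    le_of_tendsto (((Φ.continuous.tendsto x).comp hx).norm) (Eventually.of_forall orbit)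
  refine ⟨x, ?_, hxK, hΦx⟩
  -- The orbit and its limit lie in the ball, so the contraction estimate takes the place of
  -- continuity of T.
  have h2 : Tendsto (fun l => T^[l + 1] u - T x) atTop (𝓝 0) := by
    refine squeeze_zero_norm (a := fun l => |c₁| * (1 / 2) * ‖Φ (T^[l] u - x)‖) (fun l => ?_)
      (by simpa only [mul_zero] using hΦx.const_mul (|c₁| * (1 / 2)))
    rw [Function.iterate_succ_apply', mul_assoc]
    exact (hc₁ _).trans (mul_le_mul_of_nonneg_left (contr _ _ (orbit l) hxK) (abs_nonneg _))
  have h3 : Tendsto (fun l => T^[l + 1] u - T x) atTop (𝓝 (x - T x)) :=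
    ((tendsto_add_atTop_iff_nat 1).2 hx).sub_const _
  exact (sub_eq_zero.1 (tendsto_nhds_unique h3 h2)).symm

end Abstract
end FKdV

/-! ### Polynomials on the reference cell and piecewise polynomials -/

namespace FKdV

/-- Coefficient vectors of polynomials of degree at most `r`. -/
abbrev Coef (r : ℕ) := EuclideanSpace ℝ (Fin (r + 1))

variable {r : ℕ}

/-- The value at `y` of the polynomial with coefficients `a`. -/
def ev (a : Coef r) (y : ℝ) : ℝ := ∑ k, a k * y ^ (k : ℕ)

theorem ev_add (a b : Coef r) (y : ℝ) : ev (a + b) y = ev a y + ev b y := by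
  simp [ev, add_mul, Finset.sum_add_distrib]

theorem ev_smul (c : ℝ) (a : Coef r) (y : ℝ) : ev (c • a) y = c * ev a y := by
  simp [ev, Finset.mul_sum, mul_assoc]

theorem ev_zero_left (y : ℝ) : ev (0 : Coef r) y = 0 := by simp [ev]

theorem continuous_ev (a : Coef r) : Continuous (ev a) := by unfold ev; fun_prop

theorem continuous_ev_uncurry : Continuous fun p : Coef r × ℝ => ev p.1 p.2 := by
  unfold ev; fun_prop

/-- Coefficients of the derivative. -/
noncomputable def shift (r : ℕ) : Coef r →L[ℝ] Coef r :=
  LinearMap.toContinuousLinearMap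
    { toFun := fun a => WithLp.toLp 2 fun k =>
        if h : (k : ℕ) + 1 < r + 1 then ((k : ℕ) + 1) * a ⟨(k : ℕ) + 1, h⟩ else 0
      map_add' := fun a b => by
        ext k
        simp only [PiLp.add_apply]
        split_ifs <;> ring
      map_smul' := fun c a => by
        ext k
        simp only [PiLp.smul_apply, smul_eq_mul, RingHom.id_apply]
        split_ifs <;> ring }

theorem shift_apply (a : Coef r) (k : Fin (r + 1)) : shift r a k =
    if h : (k : ℕ) + 1 < r + 1 then ((k : ℕ) + 1) * a ⟨(k : ℕ) + 1, h⟩ else 0 := rfl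

theorem hasDerivAt_ev (a : Coef r) (y : ℝ) : HasDerivAt (ev a) (ev (shift r a) y) y := by
  have h : HasDerivAt (ev a) (∑ k : Fin (r + 1), a k * (((k : ℕ) : ℝ) * y ^ ((k : ℕ) - 1))) y := by
    unfold ev
    exact HasDerivAt.fun_sum fun k _ => (hasDerivAt_pow _ y).const_mul _
  refine h.congr_deriv ?_
  -- The k = 0 term of the differentiated sum and the last term of `ev (shift r a) y` vanish; the
  -- others agree after an index shift.
  rw [ev, Fin.sum_univ_succ, Fin.sum_univ_castSucc]
  simp only [shift_apply, Fin.val_zero, Fin.val_succ, Fin.val_castSucc, Fin.val_last,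
    lt_self_iff_false, dite_false, zero_mul, add_zero, Nat.cast_zero, mul_zero, zero_add]
  refine Finset.sum_congr rfl fun k _ => ?_
  rw [dif_pos (by omega)]
  simp only [Nat.add_sub_cancel, Nat.cast_add, Nat.cast_one]
  rw [← mul_assoc, mul_comm (a _)]
  rfl

theorem abs_ev_le (a : Coef r) {y : ℝ} (h0 : 0 ≤ y) (h1 : y ≤ 1) :
    |ev a y| ≤ (r + 1) * ‖a‖ := by
  refine (Finset.abs_sum_le_sum_abs _ _).trans ?_
  have : ∀ k ∈ Finset.univ, |a k * y ^ (k : ℕ)| ≤ ‖a‖ := fun k _ => by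
    rw [abs_mul, abs_of_nonneg (pow_nonneg h0 (k : ℕ))]
    have e1 : |a k| ≤ ‖a‖ := PiLp.norm_apply_le a k
    have e2 : y ^ (k : ℕ) ≤ 1 := pow_le_one₀ h0 h1
    nlinarith [abs_nonneg (a k), norm_nonneg a, pow_nonneg h0 (k : ℕ)]
  refine (Finset.sum_le_card_nsmul _ _ _ this).trans ?_
  simp

theorem eq_zero_of_ev {a : Coef r} (h : ∀ y ∈ Set.Icc (0 : ℝ) 1, ev a y = 0) : a = 0 := by
  set p : Polynomial ℝ := ∑ k : Fin (r + 1), Polynomial.monomial (k : ℕ) (a k) with hp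
  have hpe : ∀ y, p.eval y = ev a y := fun y => by
    simp [hp, ev, Polynomial.eval_finsetSum, Polynomial.eval_monomial]
  have hp0 : p = 0 := Polynomial.eq_zero_of_infinite_isRoot p <|
    (Set.Icc_infinite (zero_lt_one' ℝ)).mono fun y hy => by
      simp only [Set.mem_ofPred_eq, Polynomial.IsRoot, hpe, h y hy]
  ext k
  have := congrArg (fun q => q.coeff (k : ℕ)) hp0
  simp only [hp, Polynomial.finsetSum_coeff, Polynomial.coeff_monomial, Polynomial.coeff_zero] at this
  rw [Finset.sum_eq_single k] at this
  · simpa using this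
  · intro j _ hj
    rw [if_neg fun h => hj (Fin.ext h)]
  · simp

/-- Norm equivalence on polynomials of degree at most `r`. -/
theorem exists_ev_lower (r : ℕ) : ∃ κ : ℝ, 0 < κ ∧ ∀ a : Coef r,
    κ * ‖a‖ ^ 2 ≤ ∫ y in (0 : ℝ)..1, ev a y ^ 2 := by
  have hc : Continuous fun a : Coef r => ∫ y in (0 : ℝ)..1, ev a y ^ 2 :=
    intervalIntegral.continuous_parametric_intervalIntegral_of_continuous'
      (f := fun (a : Coef r) y => ev a y ^ 2) (continuous_ev_uncurry.pow 2) _ _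
  have hpos : ∀ a : Coef r, a ≠ 0 → 0 < ∫ y in (0 : ℝ)..1, ev a y ^ 2 := fun a ha => by
    have : ∃ y ∈ Set.Icc (0 : ℝ) 1, ev a y ≠ 0 := by
      by_contra! hcon
      exact ha (eq_zero_of_ev hcon)
    obtain ⟨y, hy, hne⟩ := this
    exact intervalIntegral.integral_pos zero_lt_one ((continuous_ev a).pow 2).continuousOn
      (fun _ _ => sq_nonneg _) ⟨y, hy, by positivity⟩
  have hne : (Metric.sphere (0 : Coef r) 1).Nonempty :=
    NormedSpace.sphere_nonempty.2 zero_le_one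
  -- The constant is the minimum over the compact unit sphere; homogeneity of degree 2 extends the
  -- bound to all a.
  obtain ⟨a₀, ha₀, hmin⟩ := (isCompact_sphere (0 : Coef r) 1).exists_isMinOn hne hc.continuousOn
  refine ⟨_, hpos a₀ (by rintro rfl; simp at ha₀), fun a => ?_⟩
  rcases eq_or_ne a 0 with rfl | ha
  · simp [ev_zero_left]
  have hn : 0 < ‖a‖ := norm_pos_iff.2 ha
  have h1 : (‖a‖⁻¹ • a) ∈ Metric.sphere (0 : Coef r) 1 := by
    rw [mem_sphere_zero_iff_norm, norm_smul, norm_inv, norm_norm, inv_mul_cancel₀ hn.ne']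
  have h2 := hmin h1
  simp only [Set.mem_ofPred_eq, ev_smul, mul_pow, intervalIntegral.integral_const_mul] at h2
  rw [inv_pow, ← div_eq_inv_mul, le_div_iff₀ (by positivity)] at h2
  exact h2

/-! ### Piecewise polynomials on a uniform grid -/

/-- The piecewise polynomial on the grid `dx ℤ` with coefficients `c m` on `[m dx, (m+1) dx)`. -/
noncomputable def spl (dx : ℝ) (c : ℤ → Coef r) (x : ℝ) : ℝ := ev (c ⌊x / dx⌋) (Int.fract (x / dx))

theorem spl_add (dx : ℝ) (c c' : ℤ → Coef r) : spl dx (c + c') = spl dx c + spl dx c' :=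
  funext fun _ => ev_add _ _ _

theorem spl_smul (dx : ℝ) (a : ℝ) (c : ℤ → Coef r) : spl dx (a • c) = a • spl dx c :=
  funext fun _ => ev_smul _ _ _

theorem spl_eq (dx : ℝ) (hdx : 0 < dx) (c : ℤ → Coef r) (m : ℤ) {x : ℝ}
    (hx : x ∈ Set.Ico (m * dx) ((m + 1) * dx)) : spl dx c x = ev (c m) (x / dx - m) := by
  have hf : ⌊x / dx⌋ = m := by
    rw [Int.floor_eq_iff, le_div_iff₀ hdx, div_lt_iff₀ hdx]
    exact hx
  rw [spl, Int.fract, hf]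

theorem mem_cell (dx : ℝ) (hdx : 0 < dx) (x : ℝ) :
    x ∈ Set.Ico ((⌊x / dx⌋ : ℝ) * dx) ((⌊x / dx⌋ + 1) * dx) := by
  constructor
  · rw [← le_div_iff₀ hdx]; exact Int.floor_le _
  · rw [← div_lt_iff₀ hdx]; exact Int.lt_floor_add_one _

theorem measurable_spl (dx : ℝ) (c : ℤ → Coef r) : Measurable (spl dx c) := by
  have h1 : Measurable fun x : ℝ => (⌊x / dx⌋, Int.fract (x / dx)) := by fun_prop
  have h2 : Measurable fun p : ℤ × ℝ => ev (c p.1) p.2 :=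
    measurable_from_prod_countable_right fun m => (continuous_ev (c m)).measurable
  exact h2.comp h1

/-- Coefficients of the derivative of `spl dx c`. -/
noncomputable def dcoef (dx : ℝ) (c : ℤ → Coef r) : ℤ → Coef r := fun m => dx⁻¹ • shift r (c m)

theorem hasDerivAt_cell (dx : ℝ) (c : ℤ → Coef r) (m : ℤ) (x : ℝ) :
    HasDerivAt (fun x => ev (c m) (x / dx - m)) (ev (dcoef dx c m) (x / dx - m)) x := by
  have := (hasDerivAt_ev (c m) (x / dx - m)).comp x (((hasDerivAt_id x).div_const dx).sub_const _)
  refine this.congr_deriv ?_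
  rw [dcoef, ev_smul, one_div, mul_comm]

theorem eventually_spl_eq (dx : ℝ) (hdx : 0 < dx) (c : ℤ → Coef r) (x : ℝ) :
    ∀ᶠ y in 𝓝[≥] x, spl dx c y = ev (c ⌊x / dx⌋) (y / dx - ⌊x / dx⌋) := by
  have h := mem_cell dx hdx x
  filter_upwards [Ico_mem_nhdsGE h.2] with y hy
  exact spl_eq dx hdx c _ ⟨h.1.trans hy.1, hy.2⟩

theorem hasDerivWithinAt_spl (dx : ℝ) (hdx : 0 < dx) (c : ℤ → Coef r) (x : ℝ) :
    HasDerivWithinAt (spl dx c) (spl dx (dcoef dx c) x) (Set.Ioi x) x := by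
  have h := (hasDerivAt_cell dx c ⌊x / dx⌋ x).hasDerivWithinAt (s := Set.Ici x)
  exact (h.congr_of_eventuallyEq (eventually_spl_eq dx hdx c x)
    (spl_eq dx hdx c _ (mem_cell dx hdx x))).mono Set.Ioi_subset_Ici_self

/-- The one-sided limits of `spl dx c` at the nodes agree. -/
def Matching (c : ℤ → Coef r) : Prop := ∀ m : ℤ, ev (c m) 1 = ev (c (m + 1)) 0

theorem tendsto_spl_left (dx : ℝ) (hdx : 0 < dx) (c : ℤ → Coef r) (m : ℤ) :
    Tendsto (spl dx c) (𝓝[<] ((m + 1) * dx)) (𝓝 (ev (c m) 1)) := by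
  have h : Tendsto (fun x => ev (c m) (x / dx - m)) (𝓝[<] ((m + 1) * dx)) (𝓝 (ev (c m) 1)) := by
    have hc : Continuous fun x : ℝ => ev (c m) (x / dx - m) :=
      (continuous_ev _).comp (by fun_prop)
    have := (hc.tendsto ((m + 1) * dx)).mono_left (nhdsWithin_le_nhds (s := Set.Iio ((m + 1) * dx)))
    rwa [mul_div_cancel_right₀ _ hdx.ne', add_sub_cancel_left] at this
  refine h.congr' ?_
  filter_upwards [Ico_mem_nhdsLT (show (m : ℝ) * dx < (m + 1) * dx by linarith)] with x hx
  exact (spl_eq dx hdx c m hx).symm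

theorem spl_node (dx : ℝ) (hdx : 0 < dx) (c : ℤ → Coef r) (m : ℤ) :
    spl dx c (m * dx) = ev (c m) 0 := by
  rw [spl_eq dx hdx c m ⟨le_rfl, by linarith⟩, mul_div_cancel_right₀ _ hdx.ne', sub_self]

theorem Matching.continuous {dx : ℝ} (hdx : 0 < dx) {c : ℤ → Coef r} (h : Matching c) :
    Continuous (spl dx c) := by
  refine continuous_iff_continuousAt.2 fun x => ?_
  have hr : ContinuousWithinAt (spl dx c) (Set.Ici x) x :=
    (((hasDerivAt_cell dx c ⌊x / dx⌋ x).continuousAt.continuousWithinAt).congr_of_eventuallyEq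
      (eventually_spl_eq dx hdx c x) (spl_eq dx hdx c _ (mem_cell dx hdx x)))
  refine continuousAt_iff_continuous_left'_right'.2 ⟨?_, hr.mono Set.Ioi_subset_Ici_self⟩
  set m := ⌊x / dx⌋
  have hm := mem_cell dx hdx x
  rcases hm.1.eq_or_lt with he | hlt
  · have t := tendsto_spl_left dx hdx c (m - 1)
    have e1 : (((m - 1 : ℤ) : ℝ) + 1) * dx = x := by
      push_cast; rw [sub_add_cancel]; exact he
    rw [e1, h (m - 1), sub_add_cancel] at t
    have e2 : spl dx c x = ev (c m) 0 := by rw [← he]; exact spl_node dx hdx c m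
    rw [ContinuousWithinAt, e2]
    exact t
  · refine ((hasDerivAt_cell dx c m x).continuousAt.continuousWithinAt).congr_of_eventuallyEq ?_
      (spl_eq dx hdx c _ hm)
    filter_upwards [Ico_mem_nhdsLT hlt] with y hy
    exact spl_eq dx hdx c _ ⟨hy.1, hy.2.trans hm.2⟩

theorem abs_spl_le (dx : ℝ) (c : ℤ → Coef r) (x : ℝ) :
    |spl dx c x| ≤ (r + 1) * ‖c ⌊x / dx⌋‖ :=
  abs_ev_le _ (Int.fract_nonneg _) (Int.fract_lt_one _).le

end FKdV

/-! ### Square summability, jumps and fractional regularity -/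

namespace FKdV

variable {r : ℕ}

theorem hasSum_cells {dx : ℝ} (hdx : 0 < dx) {f : ℝ → ℝ} (hf : Integrable f) :
    HasSum (fun m : ℤ => ∫ y in (0 : ℝ)..1, f (dx * (y + m))) (dx⁻¹ * ∫ x, f x) := by
  have h := (hf.comp_mul_left' hdx.ne').hasSum_intervalIntegral_comp_add_int
  rwa [Measure.integral_comp_mul_left, abs_of_pos (inv_pos.2 hdx)] at h

theorem floor_cell {dx : ℝ} (hdx : 0 < dx) (m : ℤ) {y : ℝ} (hy : y ∈ Set.Ico (0 : ℝ) 1) :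
    ⌊dx * (y + m) / dx⌋ = m := by
  rw [mul_div_cancel_left₀ _ hdx.ne', Int.floor_eq_iff]
  constructor <;> linarith [hy.1, hy.2]

theorem integral_Ico_congr {f g : ℝ → ℝ} (h : ∀ y ∈ Set.Ico (0 : ℝ) 1, f y = g y) :
    ∫ y in (0 : ℝ)..1, f y = ∫ y in (0 : ℝ)..1, g y := by
  rw [intervalIntegral.integral_of_le zero_le_one, intervalIntegral.integral_of_le zero_le_one,
    integral_Ioc_eq_integral_Ioo, integral_Ioc_eq_integral_Ioo]
  exact setIntegral_congr_fun measurableSet_Ioo fun y hy => h y ⟨hy.1.le, hy.2⟩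

theorem integrable_step {dx : ℝ} (hdx : 0 < dx) {h : ℤ → ℝ} (h0 : ∀ m, 0 ≤ h m)
    (hs : Summable h) : Integrable fun x => h ⌊x / dx⌋ := by
  have key : Integrable fun x : ℝ => h ⌊x⌋ := by
    rw [← integrableOn_univ, ← iUnion_Ico_intCast (α := ℝ)]
    have e : ∀ m : ℤ, Set.EqOn (fun x : ℝ => h ⌊x⌋) (fun _ => h m) (Set.Ico (m : ℝ) (m + 1)) :=
      fun m x hx => by simp only; rw [Int.floor_eq_iff.2 ⟨hx.1, hx.2⟩]
    refine integrableOn_iUnion_of_summable_integral_norm (fun m => ?_) ?_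
    · exact (integrableOn_congr_fun (e m) measurableSet_Ico).2 (by simp)
    · refine hs.congr fun m => ?_
      rw [setIntegral_congr_fun (g := fun _ => h m) measurableSet_Ico fun x hx => by
        rw [show h ⌊x⌋ = h m from e m hx, Real.norm_of_nonneg (h0 m)]]
      simp
  exact key.comp_div hdx.ne'

theorem integral_step {dx : ℝ} (hdx : 0 < dx) {h : ℤ → ℝ} (h0 : ∀ m, 0 ≤ h m)
    (hs : Summable h) : ∫ x, h ⌊x / dx⌋ = dx * ∑' m, h m := by
  have h1 := hasSum_cells hdx (integrable_step hdx h0 hs)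
  have e : (fun m : ℤ => ∫ y in (0 : ℝ)..1, h ⌊dx * (y + m) / dx⌋) = h := by
    ext m
    rw [integral_Ico_congr (g := fun _ => h m) fun y hy => by rw [floor_cell hdx m hy]]
    simp
  rw [e] at h1
  rw [h1.tsum_eq, mul_inv_cancel_left₀ hdx.ne']

theorem integral_cell_spl_sq {dx : ℝ} (hdx : 0 < dx) (c : ℤ → Coef r) (m : ℤ) :
    ∫ y in (0 : ℝ)..1, spl dx c (dx * (y + m)) ^ 2 = ∫ y in (0 : ℝ)..1, ev (c m) y ^ 2 := by
  refine integral_Ico_congr fun y hy => ?_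
  rw [spl, Int.fract, floor_cell hdx m hy, mul_div_cancel_left₀ _ hdx.ne', add_sub_cancel_right]

theorem spl_sq_le (dx : ℝ) (c : ℤ → Coef r) (x : ℝ) :
    spl dx c x ^ 2 ≤ ((r : ℝ) + 1) ^ 2 * ‖c ⌊x / dx⌋‖ ^ 2 := by
  rw [← sq_abs, ← mul_pow]
  exact pow_le_pow_left₀ (abs_nonneg _) (abs_spl_le dx c x) 2

theorem memLp_spl {dx : ℝ} (hdx : 0 < dx) {c : ℤ → Coef r} (hc : Summable fun m => ‖c m‖ ^ 2) :
    MemLp (spl dx c) 2 := by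
  rw [memLp_two_iff_integrable_sq (measurable_spl dx c).aestronglyMeasurable]
  refine Integrable.mono' ((integrable_step hdx (fun m => sq_nonneg ‖c m‖) hc).const_mul
    (((r : ℝ) + 1) ^ 2)) ((measurable_spl dx c).pow_const 2).aestronglyMeasurable
    (Eventually.of_forall fun x => ?_)
  rw [Real.norm_of_nonneg (sq_nonneg _)]
  exact spl_sq_le dx c x

theorem integral_spl_sq_le {dx : ℝ} (hdx : 0 < dx) {c : ℤ → Coef r}
    (hc : Summable fun m => ‖c m‖ ^ 2) :
    ∫ x, spl dx c x ^ 2 ≤ ((r : ℝ) + 1) ^ 2 * (dx * ∑' m, ‖c m‖ ^ 2) := by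
  rw [← integral_step hdx (fun m => sq_nonneg ‖c m‖) hc, ← integral_const_mul]
  exact integral_mono (memLp_spl hdx hc).integrable_sq
    ((integrable_step hdx (fun m => sq_nonneg ‖c m‖) hc).const_mul _) fun x => spl_sq_le dx c x

theorem summable_of_memLp_spl {dx : ℝ} (hdx : 0 < dx) {c : ℤ → Coef r}
    (h : MemLp (spl dx c) 2) : Summable fun m => ‖c m‖ ^ 2 := by
  obtain ⟨κ, hκ, hl⟩ := exists_ev_lower r
  have h1 := (hasSum_cells hdx h.integrable_sq).summable
  simp only [integral_cell_spl_sq hdx] at h1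
  refine (h1.mul_left κ⁻¹).of_nonneg_of_le (fun m => sq_nonneg _) fun m => ?_
  rw [← div_eq_inv_mul, le_div_iff₀ hκ, mul_comm]
  exact hl _

theorem le_integral_spl_sq {dx : ℝ} (hdx : 0 < dx) {κ : ℝ}
    (hl : ∀ a : Coef r, κ * ‖a‖ ^ 2 ≤ ∫ y in (0 : ℝ)..1, ev a y ^ 2) {c : ℤ → Coef r}
    (hc : Summable fun m => ‖c m‖ ^ 2) :
    κ * (dx * ∑' m, ‖c m‖ ^ 2) ≤ ∫ x, spl dx c x ^ 2 := by
  have h1 := hasSum_cells hdx (memLp_spl hdx hc).integrable_sq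
  simp only [integral_cell_spl_sq hdx] at h1
  have h2 := (hc.hasSum.mul_left κ)
  have h3 := hasSum_le (fun m => hl (c m)) h2 h1
  rw [inv_mul_eq_div, le_div_iff₀ hdx] at h3
  linarith

/-- A function in `H^{1/2}` has no jump discontinuity. -/
theorem FracMem.eq_of_tendsto_left {g : ℝ → ℝ} (hg : FracMem (1 / 2) g) {x₀ l : ℝ}
    (hr : ContinuousWithinAt g (Set.Ici x₀) x₀) (hl : Tendsto g (𝓝[<] x₀) (𝓝 l)) : l = g x₀ := by
  by_contra hne
  set J := |g x₀ - l| with hJ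
  have hJ0 : 0 < J := abs_pos.2 (sub_ne_zero.2 (Ne.symm hne))
  have e1 : ∀ᶠ y in 𝓝[≥] x₀, |g y - g x₀| < J / 4 := by
    have := Metric.tendsto_nhds.1 hr (J / 4) (by positivity)
    simpa [Real.dist_eq] using this
  have e2 : ∀ᶠ y in 𝓝[<] x₀, |g y - l| < J / 4 := by
    have := Metric.tendsto_nhds.1 hl (J / 4) (by positivity)
    simpa [Real.dist_eq] using this
  obtain ⟨b, hb, hb2⟩ := (mem_nhdsGE_iff_exists_Ico_subset).1 e1
  obtain ⟨a, ha, ha2⟩ := (mem_nhdsLT_iff_exists_Ioo_subset).1 e2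
  simp only [Set.mem_Iio, Set.mem_Ioi] at ha hb
  set η := min (b - x₀) (x₀ - a)
  have hη : 0 < η := lt_min (by linarith) (by linarith)
  -- For x in (x₀ - z, x₀), an interval of length z, the points x and x + z lie on opposite sides of
  -- the jump, so the increment is at least J/2 in modulus.
  have lower : ∀ z ∈ Set.Ioo 0 η, z * (J / 2) ^ 2 ≤ incr g z := by
    intro z hz
    have hzb : z < b - x₀ := hz.2.trans_le (min_le_left _ _)
    have hza : z < x₀ - a := hz.2.trans_le (min_le_right _ _)
    have hI := (memLp_increment hg.mem z).integrable_sq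
    calc z * (J / 2) ^ 2 = ∫ _ in Set.Ioo (x₀ - z) x₀, (J / 2) ^ 2 := by
          simp [hz.1.le]
      _ ≤ ∫ x in Set.Ioo (x₀ - z) x₀, (g (x + z) - g x) ^ 2 := by
          refine setIntegral_mono_on (by simp) hI.integrableOn measurableSet_Ioo fun x hx => ?_
          have h1 : |g (x + z) - g x₀| < J / 4 :=
            hb2 ⟨by linarith [hx.1], by linarith [hx.2]⟩
          have h2 : |g x - l| < J / 4 := ha2 ⟨by linarith [hx.1], hx.2⟩
          have h3 : J / 2 ≤ |g (x + z) - g x| := by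
            have t1 := abs_sub_abs_le_abs_sub (g x₀ - l) ((g x₀ - l) - (g (x + z) - g x))
            have t2 : |(g x₀ - l) - (g (x + z) - g x)| ≤ |g (x + z) - g x₀| + |g x - l| := by
              rw [show (g x₀ - l) - (g (x + z) - g x) = (g x - l) - (g (x + z) - g x₀) by ring]
              exact (abs_sub _ _).trans (by linarith)
            rw [sub_sub_cancel] at t1
            linarith
          rw [← sq_abs (g (x + z) - g x)]
          exact pow_le_pow_left₀ (by positivity) h3 2
      _ ≤ incr g z := setIntegral_le_integral hI (Eventually.of_forall fun x => sq_nonneg _)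
  -- For β = 1 the kernel is z^{-2}, so the lower bound would make 1/z integrable at 0.
  have fr := integrableOn_incr (β := 1) one_pos one_lt_two hg.mem hg.frac
  have i1 : IntegrableOn (fun z : ℝ => (J / 2) ^ 2 * z⁻¹) (Set.Ioo 0 η) := by
    refine Integrable.mono' (fr.mono_set Set.Ioo_subset_Ioi_self)
      (by fun_prop : Measurable _).aestronglyMeasurable ?_
    refine (ae_restrict_iff' measurableSet_Ioo).2 (Eventually.of_forall fun z hz => ?_)
    have hz0 : 0 < z := hz.1
    rw [Real.norm_of_nonneg (by positivity)]
    have h1 := mul_le_mul_of_nonneg_right (lower z hz) (Real.rpow_nonneg hz0.le (-1 - 1))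
    refine le_trans (le_of_eq ?_) h1
    rw [show (-1 - 1 : ℝ) = -(2 : ℕ) by norm_num, Real.rpow_neg hz0.le, Real.rpow_natCast]
    field_simp
  have i2 : IntegrableOn (fun z : ℝ => z⁻¹) (Set.Ioo 0 η) := by
    have := i1.const_mul (((J / 2) ^ 2)⁻¹)
    refine this.congr (Eventually.of_forall fun z => ?_)
    simp only
    rw [inv_mul_cancel_left₀ (by positivity)]
  have i3 : IntervalIntegrable (fun z : ℝ => z⁻¹) volume 0 η :=
    (intervalIntegrable_iff_integrableOn_Ioo_of_le hη.le).2 i2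
  rw [intervalIntegrable_inv_iff] at i3
  rcases i3 with h | h
  · exact hη.ne h
  · exact h Set.left_mem_uIcc

theorem FracMem.matching {dx : ℝ} (hdx : 0 < dx) {c : ℤ → Coef r}
    (h : FracMem (1 / 2) (spl dx c)) : Matching c := fun m => by
  have hn := spl_node dx hdx c (m + 1)
  push_cast at hn
  rw [← hn]
  refine h.eq_of_tendsto_left ?_ (tendsto_spl_left dx hdx c m)
  exact ((hasDerivAt_cell dx c _ _).continuousAt.continuousWithinAt).congr_of_eventuallyEq
      (eventually_spl_eq dx hdx c _) (spl_eq dx hdx c _ (mem_cell dx hdx _))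

theorem incr_le_four {f : ℝ → ℝ} (hf : MemLp f 2) (z : ℝ) : incr f z ≤ 4 * ∫ x, f x ^ 2 := by
  rw [incr_eq hf, ← norm_ft_sq hf, norm_sq_Lp, ← integral_const_mul]
  refine integral_mono (integrable_cos_mul_sq _ _) ((integrable_norm_sq_Lp _).const_mul _)
    fun ξ => ?_
  simp only
  gcongr
  linarith [Real.neg_one_le_cos (2 * Real.pi * z * ξ)]

/-- The counterpart to the absence of jumps in H^{1/2}: z · z^{-1-2s} is integrable at 0 exactly
when s < 1/2. For z > 1 boundedness of `incr` is enough. -/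
theorem fracMem_of_incr_le {f : ℝ → ℝ} (hf : MemLp f 2) {A s : ℝ}
    (hA : ∀ z, 0 < z → incr f z ≤ A * z) (h0 : 0 < s) (hs : s < 1 / 2) : FracMem s f := by
  refine ⟨hf, ?_⟩
  have hm := measurable_incr hf
  rw [show s = (2 * s) / 2 by ring, memLp_fracFourier_iff (by linarith) (by linarith) hf]
  set β := 2 * s with hβ
  suffices h : IntegrableOn (fun z => incr f z * z ^ (-1 - β)) (Set.Ioi 0) from h.lintegral_lt_top
  have m : Measurable fun z : ℝ => incr f z * z ^ (-1 - β) := by fun_prop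
  rw [← Set.Ioc_union_Ioi_eq_Ioi (zero_le_one' ℝ)]
  refine IntegrableOn.union ?_ ?_
  · have i1 : IntegrableOn (fun z : ℝ => z ^ (-β)) (Set.Ioc 0 1) :=
      (intervalIntegrable_iff_integrableOn_Ioc_of_le zero_le_one).1
        (intervalIntegral.intervalIntegrable_rpow' (by linarith))
    refine Integrable.mono' (i1.const_mul A) m.aestronglyMeasurable ?_
    refine (ae_restrict_iff' measurableSet_Ioc).2 (Eventually.of_forall fun z hz => ?_)
    have hp := Real.rpow_nonneg hz.1.le (-1 - β)
    rw [Real.norm_of_nonneg (mul_nonneg (incr_nonneg f z) hp)]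
    refine (mul_le_mul_of_nonneg_right (hA z hz.1) hp).trans (le_of_eq ?_)
    rw [mul_assoc, ← Real.rpow_one_add' hz.1.le (by linarith)]
    congr 2
    ring
  · have i1 : IntegrableOn (fun z : ℝ => z ^ (-1 - β)) (Set.Ioi 1) :=
      integrableOn_Ioi_rpow_of_lt (by linarith) one_pos
    refine Integrable.mono' (i1.const_mul (4 * ∫ x, f x ^ 2)) m.aestronglyMeasurable ?_
    refine (ae_restrict_iff' measurableSet_Ioi).2 (Eventually.of_forall fun z hz => ?_)
    have hz0 : (0 : ℝ) < z := lt_trans one_pos hz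
    have hp := Real.rpow_nonneg hz0.le (-1 - β)
    rw [Real.norm_of_nonneg (mul_nonneg (incr_nonneg f z) hp)]
    exact mul_le_mul_of_nonneg_right (incr_le_four hf z) hp

theorem abs_ev_sub_le (a : Coef r) {x y : ℝ} (hx : x ∈ Set.Icc (0 : ℝ) 1)
    (hy : y ∈ Set.Icc (0 : ℝ) 1) :
    |ev a y - ev a x| ≤ ((r + 1) * ‖shift r‖) * ‖a‖ * |y - x| := by
  have := Convex.norm_image_sub_le_of_norm_hasDerivWithin_le (f := ev a)
    (C := ((r + 1) * ‖shift r‖) * ‖a‖) (s := Set.Icc 0 1) (x := x) (y := y)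
    (fun t _ => (hasDerivAt_ev a t).hasDerivWithinAt) (fun t ht => by
      refine (abs_ev_le _ ht.1 ht.2).trans ?_
      rw [mul_assoc]
      gcongr
      exact (shift r).le_opNorm a) (convex_Icc _ _) hx hy
  simpa using this

/-- For y < 1 - t both points lie in one cell and the Lipschitz bound applies. For y ≥ 1 - t a node
is crossed and only size bounds are available, but these y fill a set of length t. -/
theorem incr_cell_le {dx : ℝ} (hdx : 0 < dx) {c : ℤ → Coef r} (hc : Summable fun m => ‖c m‖ ^ 2)
    {t : ℝ} (ht0 : 0 < t) (ht1 : t < 1) (m : ℤ) :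
    ∫ y in (0 : ℝ)..1, (spl dx c (dx * (y + m) + dx * t) - spl dx c (dx * (y + m))) ^ 2 ≤
      t * ((((r + 1) * ‖shift r‖) ^ 2 + 2 * ((r : ℝ) + 1) ^ 2) * ‖c m‖ ^ 2 +
        2 * ((r : ℝ) + 1) ^ 2 * ‖c (m + 1)‖ ^ 2) := by
  set f := fun y : ℝ => (spl dx c (dx * (y + m) + dx * t) - spl dx c (dx * (y + m))) ^ 2 with hf
  have e0 : ∀ y ∈ Set.Ico (0 : ℝ) 1, spl dx c (dx * (y + m)) = ev (c m) y := fun y hy => by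
    rw [spl, Int.fract, floor_cell hdx m hy, mul_div_cancel_left₀ _ hdx.ne', add_sub_cancel_right]
  have e1 : ∀ y ∈ Set.Ico (0 : ℝ) (1 - t),
      spl dx c (dx * (y + m) + dx * t) = ev (c m) (y + t) := fun y hy => by
    rw [show dx * (y + m) + dx * t = dx * ((y + t) + m) by ring]
    exact e0 (y + t) ⟨by linarith [hy.1], by linarith [hy.2]⟩
  have e2 : ∀ y ∈ Set.Ico (1 - t) 1, |spl dx c (dx * (y + m) + dx * t)| ≤ (r + 1) * ‖c (m + 1)‖ :=
    fun y hy => by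
      have := abs_spl_le dx c (dx * ((y + t - 1) + (m + 1 : ℤ)))
      rw [floor_cell hdx (m + 1) ⟨by linarith [hy.1], by linarith [hy.2]⟩] at this
      rwa [show dx * (y + m) + dx * t = dx * ((y + t - 1) + (m + 1 : ℤ)) by push_cast; ring]
  have hint : Integrable f := by
    have := (memLp_increment (memLp_spl hdx hc) (dx * t)).integrable_sq
    have := (this.comp_mul_left' hdx.ne').comp_add_right (m : ℝ)
    exact this
  have b1 : ‖∫ y in (0 : ℝ)..(1 - t), f y‖ ≤ (((r + 1) * ‖shift r‖) * ‖c m‖ * t) ^ 2 * |1 - t - 0| := by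
    refine intervalIntegral.norm_integral_le_of_norm_le_const_ae ?_
    filter_upwards [compl_mem_ae_iff.2 (measure_singleton (1 - t))] with y hne hy
    rw [Set.uIoc_of_le (by linarith)] at hy
    have hlt : y < 1 - t := lt_of_le_of_ne hy.2 hne
    rw [hf, Real.norm_of_nonneg (sq_nonneg _), e1 y ⟨hy.1.le, hlt⟩,
      e0 y ⟨hy.1.le, by linarith⟩, ← sq_abs]
    refine pow_le_pow_left₀ (abs_nonneg _) ?_ 2
    have := abs_ev_sub_le (c m) (x := y) (y := y + t) ⟨hy.1.le, by linarith⟩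
      ⟨by linarith [hy.1], by linarith⟩
    rwa [add_sub_cancel_left, abs_of_pos ht0] at this
  have b2 : ‖∫ y in (1 - t)..1, f y‖ ≤
      (2 * ((r : ℝ) + 1) ^ 2 * (‖c m‖ ^ 2 + ‖c (m + 1)‖ ^ 2)) * |1 - (1 - t)| := by
    refine intervalIntegral.norm_integral_le_of_norm_le_const_ae ?_
    filter_upwards [compl_mem_ae_iff.2 (measure_singleton (1 : ℝ))] with y hne hy
    rw [Set.uIoc_of_le (by linarith)] at hy
    have hlt : y < 1 := lt_of_le_of_ne hy.2 hne
    rw [hf, Real.norm_of_nonneg (sq_nonneg _)]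
    have p1 := e2 y ⟨hy.1.le, hlt⟩
    have p2 : |spl dx c (dx * (y + m))| ≤ (r + 1) * ‖c m‖ := by
      rw [e0 y ⟨by linarith [hy.1], hlt⟩]
      exact abs_ev_le _ (by linarith [hy.1]) hlt.le
    have p3 := (abs_sub (spl dx c (dx * (y + m) + dx * t)) (spl dx c (dx * (y + m)))).trans
      (add_le_add p1 p2)
    rw [← sq_abs]
    refine (pow_le_pow_left₀ (abs_nonneg _) p3 2).trans ?_
    nlinarith [sq_nonneg (((r : ℝ) + 1) * ‖c m‖ - ((r : ℝ) + 1) * ‖c (m + 1)‖)]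
  rw [← intervalIntegral.integral_add_adjacent_intervals (b := 1 - t) hint.intervalIntegrable
    hint.intervalIntegrable]
  rw [sub_sub_cancel, abs_of_pos ht0] at b2
  rw [sub_zero, abs_of_nonneg (by linarith)] at b1
  have b1' : (((r + 1) * ‖shift r‖) * ‖c m‖ * t) ^ 2 * (1 - t) ≤
      t * (((r + 1) * ‖shift r‖) ^ 2 * ‖c m‖ ^ 2) := by
    have h1 : t * (1 - t) ≤ 1 := by nlinarith
    have h2 := mul_le_mul_of_nonneg_left h1
      (by positivity : 0 ≤ t * (((r + 1) * ‖shift r‖) ^ 2 * ‖c m‖ ^ 2))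
    nlinarith
  have := (Real.le_norm_self _).trans b1
  have := (Real.le_norm_self _).trans b2
  nlinarith

theorem fracMem_spl {dx : ℝ} (hdx : 0 < dx) {c : ℤ → Coef r} (hc : Summable fun m => ‖c m‖ ^ 2)
    {s : ℝ} (h0 : 0 < s) (hs : s < 1 / 2) : FracMem s (spl dx c) := by
  have hf := memLp_spl hdx hc
  set P : ℤ → ℝ := fun m => (((r + 1) * ‖shift r‖) ^ 2 + 2 * ((r : ℝ) + 1) ^ 2) * ‖c m‖ ^ 2 +
        2 * ((r : ℝ) + 1) ^ 2 * ‖c (m + 1)‖ ^ 2 with hP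
  have hPs : Summable P :=
    (hc.mul_left _).add (((Equiv.addRight (1 : ℤ)).summable_iff.2 hc).mul_left _)
  have hP0 : 0 ≤ ∑' m, P m := tsum_nonneg fun m => by positivity
  have hI : 0 ≤ ∫ x, spl dx c x ^ 2 := integral_nonneg fun x => sq_nonneg _
  refine fracMem_of_incr_le hf (A := (∑' m, P m) + 4 * (∫ x, spl dx c x ^ 2) / dx) (fun z hz => ?_)
    h0 hs
  -- For z < Δx the cell bounds are summed; for z ≥ Δx the bound 4‖f‖² is already at most
  -- (4‖f‖²/Δx)z.
  rcases lt_or_ge z dx with hlt | hge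
  · have ht0 : 0 < z / dx := by positivity
    have ht1 : z / dx < 1 := (div_lt_one hdx).2 hlt
    have h1 := hasSum_cells hdx (memLp_increment hf z).integrable_sq
    have h2 := hPs.hasSum.mul_left (z / dx)
    have h3 := hasSum_le (fun m => by
      have := incr_cell_le hdx hc ht0 ht1 m
      rwa [mul_div_cancel₀ _ hdx.ne'] at this) h1 h2
    rw [← incr, inv_mul_le_iff₀ hdx, ← mul_assoc, mul_div_cancel₀ _ hdx.ne'] at h3
    have : 0 ≤ 4 * (∫ x, spl dx c x ^ 2) / dx * z := by positivity
    linarith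
  · refine (incr_le_four hf z).trans ?_
    have h1 : 4 * ∫ x, spl dx c x ^ 2 ≤ 4 * (∫ x, spl dx c x ^ 2) / dx * z := by
      rw [div_mul_eq_mul_div, le_div_iff₀ hdx]
      gcongr
    have : 0 ≤ (∑' m, P m) * z := by positivity
    linarith

theorem norm_dcoef_le (dx : ℝ) (c : ℤ → Coef r) (m : ℤ) :
    ‖dcoef dx c m‖ ≤ |dx⁻¹| * ‖shift r‖ * ‖c m‖ := by
  rw [dcoef, norm_smul, Real.norm_eq_abs, mul_assoc]
  gcongr
  exact (shift r).le_opNorm _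

theorem summable_dcoef (dx : ℝ) {c : ℤ → Coef r} (hc : Summable fun m => ‖c m‖ ^ 2) :
    Summable fun m => ‖dcoef dx c m‖ ^ 2 := by
  refine (hc.mul_left ((|dx⁻¹| * ‖shift r‖) ^ 2)).of_nonneg_of_le (fun m => sq_nonneg _) fun m => ?_
  rw [← mul_pow]
  exact pow_le_pow_left₀ (norm_nonneg _) (norm_dcoef_le dx c m) 2

theorem Matching.hasL2Deriv {dx : ℝ} (hdx : 0 < dx) {c : ℤ → Coef r} (h : Matching c)
    (hc : Summable fun m => ‖c m‖ ^ 2) : HasL2Deriv (spl dx c) (spl dx (dcoef dx c)) :=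
  ⟨h.continuous hdx, hasDerivWithinAt_spl dx hdx c, memLp_spl hdx hc,
    memLp_spl hdx (summable_dcoef dx hc)⟩

/-- The coefficients on the reference cell of the polynomial `p` on `[m dx, (m+1) dx]`. -/
noncomputable def polyCoef (r : ℕ) (dx : ℝ) (m : ℤ) (p : Polynomial ℝ) : Coef r :=
  WithLp.toLp 2 fun k => (p.comp (Polynomial.C dx * (Polynomial.X + Polynomial.C (m : ℝ)))).coeff k

theorem natDegree_comp_linear_le {p q : Polynomial ℝ} (hp : p.natDegree ≤ r)
    (hq : q.natDegree ≤ 1) : (p.comp q).natDegree ≤ r :=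
  Polynomial.natDegree_comp_le.trans ((Nat.mul_le_mul hp hq).trans (mul_one r).le)

theorem ev_polyCoef (dx : ℝ) (m : ℤ) {p : Polynomial ℝ} (hp : p.natDegree ≤ r) (y : ℝ) :
    ev (polyCoef r dx m p) y = p.eval (dx * (y + m)) := by
  have hd : (p.comp (Polynomial.C dx * (Polynomial.X + Polynomial.C (m : ℝ)))).natDegree ≤ r := by
    refine natDegree_comp_linear_le hp ?_
    compute_degree
  have h := Polynomial.eval_eq_sum_range' (Nat.lt_succ_of_le hd) y
  rw [Finset.sum_range] at h
  rw [Polynomial.eval_comp] at h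
  simp only [Polynomial.eval_mul, Polynomial.eval_C, Polynomial.eval_add, Polynomial.eval_X] at h
  exact h.symm

theorem exists_poly (dx : ℝ) (m : ℤ) (a : Coef r) : ∃ p : Polynomial ℝ, p.natDegree ≤ r ∧
    ∀ x, p.eval x = ev a (x / dx - m) := by
  set q : Polynomial ℝ := ∑ k : Fin (r + 1), Polynomial.monomial (k : ℕ) (a k) with hq
  have hqe : ∀ y, q.eval y = ev a y := fun y => by
    simp [hq, ev, Polynomial.eval_finsetSum, Polynomial.eval_monomial]
  have hqd : q.natDegree ≤ r := by
    refine Polynomial.natDegree_sum_le_of_forall_le _ _ fun k _ => ?_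
    exact (Polynomial.natDegree_monomial_le _).trans (Nat.lt_succ_iff.1 k.2)
  refine ⟨q.comp (Polynomial.C dx⁻¹ * Polynomial.X - Polynomial.C (m : ℝ)),
    natDegree_comp_linear_le hqd (by compute_degree), fun x => ?_⟩
  rw [Polynomial.eval_comp, hqe]
  simp only [Polynomial.eval_sub, Polynomial.eval_mul, Polynomial.eval_C, Polynomial.eval_X]
  rw [div_eq_inv_mul]

/-- The finite element space consists of the matching piecewise polynomials with square summable
coefficients. -/
theorem mem_femSpace_iff {α dx : ℝ} (hα : 1 ≤ α) (hα2 : α < 2) (hdx : 0 < dx) {v : ℝ → ℝ} :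
    v ∈ femSpace α r dx ↔ ∃ c : ℤ → Coef r, (Summable fun m => ‖c m‖ ^ 2) ∧ Matching c ∧
      Matching (dcoef dx c) ∧ (3 / 2 ≤ α → Matching (dcoef dx (dcoef dx c))) ∧ v = spl dx c := by
  constructor
  · rintro ⟨hH, hp⟩
    have hF := (memH_iff (by linarith)).1 hH
    choose p hpd hpe using hp
    -- The cell I_j starts at (j-1)Δx, while the coefficient index m refers to the cell starting at
    -- mΔx.
    set c : ℤ → Coef r := fun m => polyCoef r dx m (p (m + 1)) with hcdef
    have hev : ∀ (m : ℤ) (y : ℝ), y ∈ Set.Icc (0 : ℝ) 1 → v (dx * (y + m)) = ev (c m) y := by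
      intro m y hy
      rw [hcdef, ev_polyCoef dx m (hpd _)]
      refine hpe (m + 1) _ ⟨?_, ?_⟩
      · push_cast; nlinarith [hy.1]
      · push_cast; nlinarith [hy.2]
    have hv : v = spl dx c := by
      ext x
      rw [spl, ← hev _ _ ⟨Int.fract_nonneg _, (Int.fract_lt_one _).le⟩, Int.fract_add_floor,
        mul_div_cancel₀ _ hdx.ne']
    rw [hv] at hF
    have hc := summable_of_memLp_spl hdx hF.mem
    -- Adjacent closed cells share a node, so both polynomials take the value of v there. For the
    -- derivatives, matching comes from H^{1/2} regularity instead.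
    have m0 : Matching c := fun m => by
      rw [← hev m 1 ⟨zero_le_one, le_rfl⟩, ← hev (m + 1) 0 ⟨le_rfl, zero_le_one⟩]
      congr 2
      push_cast
      ring
    have d0 := m0.hasL2Deriv hdx hc
    have F1 : FracMem α (spl dx (dcoef dx c)) :=
      (d0.fracMem_iff (by linarith)).2 (by rwa [add_comm])
    have m1 : Matching (dcoef dx c) := (F1.mono (by norm_num) (by linarith)).matching hdx
    have d1 := m1.hasL2Deriv hdx (summable_dcoef dx hc)
    have F2 : FracMem (α - 1) (spl dx (dcoef dx (dcoef dx c))) :=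
      (d1.fracMem_iff (by linarith)).2 (by rwa [sub_add_cancel])
    exact ⟨c, hc, m0, m1, fun h => (F2.mono (by norm_num) (by linarith)).matching hdx, hv⟩
  · rintro ⟨c, hc, m0, m1, m2, rfl⟩
    have hc1 := summable_dcoef dx hc
    have hc2 := summable_dcoef dx hc1
    have F2 : FracMem (α - 1) (spl dx (dcoef dx (dcoef dx c))) := by
      rcases lt_or_ge α (3 / 2) with h | h
      -- The midpoint of α - 1 and 1/2 is positive also for α = 1, where α - 1 = 0.
      · exact (fracMem_spl hdx hc2 (s := (α - 1) / 2 + 1 / 4) (by linarith) (by linarith)).mono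
          (by linarith) (by linarith)
      · exact ((m2 h).hasL2Deriv hdx hc2).fracMem (by linarith) (by linarith)
    have F1 := ((m1.hasL2Deriv hdx hc1).fracMem_iff (by linarith)).1 F2
    rw [sub_add_cancel] at F1
    have F0 := ((m0.hasL2Deriv hdx hc).fracMem_iff (by linarith)).1 F1
    rw [add_comm] at F0
    refine ⟨(memH_iff (by linarith)).2 F0, fun j => ?_⟩
    obtain ⟨q, hqd, hqe⟩ := exists_poly dx (j - 1) (c (j - 1))
    refine ⟨q, hqd, fun x hx => ?_⟩
    rw [hqe]
    -- `spl` uses half-open cells: at the right endpoint it evaluates the next cell's polynomial,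
    -- and matching identifies the two values.
    rcases hx.2.eq_or_lt with he | hlt
    · rw [he, spl_node dx hdx, mul_div_cancel_right₀ _ hdx.ne']
      have := m0 (j - 1)
      rw [sub_add_cancel] at this
      rw [← this]
      congr 1
      push_cast
      ring
    · refine spl_eq dx hdx c (j - 1) ⟨by push_cast; exact hx.1, ?_⟩
      push_cast
      rwa [sub_add_cancel]

/-! ### The coefficient Hilbert space -/

/-- Square summable coefficient sequences. -/
noncomputable abbrev CoefL2 (r : ℕ) := lp (fun _ : ℤ => Coef r) 2

theorem summable_coef (c : CoefL2 r) : Summable fun m => ‖c m‖ ^ 2 := by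
  have := (memℓp_gen_iff (p := 2) (by norm_num)).1 (lp.memℓp c)
  simpa using this

theorem norm_sq_coef (c : CoefL2 r) : ‖c‖ ^ 2 = ∑' m, ‖c m‖ ^ 2 := by
  have := lp.norm_rpow_eq_tsum (p := 2) (by norm_num) c
  simpa using this

theorem memℓp_of_summable {c : ℤ → Coef r} (hc : Summable fun m => ‖c m‖ ^ 2) :
    Memℓp c 2 := (memℓp_gen_iff (by norm_num)).2 (by simpa using hc)

/-- Differentiation on coefficient sequences. -/
noncomputable def dcoefL (r : ℕ) (dx : ℝ) : CoefL2 r →L[ℝ] CoefL2 r :=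
  LinearMap.mkContinuous
    { toFun := fun c => ⟨dcoef dx c, memℓp_of_summable (summable_dcoef dx (summable_coef c))⟩
      map_add' := fun c c' => by
        ext1; funext m; simp only [lp.coeFn_add, Pi.add_apply, dcoef, map_add, smul_add]
      map_smul' := fun a c => by
        ext1; funext m
        simp only [lp.coeFn_smul, Pi.smul_apply, dcoef, map_smul, smul_comm a, RingHom.id_apply] }
    (|dx⁻¹| * ‖shift r‖) fun c => by
      refine abs_le_of_sq_le_sq' ?_ (by positivity) |>.2
      rw [norm_sq_coef, mul_pow, norm_sq_coef, ← tsum_mul_left]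
      refine Summable.tsum_le_tsum (fun m => ?_) (summable_dcoef dx (summable_coef c))
        ((summable_coef c).mul_left _)
      rw [← mul_pow]
      exact pow_le_pow_left₀ (norm_nonneg _) (norm_dcoef_le dx c m) 2

theorem dcoefL_coe (dx : ℝ) (c : CoefL2 r) : (dcoefL r dx c : ℤ → Coef r) = dcoef dx c := rfl

theorem continuous_coe_apply (m : ℤ) : Continuous fun c : CoefL2 r => (c : ℤ → Coef r) m :=
  (lp.evalCLM ℝ (fun _ : ℤ => Coef r) 2 m).continuous

theorem isClosed_matching : IsClosed {c : CoefL2 r | Matching (c : ℤ → Coef r)} := by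
  simp only [Matching, Set.ofPred_forall]
  refine isClosed_iInter fun m => isClosed_eq ?_ ?_
  · exact continuous_ev_uncurry.comp ((continuous_coe_apply m).prodMk continuous_const)
  · exact continuous_ev_uncurry.comp ((continuous_coe_apply (m + 1)).prodMk continuous_const)

/-- Matching coefficient sequences, as a submodule. -/
def matchingSubmodule (r : ℕ) : Submodule ℝ (CoefL2 r) where
  carrier := {c | Matching (c : ℤ → Coef r)}
  zero_mem' := fun m => by simp [ev_zero_left]
  add_mem' := fun {a b} ha hb m => by
    simp only [lp.coeFn_add, Pi.add_apply, ev_add, ha m, hb m]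
  smul_mem' := fun t a ha m => by
    simp only [lp.coeFn_smul, Pi.smul_apply, ev_smul, ha m]

/-- The coefficient sequences of the finite element space. -/
noncomputable def femCoef (α : ℝ) (r : ℕ) (dx : ℝ) : Submodule ℝ (CoefL2 r) :=
  matchingSubmodule r ⊓ (matchingSubmodule r).comap (dcoefL r dx).toLinearMap ⊓
    ⨅ _ : 3 / 2 ≤ α, (matchingSubmodule r).comap (dcoefL r dx ∘L dcoefL r dx).toLinearMap

theorem mem_femCoef {α dx : ℝ} {c : CoefL2 r} : c ∈ femCoef α r dx ↔ Matching (c : ℤ → Coef r) ∧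
    Matching (dcoef dx c) ∧ (3 / 2 ≤ α → Matching (dcoef dx (dcoef dx c))) := by
  simp only [femCoef, Submodule.mem_inf, Submodule.mem_iInf, Submodule.mem_comap, and_assoc]
  rfl

/-- Each node condition equates continuous functionals of the sequence, and differentiation is
bounded on ℓ² for fixed Δx. The resulting completeness is what Lax–Milgram needs. -/
theorem isClosed_femCoef (α : ℝ) (r : ℕ) (dx : ℝ) :
    IsClosed (femCoef α r dx : Set (CoefL2 r)) := by
  have h1 : IsClosed {c : CoefL2 r | Matching (dcoef dx c)} :=
    isClosed_matching.preimage (dcoefL r dx).continuous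
  have h2 : IsClosed {c : CoefL2 r | Matching (dcoef dx (dcoef dx c))} :=
    isClosed_matching.preimage (dcoefL r dx ∘L dcoefL r dx).continuous
  have e : (femCoef α r dx : Set (CoefL2 r)) = {c : CoefL2 r | Matching (c : ℤ → Coef r)} ∩
      ({c : CoefL2 r | Matching (dcoef dx c)} ∩
        ⋂ _ : 3 / 2 ≤ α, {c : CoefL2 r | Matching (dcoef dx (dcoef dx c))}) := by
    ext c
    simp only [SetLike.mem_coe, mem_femCoef, Set.mem_inter_iff, Set.mem_iInter]
    rfl
  rw [e]
  exact isClosed_matching.inter (h1.inter (isClosed_iInter fun _ => h2))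

instance (α : ℝ) (r : ℕ) (dx : ℝ) : CompleteSpace (femCoef α r dx) :=
  (isClosed_femCoef α r dx).completeSpace_coe

theorem mem_femSpace_iff_exists_femCoef {α dx : ℝ} (hα : 1 ≤ α) (hα2 : α < 2) (hdx : 0 < dx)
    {v : ℝ → ℝ} :
    v ∈ femSpace α r dx ↔ ∃ c : femCoef α r dx, v = spl dx (c : CoefL2 r) := by
  rw [mem_femSpace_iff hα hα2 hdx]
  constructor
  · rintro ⟨c, hc, m0, m1, m2, rfl⟩
    exact ⟨⟨⟨c, memℓp_of_summable hc⟩, mem_femCoef.2 ⟨m0, m1, m2⟩⟩, rfl⟩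
  · rintro ⟨c, rfl⟩
    obtain ⟨m0, m1, m2⟩ := mem_femCoef.1 c.2
    exact ⟨_, summable_coef c.1, m0, m1, m2, rfl⟩

end FKdV

/-! ### Weighted L² estimates -/

namespace FKdV

section Bounds

variable {R : ℝ} {φ : ℝ → ℝ}

theorem abs_integral_mul_le {f g : ℝ → ℝ} (hf : MemLp f 2) (hg : MemLp g 2) :
    |∫ x, f x * g x| ≤ Real.sqrt (∫ x, f x ^ 2) * Real.sqrt (∫ x, g x ^ 2) := by
  have hnorm : ∀ {h : ℝ → ℝ} (hh : MemLp h 2), ‖hh.toLp h‖ = Real.sqrt (∫ x, h x ^ 2) := by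
    intro h hh
    rw [@norm_eq_sqrt_real_inner, L2.inner_def]
    congr 1
    refine integral_congr_ae ?_
    filter_upwards [hh.coeFn_toLp] with x hx
    rw [hx]
    simp [sq]
  have := abs_real_inner_le_norm (hf.toLp f) (hg.toLp g)
  rw [hnorm, hnorm, L2.inner_def] at this
  refine le_trans (le_of_eq ?_) this
  congr 1
  refine integral_congr_ae ?_
  filter_upwards [hf.coeFn_toLp, hg.coeFn_toLp] with x h1 h2
  rw [h1, h2]
  simp [mul_comm]

theorem IsCutoff.exists_fracD_deriv_mul_le (h : IsCutoff R φ) : ∃ C, 0 ≤ C ∧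
    ∀ (s : ℝ) (w w' w'' : ℝ → ℝ), 0 ≤ s → s ≤ 1 → HasL2Deriv w w' → HasL2Deriv w' w'' →
      ‖fracD s (deriv (φ * w))‖ ^ 2 ≤ C * ((∫ x, w x ^ 2) + (∫ x, w' x ^ 2) + ∫ x, w'' x ^ 2) := by
  obtain ⟨M, hM0, hM, -⟩ := h.exists_bound
  set A := 2 + 2 * R with hA
  refine ⟨3 * (M ^ 2 + A ^ 2 + 5), by positivity, fun s w w' w'' h0 h1 hw hw' => ?_⟩
  have hq := h.hasL2Deriv_deriv_mul hw hw'
  refine (hq.norm_fracD_sq_le h0 h1).trans ?_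
  have i0 := hw.mem.integrable_sq
  have i1 := hw.mem'.integrable_sq
  have i2 := hw'.mem'.integrable_sq
  have i01 : Integrable fun x => w x ^ 2 + w' x ^ 2 := i0.add i1
  rw [← integral_add hq.mem.integrable_sq hq.mem'.integrable_sq, ← integral_add i0 i1,
    ← integral_add i01 i2, ← integral_const_mul]
  refine integral_mono (hq.mem.integrable_sq.add hq.mem'.integrable_sq)
    ((i01.add i2).const_mul _) fun x => ?_
  simp only [h.deriv_mul hw hw'.cont]
  have b1 : deriv φ x ^ 2 ≤ 1 := by
    rw [← sq_abs]; exact pow_le_one₀ (abs_nonneg _) (h.abs_deriv_le x)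
  have b2 : deriv (deriv φ) x ^ 2 ≤ M ^ 2 := by
    rw [← sq_abs]; exact pow_le_pow_left₀ (abs_nonneg _) (hM x) 2
  have b3 : φ x ^ 2 ≤ A ^ 2 := by
    rw [← sq_abs]; exact pow_le_pow_left₀ (abs_nonneg _) (h.abs_le x) 2
  have t1 : (deriv φ x * w x + φ x * w' x) ^ 2 ≤ 2 * w x ^ 2 + 2 * (A ^ 2 * w' x ^ 2) := by
    have e1 := mul_le_mul_of_nonneg_right b1 (sq_nonneg (w x))
    have e2 := mul_le_mul_of_nonneg_right b3 (sq_nonneg (w' x))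
    nlinarith [sq_nonneg (deriv φ x * w x - φ x * w' x)]
  have t2 : (deriv (deriv φ) x * w x + 2 * (deriv φ x * w' x) + φ x * w'' x) ^ 2 ≤
      3 * (M ^ 2 * w x ^ 2) + 12 * w' x ^ 2 + 3 * (A ^ 2 * w'' x ^ 2) := by
    have e1 := mul_le_mul_of_nonneg_right b2 (sq_nonneg (w x))
    have e2 := mul_le_mul_of_nonneg_right b1 (sq_nonneg (w' x))
    have e3 := mul_le_mul_of_nonneg_right b3 (sq_nonneg (w'' x))
    set p := deriv (deriv φ) x * w x with hp
    set q := deriv φ x * w' x with hq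
    set t := φ x * w'' x with ht
    have p2 : p ^ 2 ≤ M ^ 2 * w x ^ 2 := by rw [hp, mul_pow]; exact e1
    have q2 : q ^ 2 ≤ 1 * w' x ^ 2 := by rw [hq, mul_pow]; exact e2
    have s2 : t ^ 2 ≤ A ^ 2 * w'' x ^ 2 := by rw [ht, mul_pow]; exact e3
    nlinarith [sq_nonneg (p - 2 * q), sq_nonneg (p - t), sq_nonneg (2 * q - t)]
  have n0 := sq_nonneg (w x)
  have n1 := sq_nonneg (w' x)
  have n2 := sq_nonneg (w'' x)
  have n3 := sq_nonneg A
  have n4 := sq_nonneg M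
  refine (add_le_add t1 t2).trans ?_
  nlinarith [mul_nonneg n3 n0, mul_nonneg n3 n1, mul_nonneg n3 n2, mul_nonneg n4 n0,
    mul_nonneg n4 n1, mul_nonneg n4 n2]

theorem IsCutoff.sqrt_mul_memLp (h : IsCutoff R φ) {w : ℝ → ℝ} (hw : MemLp w 2) :
    MemLp (fun x => Real.sqrt (φ x) * w x) 2 :=
  MemLp.bdd_mul_cont (C := Real.sqrt (2 + 2 * R)) hw
    (Real.continuous_sqrt.comp h.differentiable.continuous) fun x => by
      rw [abs_of_nonneg (Real.sqrt_nonneg _)]; exact Real.sqrt_le_sqrt (h.le x)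

/-- Multiplication by the square root of the weight, with values in `L²`. -/
noncomputable def IsCutoff.sqrtMul (h : IsCutoff R φ) {w : ℝ → ℝ} (hw : MemLp w 2) :
    Lp ℝ 2 (volume : Measure ℝ) := (h.sqrt_mul_memLp hw).toLp _

theorem IsCutoff.inner_sqrtMul (h : IsCutoff R φ) {w v : ℝ → ℝ} (hw : MemLp w 2)
    (hv : MemLp v 2) : inner ℝ (h.sqrtMul hw) (h.sqrtMul hv) = ip w (φ * v) := by
  rw [L2.inner_def, ip]
  refine integral_congr_ae ?_
  filter_upwards [(h.sqrt_mul_memLp hw).coeFn_toLp, (h.sqrt_mul_memLp hv).coeFn_toLp] with x h1 h2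
  rw [sqrtMul, sqrtMul, h1, h2]
  have := Real.mul_self_sqrt (show 0 ≤ φ x by linarith [h.one_le x])
  simp only [RCLike.inner_apply, conj_trivial, Pi.mul_apply]
  linear_combination w x * v x * this

theorem IsCutoff.norm_sqrtMul (h : IsCutoff R φ) {w : ℝ → ℝ} (hw : MemLp w 2) :
    ‖h.sqrtMul hw‖ = wnorm φ w := by
  rw [norm_eq_sqrt_real_inner, h.inner_sqrtMul, wnorm, mul_comm φ w]

theorem IsCutoff.wnorm_sq (h : IsCutoff R φ) {w : ℝ → ℝ} (hw : MemLp w 2) :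
    wnorm φ w ^ 2 = ∫ x, φ x * w x ^ 2 := by
  rw [← h.norm_sqrtMul hw, ← real_inner_self_eq_norm_sq, h.inner_sqrtMul, ip]
  congr 1
  ext x
  simp only [Pi.mul_apply]
  ring

theorem IsCutoff.integral_sq_le_wnorm_sq (h : IsCutoff R φ) {w : ℝ → ℝ} (hw : MemLp w 2) :
    ∫ x, w x ^ 2 ≤ wnorm φ w ^ 2 := by
  rw [h.wnorm_sq hw]
  refine integral_mono hw.integrable_sq (hw.integrable_sq.bdd_mul
    h.differentiable.continuous.aestronglyMeasurable (Eventually.of_forall h.abs_le)) fun x => ?_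
  nlinarith [h.one_le x, sq_nonneg (w x)]

theorem IsCutoff.wnorm_sq_le (h : IsCutoff R φ) {w : ℝ → ℝ} (hw : MemLp w 2) :
    wnorm φ w ^ 2 ≤ (2 + 2 * R) * ∫ x, w x ^ 2 := by
  rw [h.wnorm_sq hw, ← integral_const_mul]
  refine integral_mono (hw.integrable_sq.bdd_mul
    h.differentiable.continuous.aestronglyMeasurable (Eventually.of_forall h.abs_le))
    (hw.integrable_sq.const_mul _) fun x => ?_
  exact mul_le_mul_of_nonneg_right (h.le x) (sq_nonneg _)

/-- Writing φ = √φ · √φ and giving one root to each of y and v, Cauchy–Schwarz produces the weighted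
norms with the constant A alone. This keeps C₂ independent of φ. -/
theorem IsCutoff.abs_integral_bdd_mul_le (h : IsCutoff R φ) {g y v : ℝ → ℝ} {A : ℝ}
    (hgm : Measurable g) (hg : ∀ x, |g x| ≤ A) (hy : MemLp y 2) (hv : MemLp v 2) :
    Integrable (fun x => g x * (y x * (φ x * v x))) ∧
    |∫ x, g x * (y x * (φ x * v x))| ≤ A * (wnorm φ y * wnorm φ v) := by
  have hA : 0 ≤ A := (abs_nonneg _).trans (hg 0)
  have hs := h.sqrt_mul_memLp hy
  have hsv := h.sqrt_mul_memLp hv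
  have hgs : MemLp (fun x => g x * (Real.sqrt (φ x) * y x)) 2 :=
    (hs.const_mul A).of_le (hgm.aestronglyMeasurable.mul hs.1) (Eventually.of_forall fun x => by
      rw [norm_mul, norm_mul A, Real.norm_of_nonneg hA]
      exact mul_le_mul_of_nonneg_right (hg x) (norm_nonneg _))
  have e : ∀ x, g x * (y x * (φ x * v x)) =
      (g x * (Real.sqrt (φ x) * y x)) * (Real.sqrt (φ x) * v x) := fun x => by
    have := Real.mul_self_sqrt (show 0 ≤ φ x by linarith [h.one_le x])
    linear_combination -(g x * y x * v x) * this
  simp_rw [e]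
  refine ⟨hgs.integrable_mul hsv, (abs_integral_mul_le hgs hsv).trans ?_⟩
  have n : ∀ {w : ℝ → ℝ} (hw : MemLp w 2), ∫ x, (Real.sqrt (φ x) * w x) ^ 2 = wnorm φ w ^ 2 := by
    intro w hw
    rw [h.wnorm_sq hw]
    congr 1
    ext x
    rw [mul_pow, Real.sq_sqrt (by linarith [h.one_le x])]
  have wn : ∀ w, 0 ≤ wnorm φ w := fun w => Real.sqrt_nonneg _
  rw [n hv, Real.sqrt_sq (wn v), ← mul_assoc]
  refine mul_le_mul_of_nonneg_right ?_ (wn v)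
  refine Real.sqrt_le_iff.2 ⟨mul_nonneg hA (wn y), ?_⟩
  rw [mul_pow, ← n hy, ← integral_const_mul]
  refine integral_mono hgs.integrable_sq (hs.integrable_sq.const_mul _) fun x => ?_
  simp only
  rw [mul_pow]
  refine mul_le_mul_of_nonneg_right ?_ (sq_nonneg _)
  rw [← sq_abs]
  exact pow_le_pow_left₀ (abs_nonneg _) (hg x) 2

/-- The convection term, estimated after integration by parts. -/
theorem IsCutoff.abs_convection_le (h : IsCutoff R φ) {x x' y y' v v' : ℝ → ℝ} {A B B' : ℝ}
    (hx : HasL2Deriv x x') (hy : HasL2Deriv y y') (hv : HasL2Deriv v v') (hv' : Continuous v')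
    (mx : Measurable x') (my : Measurable y')
    (hA : ∀ t, |x t| ≤ A) (hB : ∀ t, |x' t| ≤ B) (hB' : ∀ t, |y' t| ≤ B') :
    Integrable (fun t => x t * y t * deriv (φ * v) t) ∧
    |∫ t, x t * y t * deriv (φ * v) t| ≤
      B * (wnorm φ y * wnorm φ v) + B' * (wnorm φ x * wnorm φ v) := by
  have hq := h.hasL2Deriv_mul hv
  have hqd := h.deriv_mul hv hv'
  obtain ⟨i1, l1⟩ := h.abs_integral_bdd_mul_le mx hB hy.mem hv.mem
  obtain ⟨i2, l2⟩ := h.abs_integral_bdd_mul_le my hB' hx.mem hv.mem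
  obtain ⟨i0, -⟩ := h.abs_integral_bdd_mul_le hx.cont.measurable hA hy.mem hv.mem
  have i3 : Integrable fun t => x t * (y t * deriv (φ * v) t) := by
    have : Integrable fun t => y t * deriv (φ * v) t := by
      rw [hqd]; exact hy.mem.integrable_mul hq.mem'
    exact this.bdd_mul hx.cont.aestronglyMeasurable (Eventually.of_forall hA)
  have i3' : Integrable fun t => x t * y t * deriv (φ * v) t := by simpa only [mul_assoc] using i3
  refine ⟨i3', ?_⟩
  have i12 : Integrable fun t => x' t * (y t * (φ t * v t)) + y' t * (x t * (φ t * v t)) :=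
    i1.add i2
  -- The derivative is moved off φv, so neither φ_x nor v' enters the bound.
  have z := integral_right_deriv_eq_zero (G := fun t => x t * (y t * (φ t * v t)))
    (G' := fun t => (x' t * (y t * (φ t * v t)) + y' t * (x t * (φ t * v t))) +
      x t * y t * deriv (φ * v) t)
    (hx.cont.mul (hy.cont.mul (h.differentiable.continuous.mul hv.cont))) (fun t => by
      refine ((hx.deriv t).mul ((hy.deriv t).mul (hq.deriv t))).congr_deriv ?_
      simp only [hqd, Pi.mul_apply]
      ring) i0 (i12.add i3')
  rw [integral_add i12 i3', integral_add i1 i2] at z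
  have e : ∫ t, x t * y t * deriv (φ * v) t =
      -((∫ t, x' t * (y t * (φ t * v t))) + ∫ t, y' t * (x t * (φ t * v t))) := by linarith
  rw [e, abs_neg]
  exact (abs_add_le _ _).trans (add_le_add l1 l2)

end Bounds
end FKdV

/-! ### The forms of the scheme on the coefficient space -/

namespace FKdV

section Forms

variable {r : ℕ} {α dx R : ℝ} {φ : ℝ → ℝ}

theorem le_sqrt_mul {x A y : ℝ} (hy : 0 ≤ y) (h : x ^ 2 ≤ A * y ^ 2) : x ≤ Real.sqrt A * y := by
  have := Real.le_sqrt_of_sq_le h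
  rwa [Real.sqrt_mul' _ (sq_nonneg y), Real.sqrt_sq hy] at this

/-- The finite element function with given coefficients. -/
noncomputable def fem (α : ℝ) (r : ℕ) (dx : ℝ) : femCoef α r dx →ₗ[ℝ] (ℝ → ℝ) where
  toFun c := spl dx (c : CoefL2 r)
  map_add' _ _ := spl_add _ _ _
  map_smul' _ _ := spl_smul _ _ _

/-- The derivative of a finite element function. -/
noncomputable def dfem (c : femCoef α r dx) : ℝ → ℝ := spl dx (dcoefL r dx c)

/-- The second derivative of a finite element function. -/
noncomputable def ddfem (c : femCoef α r dx) : ℝ → ℝ := spl dx (dcoefL r dx (dcoefL r dx c))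

theorem hasL2Deriv_fem (hdx : 0 < dx) (c : femCoef α r dx) :
    HasL2Deriv (fem α r dx c) (dfem c) :=
  (mem_femCoef.1 c.2).1.hasL2Deriv hdx (summable_coef _)

theorem hasL2Deriv_dfem (hdx : 0 < dx) (c : femCoef α r dx) : HasL2Deriv (dfem c) (ddfem c) :=
  (mem_femCoef.1 c.2).2.1.hasL2Deriv hdx (summable_coef (dcoefL r dx c))

/-- Serves only for continuity of the embedding and of the dispersive form, so the dependence of N
on Δx is harmless. -/
theorem exists_integral_fem_sq_le (α : ℝ) (r : ℕ) (hdx : 0 < dx) :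
    ∃ N, 0 ≤ N ∧ ∀ c : femCoef α r dx, (∫ x, fem α r dx c x ^ 2) + (∫ x, dfem c x ^ 2) +
      (∫ x, ddfem c x ^ 2) ≤ N * ‖c‖ ^ 2 := by
  have hb : ∀ c : CoefL2 r, ∫ x, spl dx c x ^ 2 ≤ ((r : ℝ) + 1) ^ 2 * dx * ‖c‖ ^ 2 := fun c => by
    rw [norm_sq_coef, mul_assoc]
    exact integral_spl_sq_le hdx (summable_coef c)
  have hd : ∀ c : CoefL2 r, ‖dcoefL r dx c‖ ^ 2 ≤ ‖dcoefL r dx‖ ^ 2 * ‖c‖ ^ 2 := fun c => by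
    rw [← mul_pow]
    exact pow_le_pow_left₀ (norm_nonneg _) ((dcoefL r dx).le_opNorm c) 2
  set N := ((r : ℝ) + 1) ^ 2 * dx
  set D := ‖dcoefL r dx‖ ^ 2
  have hN : 0 ≤ N := by positivity
  have hD : 0 ≤ D := by positivity
  refine ⟨N + N * D + N * (D * D), by positivity, fun c => ?_⟩
  have h0 := hb c
  have h1 := (hb (dcoefL r dx c)).trans (mul_le_mul_of_nonneg_left (hd c) hN)
  have h2 := (hb (dcoefL r dx (dcoefL r dx c))).trans (mul_le_mul_of_nonneg_left
    ((hd _).trans (mul_le_mul_of_nonneg_left (hd c) hD)) hN)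
  refine (add_le_add (add_le_add h0 h1) h2).trans (le_of_eq ?_)
  rw [Submodule.coe_norm]
  ring

/-- The embedding of the coefficient space into `L²` by the weighted norm. -/
theorem IsCutoff.exists_embedding (h : IsCutoff R φ) (α : ℝ) (r : ℕ) (hdx : 0 < dx) :
    ∃ Φ : femCoef α r dx →L[ℝ] Lp ℝ 2 (volume : Measure ℝ),
      (∀ c c', inner ℝ (Φ c) (Φ c') = ip (fem α r dx c) (φ * fem α r dx c')) ∧
      ∀ c, ‖Φ c‖ = wnorm φ (fem α r dx c) := by
  obtain ⟨N, -, hN⟩ := exists_integral_fem_sq_le α r hdx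
  have hm := fun c : femCoef α r dx => (hasL2Deriv_fem hdx c).mem
  refine ⟨LinearMap.mkContinuous
    { toFun := fun c => h.sqrtMul (hm c)
      map_add' := fun c c' => ?_
      map_smul' := fun a c => ?_ } (Real.sqrt ((2 + 2 * R) * N)) fun c => ?_,
    fun c c' => h.inner_sqrtMul (hm c) (hm c'), fun c => h.norm_sqrtMul (hm c)⟩
  · rw [sqrtMul, sqrtMul, sqrtMul, ← MemLp.toLp_add]
    congr 1
    ext x
    simp only [map_add, Pi.add_apply]
    ring
  · rw [sqrtMul, sqrtMul, RingHom.id_apply, ← MemLp.toLp_const_smul]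
    congr 1
    ext x
    simp only [map_smul, Pi.smul_apply, smul_eq_mul]
    ring
  · refine le_sqrt_mul (norm_nonneg _) ?_
    have hR : 0 ≤ 2 + 2 * R := by linarith [h.one_le 0, h.le 0]
    rw [LinearMap.coe_mk, AddHom.coe_mk, h.norm_sqrtMul, mul_assoc]
    refine (h.wnorm_sq_le (hm c)).trans (mul_le_mul_of_nonneg_left ((?_ : _ ≤ _).trans (hN c)) hR)
    rw [add_assoc]
    exact le_add_of_nonneg_right (by positivity)

/-- Since φ ≥ 1, the weighted norm dominates the L² norm, which controls the coefficients cell by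
cell; rescaling to [0, 1] gives the factor Δx^{-1/2}. -/
theorem norm_coef_le (hdx : 0 < dx) {κ : ℝ} (hκ : 0 < κ)
    (hl : ∀ a : Coef r, κ * ‖a‖ ^ 2 ≤ ∫ y in (0 : ℝ)..1, ev a y ^ 2) (h : IsCutoff R φ)
    (c : femCoef α r dx) : ‖c‖ ≤ Real.sqrt (κ * dx)⁻¹ * wnorm φ (fem α r dx c) := by
  refine le_sqrt_mul (Real.sqrt_nonneg _) ?_
  rw [inv_mul_eq_div, le_div_iff₀ (by positivity), Submodule.coe_norm, norm_sq_coef]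
  have h1 := le_integral_spl_sq hdx hl (summable_coef (c : CoefL2 r))
  have h2 := h.integral_sq_le_wnorm_sq (hasL2Deriv_fem hdx c).mem
  refine le_trans (le_of_eq ?_) (h1.trans h2)
  ring

theorem abs_fem_le (c : femCoef α r dx) (x : ℝ) : |fem α r dx c x| ≤ (r + 1) * ‖c‖ :=
  (abs_spl_le dx _ x).trans (mul_le_mul_of_nonneg_left
    (lp.norm_apply_le_norm (by norm_num) (c : CoefL2 r) _) (by positivity))

theorem abs_dfem_le (hdx : 0 < dx) (c : femCoef α r dx) (x : ℝ) :
    |dfem c x| ≤ (r + 1) * (dx⁻¹ * ‖shift r‖ * ‖c‖) := by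
  refine (abs_spl_le dx _ x).trans (mul_le_mul_of_nonneg_left ?_ (by positivity))
  rw [dcoefL_coe]
  refine (norm_dcoef_le dx _ _).trans ?_
  rw [abs_of_pos (inv_pos.2 hdx)]
  exact mul_le_mul_of_nonneg_left (lp.norm_apply_le_norm (by norm_num) (c : CoefL2 r) _)
    (by positivity)

/-- The inverse inequality for the derivative. -/
theorem exists_abs_dfem_le (r : ℕ) : ∃ B : ℝ, 0 < B ∧ ∀ (α dx R : ℝ) (φ : ℝ → ℝ), 0 < dx →
    IsCutoff R φ → ∀ (c : femCoef α r dx) (x : ℝ),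
      |dfem c x| ≤ B / dx ^ (3 / 2 : ℝ) * wnorm φ (fem α r dx c) := by
  obtain ⟨κ, hκ, hl⟩ := exists_ev_lower r
  -- The factors bound values by coefficients, differentiation on the reference cell, and
  -- coefficients by the L² norm; the + 1 makes B positive. Of Δx^{-3/2}, one power comes from the
  -- derivative and a half from the L² scaling.
  refine ⟨(r + 1) * ‖shift r‖ * Real.sqrt κ⁻¹ + 1, by positivity,
    fun α dx R φ hdx h c x => (abs_dfem_le hdx c x).trans ?_⟩
  have hp : dx ^ (3 / 2 : ℝ) = dx * Real.sqrt dx := by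
    rw [show (3 / 2 : ℝ) = 1 + 1 / 2 by norm_num, Real.rpow_add hdx, Real.rpow_one,
      Real.sqrt_eq_rpow]
  have hs := Real.sqrt_pos.2 hdx
  have hw : 0 ≤ wnorm φ (fem α r dx c) := Real.sqrt_nonneg _
  have hn := norm_coef_le hdx hκ hl h c
  rw [mul_inv, Real.sqrt_mul' _ (by positivity), Real.sqrt_inv dx] at hn
  calc (r + 1) * (dx⁻¹ * ‖shift r‖ * ‖c‖)
      ≤ (r + 1) * (dx⁻¹ * ‖shift r‖ *
        (Real.sqrt κ⁻¹ * (Real.sqrt dx)⁻¹ * wnorm φ (fem α r dx c))) := by gcongr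
    _ = (r + 1) * ‖shift r‖ * Real.sqrt κ⁻¹ / (dx * Real.sqrt dx) *
        wnorm φ (fem α r dx c) := by field_simp
    _ ≤ _ := by
        rw [hp]
        gcongr
        linarith

theorem IsCutoff.deriv_mul_fem_add (h : IsCutoff R φ) (hdx : 0 < dx) (c c' : femCoef α r dx) :
    deriv (φ * fem α r dx (c + c')) =
      deriv (φ * fem α r dx c) + deriv (φ * fem α r dx c') := by
  have hd := fun c : femCoef α r dx =>
    h.deriv_mul (hasL2Deriv_fem hdx c) (hasL2Deriv_dfem hdx c).cont
  rw [hd, hd, hd]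
  ext x
  simp only [dfem, Submodule.coe_add, map_add, lp.coeFn_add, spl_add, Pi.add_apply]
  ring

theorem IsCutoff.deriv_mul_fem_smul (h : IsCutoff R φ) (hdx : 0 < dx) (a : ℝ)
    (c : femCoef α r dx) :
    deriv (φ * fem α r dx (a • c)) = a • deriv (φ * fem α r dx c) := by
  have hd := fun c : femCoef α r dx =>
    h.deriv_mul (hasL2Deriv_fem hdx c) (hasL2Deriv_dfem hdx c).cont
  rw [hd, hd]
  ext x
  simp only [dfem, Submodule.coe_smul, map_smul, lp.coeFn_smul, spl_smul, Pi.smul_apply,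
    smul_eq_mul]
  ring

/-- The dispersive form on the coefficient space. -/
theorem IsCutoff.exists_dispersion (h : IsCutoff R φ) (hα : 1 ≤ α) (hα2 : α < 2) (r : ℕ)
    (hdx : 0 < dx) : ∃ d : femCoef α r dx →L[ℝ] femCoef α r dx →L[ℝ] ℝ,
      ∀ c c', d c c' = fracInner (α / 2) (fem α r dx c) (deriv (φ * fem α r dx c')) := by
  obtain ⟨N, hN0, hN⟩ := exists_integral_fem_sq_le α r hdx
  obtain ⟨C, hC0, hC⟩ := h.exists_fracD_deriv_mul_le
  have h0 : 0 ≤ α / 2 := by linarith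
  have h1 : α / 2 ≤ 1 := by linarith
  have d0 := fun c : femCoef α r dx => hasL2Deriv_fem hdx c
  have d1 := fun c : femCoef α r dx => hasL2Deriv_dfem hdx c
  have fl := fun c => (d0 c).fracMem h0 h1
  have fr := fun c => (h.hasL2Deriv_deriv_mul (d0 c) (d1 c)).fracMem h0 h1
  refine ⟨LinearMap.mkContinuous₂ (LinearMap.mk₂ ℝ
    (fun c c' => fracInner (α / 2) (fem α r dx c) (deriv (φ * fem α r dx c'))) ?_ ?_ ?_ ?_)
    (Real.sqrt N * Real.sqrt (C * N)) ?_, fun c c' => rfl⟩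
  · intro c c' e
    rw [map_add, fracInner_add_left (fl c) (fl c')]
  · intro a c e
    rw [map_smul, fracInner_smul_left a (fl c), smul_eq_mul]
  · intro e c c'
    rw [h.deriv_mul_fem_add hdx, fracInner_add_right (fr c) (fr c')]
  · intro a e c
    rw [h.deriv_mul_fem_smul hdx, fracInner_smul_right a (fr c), smul_eq_mul]
  · intro c c'
    rw [LinearMap.mk₂_apply, Real.norm_eq_abs]
    refine (abs_fracInner_le _ _ _).trans ?_
    have e1 : ‖fracD (α / 2) (fem α r dx c)‖ ≤ Real.sqrt N * ‖c‖ := by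
      refine le_sqrt_mul (norm_nonneg _) (((d0 c).norm_fracD_sq_le h0 h1).trans
        ((?_ : _ ≤ _).trans (hN c)))
      exact le_add_of_nonneg_right (by positivity)
    have e2 : ‖fracD (α / 2) (deriv (φ * fem α r dx c'))‖ ≤ Real.sqrt (C * N) * ‖c'‖ := by
      refine le_sqrt_mul (norm_nonneg _) ((hC _ _ _ _ h0 h1 (d0 c') (d1 c')).trans ?_)
      rw [mul_assoc]
      exact mul_le_mul_of_nonneg_left (hN c') hC0
    refine (mul_le_mul e1 e2 (norm_nonneg _) (by positivity)).trans (le_of_eq ?_)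
    ring

/-- The convective form on the coefficient space. -/
theorem IsCutoff.exists_convection (h : IsCutoff R φ) (hdx : 0 < dx) {B : ℝ}
    (hB : ∀ (c : femCoef α r dx) (x : ℝ), |dfem c x| ≤ B * wnorm φ (fem α r dx c)) :
    ∃ Q : femCoef α r dx → femCoef α r dx →L[ℝ] ℝ,
      (∀ e c, Q e c = ip (fun x => fem α r dx e x ^ 2) (deriv (φ * fem α r dx c))) ∧
      ∀ x y c, |Q x c - Q y c| ≤ 2 * B * wnorm φ (fem α r dx (x - y)) *
        wnorm φ (fem α r dx (x + y)) * wnorm φ (fem α r dx c) := by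
  obtain ⟨Φ, -, hΦ⟩ := h.exists_embedding α r hdx
  have d0 := fun c : femCoef α r dx => hasL2Deriv_fem hdx c
  have d1 := fun c : femCoef α r dx => hasL2Deriv_dfem hdx c
  have hc := fun x y c : femCoef α r dx => h.abs_convection_le (d0 x) (d0 y) (d0 c) (d1 c).cont
    (d1 x).cont.measurable (d1 y).cont.measurable (abs_fem_le x) (hB x) (hB y)
  have hi : ∀ e c : femCoef α r dx,
      Integrable fun x => fem α r dx e x ^ 2 * deriv (φ * fem α r dx c) x := fun e c => by
    simpa only [sq] using (hc e e c).1
  refine ⟨fun e => LinearMap.mkContinuous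
    { toFun := fun c => ip (fun x => fem α r dx e x ^ 2) (deriv (φ * fem α r dx c))
      map_add' := fun c c' => ?_
      map_smul' := fun a c => ?_ } (2 * (B * wnorm φ (fem α r dx e) ^ 2) * ‖Φ‖) fun c => ?_,
    fun e c => rfl, fun x y c => ?_⟩
  · rw [ip, ip, ip, ← integral_add (hi e c) (hi e c'), h.deriv_mul_fem_add hdx]
    congr 1
    ext x
    exact mul_add _ _ _
  · rw [ip, ip, RingHom.id_apply, smul_eq_mul, ← integral_const_mul, h.deriv_mul_fem_smul hdx]
    congr 1
    ext x
    simp only [Pi.smul_apply, smul_eq_mul]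
    ring
  · have := (hc e e c).2
    simp only [LinearMap.coe_mk, AddHom.coe_mk, ip, sq, Real.norm_eq_abs]
    refine this.trans ?_
    have hB0 : 0 ≤ B * wnorm φ (fem α r dx e) := (abs_nonneg _).trans (hB e 0)
    have hw : 0 ≤ wnorm φ (fem α r dx e) := Real.sqrt_nonneg _
    have hn := mul_le_mul_of_nonneg_left (Φ.le_opNorm c) (mul_nonneg hB0 hw)
    rw [hΦ] at hn
    nlinarith [hn]
  -- Since x² - y² = (x - y)(x + y), the convection estimate applies to the two factors.
  · have := (hc (x - y) (x + y) c).2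
    simp only [LinearMap.mkContinuous_apply, LinearMap.coe_mk, AddHom.coe_mk, ip]
    rw [← integral_sub (hi x c) (hi y c)]
    refine le_trans (le_of_eq ?_) (this.trans (le_of_eq ?_))
    · congr 2
      ext t
      simp only [map_add, map_sub, Pi.add_apply, Pi.sub_apply]
      ring
    · ring

end Forms
end FKdV

/-! ### The theorem -/

open FKdV

theorem mainTheorem4 (r : ℕ) (hr : 2 ≤ r) :
    ∃ C₂ : ℝ, 0 < C₂ ∧
      ∀ (α : ℝ), 1 ≤ α → α < 2 →
      ∀ (R : ℝ) (φ : ℝ → ℝ), 0 < R → FKdV.IsCutoff R φ →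
      ∃ dt₀ : ℝ, 0 < dt₀ ∧
        ∀ (dx dt lam L K : ℝ) (u : ℝ → ℝ),
          0 < dx → 0 < dt → dt ≤ dt₀ →
          lam = dt / dx ^ (3 / 2 : ℝ) →
          0 < L → L < 1 → K = (5 - L) / (1 - L) →
          u ∈ FKdV.femSpace α r dx →
          lam * (2 * Real.sqrt C₂ * K * FKdV.wnorm φ u) ≤ L →
          (∃ w : ℕ → ℝ → ℝ, FKdV.IsIteration α r dx dt φ u w) ∧
          ∃ unext : ℝ → ℝ,
            FKdV.SolvesCN α r dx dt φ u unext ∧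
            (∀ w : ℕ → ℝ → ℝ, FKdV.IsIteration α r dx dt φ u w →
              Tendsto (fun l => FKdV.wnorm φ (w l - unext)) atTop (𝓝 0)) ∧
            FKdV.wnorm φ unext ≤ K * FKdV.wnorm φ u := by
  obtain ⟨B, hB0, hB⟩ := exists_abs_dfem_le r
  -- With √C₂ = 10B the CFL condition reads Δt · 2BΔx^{-3/2} · K‖u‖ ≤ L/10, which gives the
  -- smallness required by `exists_scheme`.
  refine ⟨(10 * B) ^ 2, by positivity, fun α hα hα2 R φ _ h => ?_⟩
  obtain ⟨C, hC0, hC⟩ := h.fracInner_lower hα hα2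
  -- Ensures C Δt ≤ 1/5; C + 1 allows for C = 0.
  refine ⟨1 / (5 * (C + 1)), by positivity, ?_⟩
  intro dx dt lam L K u hdx hdt hdt0 hlam hL hL1 hK hu hcfl
  have mem_iff : ∀ {v : ℝ → ℝ}, v ∈ femSpace α r dx ↔ ∃ c, v = fem α r dx c :=
    mem_femSpace_iff_exists_femCoef hα hα2 hdx
  obtain ⟨u, rfl⟩ := mem_iff.1 hu
  rw [Real.sqrt_sq (by positivity)] at hcfl
  obtain ⟨κ, hκ, hl⟩ := exists_ev_lower r
  obtain ⟨Φ, hΦi, hΦ⟩ := h.exists_embedding α r hdx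
  obtain ⟨d, hd⟩ := h.exists_dispersion hα hα2 r hdx
  obtain ⟨Q, hQ, hQb⟩ := h.exists_convection hdx (hB α dx R φ hdx h)
  have hK5 : 5 ≤ K := by rw [hK, le_div_iff₀] <;> linarith
  obtain ⟨T, hT, x, hx, hxK, hlim⟩ := exists_scheme Φ (c₁ := Real.sqrt (κ * dx)⁻¹)
    (fun c => by rw [hΦ]; exact norm_coef_le hdx hκ hl h c) d (C := C) (fun c => by
      rw [hd, hΦ]
      refine le_trans (neg_le_neg (mul_le_mul_of_nonneg_left
        (h.integral_sq_le_wnorm_sq (hasL2Deriv_fem hdx c).mem) hC0))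
        (hC _ _ _ (hasL2Deriv_fem hdx c) (hasL2Deriv_dfem hdx c)))
    Q (b := 2 * (B / dx ^ (3 / 2 : ℝ))) (by positivity) (by
      ext c
      rw [hQ, map_zero]
      simp [ip]) (fun x y c => by simpa only [hΦ] using hQb x y c) hdt (K := K) (by
      have h1 := mul_le_mul_of_nonneg_left hdt0 hC0
      refine h1.trans ?_
      rw [mul_one_div, div_le_div_iff₀ (by positivity) (by norm_num)]
      linarith) hK5 u (by
      rw [hΦ]
      rw [hlam] at hcfl
      have e : dt * (2 * (B / dx ^ (3 / 2 : ℝ))) * K * wnorm φ (fem α r dx u) =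
        dt / dx ^ (3 / 2 : ℝ) * (2 * (10 * B) * K * wnorm φ (fem α r dx u)) / 10 := by ring
      rw [e]
      linarith)
  have hhalf : ∀ a b : femCoef α r dx, fem α r dx ((2⁻¹ : ℝ) • (a + b)) =
      fun t => (fem α r dx a t + fem α r dx b t) / 2 := fun a b => by
    ext t
    simp only [map_smul, map_add, Pi.smul_apply, Pi.add_apply, smul_eq_mul]
    ring
  have step : ∀ a b : femCoef α r dx, (∀ v ∈ femSpace α r dx,
      ip (fem α r dx b) (φ * v)
        - dt / 2 * ip (fun t => ((fem α r dx a t + fem α r dx u t) / 2) ^ 2) (deriv (φ * v))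
        + dt * fracInner (α / 2) (fun t => (fem α r dx b t + fem α r dx u t) / 2)
          (deriv (φ * v)) = ip (fem α r dx u) (φ * v)) ↔ b = T a := fun a b => by
    rw [← hT a b]
    simp only [mem_iff, forall_exists_index, forall_eq_apply_imp_iff, hΦi, hQ, hd, hhalf]
  refine ⟨⟨fun l => fem α r dx (T^[l] u), rfl, fun l => mem_iff.2 ⟨_, rfl⟩, fun l =>
    (step _ _).2 (Function.iterate_succ_apply' T l u)⟩, fem α r dx x, ⟨mem_iff.2 ⟨x, rfl⟩,
    fun v hv => ?_⟩, fun w hw => ?_, by simpa only [hΦ] using hxK⟩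
  -- At a fixed point the iteration is the scheme itself, once the factor 1/2 moves inside the inner
  -- product.
  · rw [← (step x x).2 hx.symm v hv]
    congr 2
    simp only [ip, ← integral_const_mul]
    congr 1
    ext t
    ring
  · obtain ⟨hw0, hwm, hws⟩ := hw
    -- Each step determines its iterate, so an arbitrary sequence of iterates is the orbit of u
    -- under T.
    have hwT : ∀ l, w l = fem α r dx (T^[l] u) := fun l => by
      induction l with
      | zero => exact hw0
      | succ l ih =>
        obtain ⟨c, hc⟩ := mem_iff.1 (hwm (l + 1))
        have := hws l
        rw [hc, ih] at this
        rw [hc, Function.iterate_succ_apply', (step _ c).1 this]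
    simpa only [hwT, ← map_sub, hΦ] using hlim
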